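/- **Conventions.** Let $c>0$. Work in coordinates $(x^0,x^1,x^2,x^3)$ with $x^0=ct$, on a tube $V=\mathbb R\times B(x,R)$ over an open Euclidean coordinate ball in $\mathbb R^3$. A *static metric* on $V$ is a smooth metric $g$ of signature $(-,+,+,+)$ whose components do not depend on $x^0$, with $g_{0i}=0$, $g_{00}<0$ and $(g_{ij})$ positive definite ($i,j=1,2,3$). For $\varepsilon>0$, $g$ is *$\varepsilon$-gently curved at scale $R$* if on $V$, for all indices, $$|g_{\mu\nu}-\eta_{\mu\nu}|\le\varepsilon,\qquad R\,|\partial_\alpha g_{\mu\nu}|\le\varepsilon,\qquad R^2\,|\partial_\alpha\partial_\beta g_{\mu\nu}|\le\varepsilon ,\qquad \eta=\mathrm{diag}(-1,1,1,1).$$ An *open machine* is a smooth future-pointing timelike worldline $A:\mathbb R\to V$ parametrized by the readings of its clock; its *ticks* are the integer readings. A *signal* from an event to another is a future-pointing null geodesic in $V$ joining them. Machines $A,B$ are *radar linkable* if each event of either one is reached by exactly one null geodesic in $V$ coming from the worldline of the other, and is joined to that worldline by exactly one outgoing future-pointing null geodesic in $V$. A *channel with null phases* from $A$ to $B$ is an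 endlessly repeating, order-preserving set of pairs $(m,n)$ of integers such that a signal leads from $A(m)$ to $B(n)$. Given channels from $A$ to $B$ and from $B$ to $A$, the *echo count* of $A$ at the reading $m$ is $\Delta$ if a signal sent by $A$ at $m$ is received by $B$ at some reading $n$, and the first signal that $B$ can transmit back, at a reading $n'\ge n$, reaches $A$ at the reading $m+\Delta$. A *two-way channel with echo counts $\Delta$* is a pair of channels with null phases, one in each direction, for which the echo counts of both machines at every tick are $\Delta$. A *tetrahedral arrangement* with data $(N,p,x)$ consists of four distinct (with disjoint worldlines), pairwise radar linkable open machines $V_1,\dots,V_4$ in $V$, each at fixed spatial coordinates, with a two-way channel with echo counts $2N$ for each of the six pairs, where $V_1$ is located at $x$ and successive ticks of $V_1$ are separated by proper time $p$. **Proposition.** There is a universal constant $\varepsilon>0$ such that the following holds for all $c,p>0$, all integers $N\ge1$, all $R\ge 2cNp$, all $x\in\mathbb R^3$, and all static metrics $g$ on $V=\mathbb R\times B(x,R)$ that are $\varepsilon$-gently curved at scale $R$. 1. A tetrahedral arrangement with data $(N,p,x)$ exists in $V$. 2. For every such tetrahedral arrangement $V_1,\dots,V_4$ and any three of its four machines,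 there is a fifth open machine $V_5$ in $V$ at fixed spatial coordinates, distinct from $V_1,\dots,V_4$ and radar linkable with each of them, that has a two-way channel with echo counts $2N$ with each of the three chosen machines. The five machines thus form an arrangement with nine two-way channels with null phases, all with echo counts $2N$. -/

import Mathlib

open scoped ContDiff

noncomputable section

/-- Coordinates `(x⁰, x¹, x², x³)` of an event; `x⁰ = c t` is the time coordinate multiplied by
the speed of light. -/
abbrev Event : Type := Fin 4 → ℝ

/-- A curve in spacetime. For an open machine the parameter is the reading of its clock. -/
abbrev Worldline : Type := ℝ → Event

/-- The components `g_{μν}` of a metric tensor field, of signature `(-,+,+,+)`. -/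
abbrev MetricField : Type := Event → Matrix (Fin 4) (Fin 4) ℝ

/-- The partial derivative `∂_μ f`. -/
def partialDeriv (μ : Fin 4) (f : Event → ℝ) (q : Event) : ℝ :=
  fderiv ℝ f q (Pi.single μ 1)

/-- The inner product `g_{μν} v^μ w^ν` at the event `q`. -/
def metricForm (g : MetricField) (q v w : Event) : ℝ :=
  ∑ μ, ∑ ν, g q μ ν * v μ * w ν

/-- Christoffel symbols of the first kind,
`Γ_{μαβ} = (∂_α g_{μβ} + ∂_β g_{μα} - ∂_μ g_{αβ}) / 2`. -/
def christoffel (g : MetricField) (q : Event) (μ α β : Fin 4) : ℝ :=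
  (partialDeriv α (fun r => g r μ β) q + partialDeriv β (fun r => g r μ α) q
    - partialDeriv μ (fun r => g r α β) q) / 2

/-- The spacetime tube `ℝ × B(x, R)` over the open coordinate ball of centre `x`, radius `R`. -/
def tube (x : Fin 3 → ℝ) (R : ℝ) : Set Event :=
  {q | ∑ i : Fin 3, (q i.succ - x i) ^ 2 < R ^ 2 ∧ 0 < R}

/-- `g` is a smooth static Lorentzian metric on `V`, in adapted coordinates: the components do
not depend on time, there are no time-space cross terms, `∂/∂x⁰` is timelike, and the spatial
part is positive definite. -/
structure IsStaticMetric (V : Set Event) (g : MetricField) : Prop where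
  smooth : ∀ μ ν, ContDiffOn ℝ ∞ (fun q => g q μ ν) V
  symm : ∀ q ∈ V, ∀ μ ν, g q μ ν = g q ν μ
  stationary : ∀ q ∈ V, ∀ t : ℝ, g (Function.update q 0 t) = g q
  orthogonal : ∀ q ∈ V, ∀ i : Fin 3, g q 0 i.succ = 0
  timelike : ∀ q ∈ V, g q 0 0 < 0
  spacelike : ∀ q ∈ V, ∀ v : Fin 3 → ℝ, v ≠ 0 →
    0 < ∑ i, ∑ j, g q i.succ j.succ * v i * v j

/-- The Minkowski metric `diag(-1, 1, 1, 1)`. -/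
def minkowski : Matrix (Fin 4) (Fin 4) ℝ := Matrix.diagonal ![-1, 1, 1, 1]

/-- Gentle curvature on `V` at the length scale `R`, with tolerance `ε`: the coordinates are
Minkowskian up to `ε`, the first derivatives of the metric are at most `ε / R`, and the second
derivatives, which carry the Riemann curvature, are at most `ε / R ^ 2`. -/
def IsGentle (V : Set Event) (R ε : ℝ) (g : MetricField) : Prop :=
  ∀ q ∈ V, ∀ μ ν, |g q μ ν - minkowski μ ν| ≤ ε ∧
    (∀ α, R * |partialDeriv α (fun r => g r μ ν) q| ≤ ε) ∧
    ∀ α β, R ^ 2 * |partialDeriv α (partialDeriv β (fun r => g r μ ν)) q| ≤ ε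

/-- `γ`, with affine parameter running over `[0, 1]`, is a future-pointing null geodesic of `g`
that stays in `V`; `v` and `a` are its first and second derivatives, and the geodesic equation
is written with the free index lowered. -/
def IsNullGeodesic (g : MetricField) (V : Set Event) (γ : Worldline) : Prop :=
  ∃ v a : ℝ → Event, ∀ s ∈ Set.Icc (0 : ℝ) 1,
    γ s ∈ V ∧
    HasDerivWithinAt γ (v s) (Set.Icc 0 1) s ∧
    HasDerivWithinAt v (a s) (Set.Icc 0 1) s ∧
    (∀ μ, ∑ ν, g (γ s) μ ν * a s ν +
      ∑ α, ∑ β, christoffel g (γ s) μ α β * v s α * v s β = 0) ∧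
    metricForm g (γ s) (v s) (v s) = 0 ∧
    0 < v s 0

/-- A light signal leaves the event `P` and arrives at the event `Q`. -/
def Signal (g : MetricField) (V : Set Event) (P Q : Event) : Prop :=
  ∃ γ, IsNullGeodesic g V γ ∧ γ 0 = P ∧ γ 1 = Q

/-- An open machine, represented by a smooth future-pointing timelike worldline in `V`
parametrized by clock readings. As `x⁰` has positive derivative along it, it is an embedding. -/
structure IsOpenMachine (g : MetricField) (V : Set Event) (A : Worldline) : Prop where
  smooth : ContDiff ℝ ∞ A
  mem : ∀ ζ, A ζ ∈ V
  timelike : ∀ ζ, metricForm g (A ζ) (deriv A ζ) (deriv A ζ) < 0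
  future : ∀ ζ, 0 < deriv A ζ 0

/-- The worldline stays at the spatial coordinates `x`. -/
def IsAtRest (A : Worldline) (x : Fin 3 → ℝ) : Prop :=
  ∀ ζ, ∀ i : Fin 3, A ζ i.succ = x i

/-- Proper time along `A` from reading `a` to reading `b`. -/
def properTime (g : MetricField) (c : ℝ) (A : Worldline) (a b : ℝ) : ℝ :=
  (1 / c) * ∫ ζ in a..b, Real.sqrt (-metricForm g (A ζ) (deriv A ζ) (deriv A ζ))

/-- Successive ticks (integer readings) of `A` are separated by the proper time `p`. -/
def HasProperPeriod (g : MetricField) (c : ℝ) (A : Worldline) (p : ℝ) : Prop :=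
  ∀ k : ℤ, properTime g c A k (k + 1) = p

/-- Exactly one future-pointing null geodesic in `V` leads from the set `S` to the set `T`. -/
def UniqueNullGeodesic (g : MetricField) (V S T : Set Event) : Prop :=
  ∃ γ, (IsNullGeodesic g V γ ∧ γ 0 ∈ S ∧ γ 1 ∈ T) ∧
    ∀ δ, IsNullGeodesic g V δ → δ 0 ∈ S → δ 1 ∈ T → Set.EqOn δ γ (Set.Icc 0 1)

/-- Radar linkability: each event of either machine is joined to the worldline of the other by
exactly one incoming and exactly one outgoing null geodesic in `V`. -/
def RadarLinkable (g : MetricField) (V : Set Event) (A B : Worldline) : Prop :=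
  (∀ ζ, UniqueNullGeodesic g V (Set.range B) {A ζ} ∧
    UniqueNullGeodesic g V {A ζ} (Set.range B)) ∧
  (∀ ζ, UniqueNullGeodesic g V (Set.range A) {B ζ} ∧
    UniqueNullGeodesic g V {B ζ} (Set.range A))

/-- `C` is an order preserving, endlessly repeating channel from `A` to `B` with null phases: a
set of pairs (transmission reading of `A`, reception reading of `B`), all integers, each carried
by a light signal. -/
structure IsNullPhaseChannel (g : MetricField) (V : Set Event) (A B : Worldline)
    (C : Set (ℝ × ℝ)) : Prop where
  carried : ∀ q ∈ C, Signal g V (A q.1) (B q.2)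
  nullPhases : ∀ q ∈ C, ∃ m n : ℤ, q = ((m : ℝ), (n : ℝ))
  orderPreserving : ∀ q ∈ C, ∀ r ∈ C, q.1 < r.1 → q.2 < r.2
  repeating : ∃ m n j k : ℤ, 0 < j ∧ 0 < k ∧
    ∀ l : ℤ, (((m + l * j : ℤ) : ℝ), ((n + l * k : ℤ) : ℝ)) ∈ C

/-- The echo count at the `A`-reading `m` is `Δ`: a signal sent to `B` at `m` is received at the
`B`-reading `n`, and the first signal that `B` can transmit back, at the least transmission
reading `n' ≥ n`, reaches `A` at the reading `m + Δ`. -/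
def HasEchoCount (AB BA : Set (ℝ × ℝ)) (m Δ : ℝ) : Prop :=
  ∃ n n', (m, n) ∈ AB ∧ IsLeast {s | n ≤ s ∧ ∃ r, (s, r) ∈ BA} n' ∧ (n', m + Δ) ∈ BA

/-- `A` and `B` are linked by a two-way channel with null phases whose echo counts, from `A` and
from `B`, at every tick, are `Δ`. -/
def TwoWayChannel (g : MetricField) (V : Set Event) (A B : Worldline) (Δ : ℝ) : Prop :=
  ∃ AB BA : Set (ℝ × ℝ), IsNullPhaseChannel g V A B AB ∧ IsNullPhaseChannel g V B A BA ∧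
    (∀ m : ℤ, HasEchoCount AB BA m Δ) ∧ (∀ m : ℤ, HasEchoCount BA AB m Δ)

/-- The machines `M i`, fixed to space coordinates, distinct and pairwise radar linkable, form an
arrangement in which each edge of `G` is a two-way channel with echo counts `Δ`. -/
structure IsArrangement (g : MetricField) (V : Set Event) {ι : Type} (M : ι → Worldline)
    (G : SimpleGraph ι) (Δ : ℝ) : Prop where
  machine : ∀ i, IsOpenMachine g V (M i)
  atRest : ∀ i, ∃ x, IsAtRest (M i) x
  distinct : ∀ i j, i ≠ j → Disjoint (Set.range (M i)) (Set.range (M j))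
  radar : ∀ i j, i ≠ j → RadarLinkable g V (M i) (M j)
  channel : ∀ i j, G.Adj i j → TwoWayChannel g V (M i) (M j) Δ

/-- A tetrahedral arrangement in `V`: four machines, all six pairs linked by two-way channels
with echo counts `2 N`, machine `0` being at `x` and stepped with the proper period `p`. -/
structure IsTetrahedral (g : MetricField) (V : Set Event) (c p : ℝ) (N : ℕ) (x : Fin 3 → ℝ)
    (M : Fin 4 → Worldline) : Prop where
  arrangement : IsArrangement g V M ⊤ (2 * N)
  position : IsAtRest (M 0) x
  period : HasProperPeriod g c (M 0) p

end

/-! Light rays of a static metric can be studied in space alone. The null condition expresses the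
time component of the velocity through the spatial ones, so the spatial projection of a null
geodesic solves an autonomous second order equation, quadratic in the velocity and with coefficients
of size `ε`. Lapse times `x⁰`-velocity is a conserved energy, hence the elapsed `x⁰` is this energy
times the integral of the inverse lapse. Conversely, a ray with distinct ends lifts to a null
geodesic starting at any prescribed time. What remains is the geometry of travel times in a ball of
`ℝ³`, and the arithmetic of ticks.

Rays: two points of the ball of radius `9 / 10 * R` are joined by a ray in the ball of radius `R`,
by a contraction argument (`IsSpray.exists_curve`). Uniqueness has to hold against every ray that
stays in the ball, however fast. Convexity of the squared distance from the centre bounds the speed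
(`IsSprayCurve.speed_le`); then rays are almost straight, and rays from one source are controlled by
their ends (`IsSprayCurve.compare`). It follows that the squared travel time minus the squared
Euclidean distance has a Lipschitz constant of order `ε` (`IsGentle.travelTime_sq_sub_le`).

Tetrahedra: near a regular tetrahedron, the three squared distances from the apex to the base points
are good coordinates for the apex, and this survives a perturbation with small Lipschitz constant
(`exists_apex`). Correcting three vertices of a regular tetrahedron in turn makes all six travel
times equal. The fifth point is a corrected mirror image of the omitted vertex in the opposite face.

Clocks: machines at rest whose ticks mark multiples of one unit `P` of `x⁰`, at travel times `N *
P`, have echo counts `2 * N`. In the other direction, the echo counts of an arbitrary tetrahedral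
arrangement force this synchronization (`IsTetrahedral.exists_synchronized`), so that a fifth clock
with the same unit fits in. -/

/-- On `[0, 1]` a bound on the derivative bounds every increment. -/
theorem norm_sub_le_of_deriv_le_unitInterval {E : Type*} [NormedAddCommGroup E] [NormedSpace ℝ E]
    {f f' : ℝ → E} {C : ℝ}
    (hf : ∀ s ∈ Set.Icc (0 : ℝ) 1, HasDerivWithinAt f (f' s) (Set.Icc 0 1) s)
    (hC : ∀ s ∈ Set.Icc (0 : ℝ) 1, ‖f' s‖ ≤ C) {s t : ℝ} (hs : s ∈ Set.Icc (0 : ℝ) 1)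
    (ht : t ∈ Set.Icc (0 : ℝ) 1) : ‖f t - f s‖ ≤ C := by
  have h := (convex_Icc (0 : ℝ) 1).norm_image_sub_le_of_norm_hasDerivWithin_le hf hC hs ht
  have hC0 : 0 ≤ C := (norm_nonneg _).trans (hC s hs)
  have h1 : ‖t - s‖ ≤ 1 := by
    rw [Real.norm_eq_abs, abs_le]
    constructor <;> linarith [hs.1, hs.2, ht.1, ht.2]
  exact h.trans (mul_le_of_le_one_right hC0 h1)

/-- If the derivative of `f` is within `C` of the fixed vector `w`, the total increment is too. -/
theorem norm_increment_sub_le {E : Type*} [NormedAddCommGroup E] [NormedSpace ℝ E]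
    {f f' : ℝ → E} {C : ℝ} {w : E}
    (hf : ∀ s ∈ Set.Icc (0 : ℝ) 1, HasDerivWithinAt f (f' s) (Set.Icc 0 1) s)
    (hC : ∀ s ∈ Set.Icc (0 : ℝ) 1, ‖f' s - w‖ ≤ C) : ‖f 1 - f 0 - w‖ ≤ C := by
  have h := norm_sub_le_of_deriv_le_unitInterval (f := fun s => f s - s • w)
    (f' := fun s => f' s - w) (s := 0) (t := 1)
    (fun s hs => by
      have := (hf s hs).sub ((hasDerivWithinAt_id s (Set.Icc 0 1)).smul_const w)
      exact this.congr_deriv (by simp)) hC (by simp) (by simp)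
  have e : f 1 - f 0 - w = (f 1 - (1 : ℝ) • w) - (f 0 - (0 : ℝ) • w) := by
    simp; abel
  rw [e]; exact h

/-! ### Second order equations with a small quadratic right-hand side -/

/-- The second order equation `γ'' = Q (γ, γ')` has a right-hand side that is small and Lipschitz
at the length scale `R`, and grows quadratically with the velocity. -/
structure IsSpray {E : Type*} [NormedAddCommGroup E] (Q : E → E → E) (U : Set E) (R κ : ℝ) :
    Prop where
  bound : ∀ p ∈ U, ∀ v, ‖Q p v‖ ≤ κ / R * ‖v‖ ^ 2
  lip : ∀ p ∈ U, ∀ p' ∈ U, ∀ v v', ‖Q p v - Q p' v'‖ ≤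
    κ / R ^ 2 * ‖p - p'‖ * (‖v‖ + ‖v'‖) ^ 2 + κ / R * ‖v - v'‖ * (‖v‖ + ‖v'‖)

/-- `γ`, with velocity `v`, solves `γ'' = Q (γ, γ')` on `[0, 1]` and stays in `U`. -/
structure IsSprayCurve {E : Type*} [NormedAddCommGroup E] [NormedSpace ℝ E] (Q : E → E → E)
    (U : Set E) (γ v : ℝ → E) : Prop where
  mem : ∀ s ∈ Set.Icc (0 : ℝ) 1, γ s ∈ U
  pos : ∀ s ∈ Set.Icc (0 : ℝ) 1, HasDerivWithinAt γ (v s) (Set.Icc 0 1) s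
  vel : ∀ s ∈ Set.Icc (0 : ℝ) 1, HasDerivWithinAt v (Q (γ s) (v s)) (Set.Icc 0 1) s

section Spray

variable {E : Type*} [NormedAddCommGroup E] [InnerProductSpace ℝ E] {Q : E → E → E} {x : E}
  {R κ : ℝ} {γ v : ℝ → E}

theorem IsSprayCurve.exists_max_speed {U : Set E} (hγ : IsSprayCurve Q U γ v) :
    ∃ t ∈ Set.Icc (0 : ℝ) 1, ∀ s ∈ Set.Icc (0 : ℝ) 1, ‖v s‖ ≤ ‖v t‖ := by
  have hc : ContinuousOn (fun s => ‖v s‖) (Set.Icc 0 1) :=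
    fun s hs => (hγ.vel s hs).continuousWithinAt.norm
  obtain ⟨t, ht, h⟩ := isCompact_Icc.exists_isMaxOn (⟨0, by simp⟩ : (Set.Icc (0:ℝ) 1).Nonempty) hc
  exact ⟨t, ht, fun s hs => h hs⟩

open scoped InnerProductSpace in
/-- A spray curve inside a ball cannot be fast: the squared distance from the centre is
convex. -/
theorem IsSprayCurve.speed_le (hR : 0 < R) (hκ : κ ≤ 1 / 1000)
    (hQ : IsSpray Q (Metric.ball x R) R κ) (hγ : IsSprayCurve Q (Metric.ball x R) γ v)
    (he : ∀ s ∈ Set.Icc (0 : ℝ) 1, ∀ t ∈ Set.Icc (0 : ℝ) 1, ‖v t‖ ≤ 2 * ‖v s‖) {s : ℝ}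
    (hs : s ∈ Set.Icc (0 : ℝ) 1) : ‖v s‖ ≤ 6 * R := by
  obtain ⟨t, ht, hmax⟩ := hγ.exists_max_speed
  set M := ‖v t‖ with hM
  refine (hmax s hs).trans ?_
  have hM0 : 0 ≤ M := norm_nonneg _
  -- The second derivative of `‖γ s - x‖ ^ 2` is about `2 * ‖v s‖ ^ 2`, hence at least `M ^ 2 / 4`
  -- by `he`. So the function stays convex after subtracting `M ^ 2 / 8 * s ^ 2`, and comparing the
  -- midpoint with the ends gives `M ^ 2 ≤ 32 * R ^ 2`.
  have hd1 : ∀ s ∈ Set.Icc (0 : ℝ) 1,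
      HasDerivWithinAt (fun s => ‖γ s - x‖ ^ 2 - M ^ 2 / 8 * s ^ 2)
        (2 * ⟪γ s - x, v s⟫_ℝ - M ^ 2 / 4 * s) (Set.Icc 0 1) s := by
    intro s hs
    have h1 := ((hγ.pos s hs).sub_const x).norm_sq
    have h2 := ((hasDerivWithinAt_id s (Set.Icc 0 1)).pow 2).const_mul (M ^ 2 / 8)
    refine (h1.sub h2).congr_deriv ?_
    simp; ring
  have hd2 : ∀ s ∈ Set.Icc (0 : ℝ) 1,
      HasDerivWithinAt (fun s => 2 * ⟪γ s - x, v s⟫_ℝ - M ^ 2 / 4 * s)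
        (2 * (⟪γ s - x, Q (γ s) (v s)⟫_ℝ + ‖v s‖ ^ 2) - M ^ 2 / 4) (Set.Icc 0 1) s := by
    intro s hs
    have h1 := (((hγ.pos s hs).sub_const x).inner ℝ (hγ.vel s hs)).const_mul 2
    have h2 := (hasDerivWithinAt_id s (Set.Icc 0 1)).const_mul (M ^ 2 / 4)
    refine (h1.sub h2).congr_deriv ?_
    rw [real_inner_self_eq_norm_sq]; ring
  have hnonneg : ∀ s ∈ Set.Icc (0 : ℝ) 1,
      0 ≤ 2 * (⟪γ s - x, Q (γ s) (v s)⟫_ℝ + ‖v s‖ ^ 2) - M ^ 2 / 4 := by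
    intro s hs
    have h1 : |⟪γ s - x, Q (γ s) (v s)⟫_ℝ| ≤ R * (κ / R * ‖v s‖ ^ 2) := by
      refine (abs_real_inner_le_norm _ _).trans ?_
      gcongr
      · have := hγ.mem s hs
        rw [mem_ball_iff_norm] at this
        exact this.le
      · exact hQ.bound _ (hγ.mem s hs) _
    have h2 : R * (κ / R * ‖v s‖ ^ 2) = κ * ‖v s‖ ^ 2 := by field_simp
    have h3 : M ^ 2 ≤ (2 * ‖v s‖) ^ 2 := by
      have := he s hs t ht
      gcongr
    have h4 : κ * ‖v s‖ ^ 2 ≤ 1 / 1000 * ‖v s‖ ^ 2 := by gcongr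
    have := (abs_le.1 h1).1
    nlinarith [sq_nonneg ‖v s‖]
  have hconv : ConvexOn ℝ (Set.Icc (0 : ℝ) 1)
      (fun s => ‖γ s - x‖ ^ 2 - M ^ 2 / 8 * s ^ 2) := by
    refine convexOn_of_hasDerivWithinAt2_nonneg (convex_Icc 0 1)
      (fun s hs => (hd1 s hs).continuousWithinAt)
      (fun s hs => (hd1 s (interior_subset hs)).mono interior_subset)
      (fun s hs => (hd2 s (interior_subset hs)).mono interior_subset)
      (fun s hs => hnonneg s (interior_subset hs))
  have h := hconv.2 (show (0 : ℝ) ∈ Set.Icc (0 : ℝ) 1 by simp)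
    (show (1 : ℝ) ∈ Set.Icc (0 : ℝ) 1 by simp) (show (0 : ℝ) ≤ 1 / 2 by norm_num)
    (show (0 : ℝ) ≤ 1 / 2 by norm_num) (by norm_num)
  simp only [smul_eq_mul] at h
  norm_num at h
  have hb : ∀ s ∈ Set.Icc (0 : ℝ) 1, ‖γ s - x‖ ^ 2 ≤ R ^ 2 := by
    intro s hs
    have := hγ.mem s hs
    rw [mem_ball_iff_norm] at this
    gcongr
  have h0 := hb 0 (by simp)
  have h1 := hb 1 (by simp)
  have h2 : (0 : ℝ) ≤ ‖γ (1 / 2) - x‖ ^ 2 := by positivity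
  have : M ^ 2 ≤ (6 * R) ^ 2 := by nlinarith
  exact abs_le_of_sq_le_sq' this (by positivity) |>.2

/-- A spray curve inside a ball is almost straight. -/
theorem IsSprayCurve.velocity_sub_le (hR : 0 < R) (hκ0 : 0 ≤ κ) (hκ : κ ≤ 1 / 1000)
    (hQ : IsSpray Q (Metric.ball x R) R κ) (hγ : IsSprayCurve Q (Metric.ball x R) γ v)
    (he : ∀ s ∈ Set.Icc (0 : ℝ) 1, ∀ t ∈ Set.Icc (0 : ℝ) 1, ‖v t‖ ≤ 2 * ‖v s‖) {s : ℝ}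
    (hs : s ∈ Set.Icc (0 : ℝ) 1) :
    ‖v s‖ ≤ 2 * ‖γ 1 - γ 0‖ ∧ ‖v s - (γ 1 - γ 0)‖ ≤ 12 * κ * ‖γ 1 - γ 0‖ := by
  obtain ⟨t, ht, hmax⟩ := hγ.exists_max_speed
  set M := ‖v t‖ with hM
  have hM0 : 0 ≤ M := norm_nonneg _
  have hM6 : M ≤ 6 * R := hγ.speed_le hR hκ hQ he ht
  -- The speed bound is spent on one of the two factors `‖v s‖`, which makes the acceleration linear
  -- in `M`; the velocity then differs from its mean `γ 1 - γ 0` by a small fraction of `M`, and `M`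
  -- can be absorbed.
  have hacc : ∀ s ∈ Set.Icc (0 : ℝ) 1, ‖Q (γ s) (v s)‖ ≤ 6 * κ * M := by
    intro s hs
    calc ‖Q (γ s) (v s)‖ ≤ κ / R * ‖v s‖ ^ 2 := hQ.bound _ (hγ.mem s hs) _
      _ ≤ κ / R * (M * (6 * R)) := by
        have := hmax s hs
        rw [sq]; gcongr
        exact this.trans hM6
      _ = 6 * κ * M := by field_simp
  have hdiff : ∀ s ∈ Set.Icc (0 : ℝ) 1, ‖γ 1 - γ 0 - v s‖ ≤ 6 * κ * M := fun s hs =>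
    norm_increment_sub_le hγ.pos
      (fun r hr => norm_sub_le_of_deriv_le_unitInterval hγ.vel hacc hs hr)
  have hMle : M ≤ 2 * ‖γ 1 - γ 0‖ := by
    have h1 := hdiff t ht
    have h2 := norm_sub_norm_le (v t) (γ 1 - γ 0)
    rw [norm_sub_rev] at h1
    nlinarith
  refine ⟨(hmax s hs).trans hMle, ?_⟩
  rw [norm_sub_rev]
  refine (hdiff s hs).trans ?_
  nlinarith

/-- Two spray curves with the same origin and nearby ends stay close to each other. -/
theorem IsSprayCurve.compare {δ w : ℝ → E} (hR : 0 < R) (hκ0 : 0 ≤ κ) (hκ : κ ≤ 1 / 1000)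
    (hQ : IsSpray Q (Metric.ball x R) R κ) (hγ : IsSprayCurve Q (Metric.ball x R) γ v)
    (he : ∀ s ∈ Set.Icc (0 : ℝ) 1, ∀ t ∈ Set.Icc (0 : ℝ) 1, ‖v t‖ ≤ 2 * ‖v s‖)
    (hδ : IsSprayCurve Q (Metric.ball x R) δ w)
    (he' : ∀ s ∈ Set.Icc (0 : ℝ) 1, ∀ t ∈ Set.Icc (0 : ℝ) 1, ‖w t‖ ≤ 2 * ‖w s‖)
    (h0 : γ 0 = δ 0) {s : ℝ} (hs : s ∈ Set.Icc (0 : ℝ) 1) :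
    ‖γ s - δ s‖ ≤ 2 * ‖γ 1 - δ 1‖ ∧
      ‖v s - w s - (γ 1 - δ 1)‖ ≤ 400 * κ * ‖γ 1 - δ 1‖ ∧ ‖v s - w s‖ ≤ 2 * ‖γ 1 - δ 1‖ := by
  have hc : ContinuousOn (fun s => ‖v s - w s‖) (Set.Icc 0 1) :=
    fun s hs => ((hγ.vel s hs).continuousWithinAt.sub (hδ.vel s hs).continuousWithinAt).norm
  obtain ⟨t, ht, hmax'⟩ :=
    isCompact_Icc.exists_isMaxOn (⟨0, by simp⟩ : (Set.Icc (0:ℝ) 1).Nonempty) hc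
  have hmax : ∀ s ∈ Set.Icc (0 : ℝ) 1, ‖v s - w s‖ ≤ ‖v t - w t‖ := fun s hs => hmax' hs
  set N := ‖v t - w t‖ with hN
  have hN0 : 0 ≤ N := norm_nonneg _
  have hdp : ∀ s ∈ Set.Icc (0 : ℝ) 1,
      HasDerivWithinAt (fun s => γ s - δ s) (v s - w s) (Set.Icc 0 1) s :=
    fun s hs => (hγ.pos s hs).sub (hδ.pos s hs)
  have hdv : ∀ s ∈ Set.Icc (0 : ℝ) 1,
      HasDerivWithinAt (fun s => v s - w s) (Q (γ s) (v s) - Q (δ s) (w s)) (Set.Icc 0 1) s :=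
    fun s hs => (hγ.vel s hs).sub (hδ.vel s hs)
  have hpos : ∀ s ∈ Set.Icc (0 : ℝ) 1, ‖γ s - δ s‖ ≤ N := by
    intro s hs
    have := norm_sub_le_of_deriv_le_unitInterval hdp hmax (s := 0) (by simp) hs
    simpa [h0] using this
  -- With speeds at most `6 * R` the Lipschitz bound becomes linear in the largest velocity
  -- difference `N`: `156 = 12 ^ 2 + 12`.
  have hacc : ∀ s ∈ Set.Icc (0 : ℝ) 1, ‖Q (γ s) (v s) - Q (δ s) (w s)‖ ≤ 156 * κ * N := by
    intro s hs
    have h1 := hγ.speed_le hR hκ hQ he hs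
    have h2 := hδ.speed_le hR hκ hQ he' hs
    have h3 : ‖v s‖ + ‖w s‖ ≤ 12 * R := by linarith
    calc ‖Q (γ s) (v s) - Q (δ s) (w s)‖
        ≤ κ / R ^ 2 * ‖γ s - δ s‖ * (‖v s‖ + ‖w s‖) ^ 2
          + κ / R * ‖v s - w s‖ * (‖v s‖ + ‖w s‖) :=
          hQ.lip _ (hγ.mem s hs) _ (hδ.mem s hs) _ _
      _ ≤ κ / R ^ 2 * N * (12 * R) ^ 2 + κ / R * N * (12 * R) := by
        have := hmax s hs
        have := hpos s hs
        gcongr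
      _ = 156 * κ * N := by field_simp; ring
  have hdiff : ∀ s ∈ Set.Icc (0 : ℝ) 1, ‖γ 1 - δ 1 - (v s - w s)‖ ≤ 156 * κ * N := by
    intro s hs
    have := norm_increment_sub_le (w := v s - w s) hdp
      (fun r hr => norm_sub_le_of_deriv_le_unitInterval hdv hacc hs hr)
    simpa [h0] using this
  have hNle : N ≤ 2 * ‖γ 1 - δ 1‖ := by
    have h1 := hdiff t ht
    have h2 := norm_sub_norm_le (v t - w t) (γ 1 - δ 1)
    rw [norm_sub_rev] at h1
    nlinarith
  refine ⟨(hpos s hs).trans hNle, ?_, (hmax s hs).trans hNle⟩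
  rw [norm_sub_rev]
  refine (hdiff s hs).trans ?_
  nlinarith [mul_nonneg hκ0 (norm_nonneg (γ 1 - δ 1))]

end Spray

/-! ### The two-point boundary problem -/

/-- The second antiderivative of a continuous function, with zero initial data. -/
theorem exists_double_antiderivative {E : Type*} [NormedAddCommGroup E] [NormedSpace ℝ E]
    [CompleteSpace E] (α : C(Set.Icc (0 : ℝ) 1, E)) :
    ∃ V A : ℝ → E, V 0 = 0 ∧ A 0 = 0 ∧ (∀ s, HasDerivAt A (V s) s) ∧
      ∀ s, HasDerivAt V (Set.IccExtend zero_le_one α s) s := by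
  have hα : Continuous (Set.IccExtend zero_le_one α) := α.continuous.Icc_extend'
  have hV : ∀ s, HasDerivAt (fun u => ∫ t in (0 : ℝ)..u, Set.IccExtend zero_le_one α t)
      (Set.IccExtend zero_le_one α s) s :=
    fun s => (hα.integral_hasStrictDerivAt 0 s).hasDerivAt
  have hVc : Continuous (fun u => ∫ t in (0 : ℝ)..u, Set.IccExtend zero_le_one α t) :=
    continuous_iff_continuousAt.2 fun s => (hV s).continuousAt
  exact ⟨_, fun u => ∫ r in (0 : ℝ)..u, ∫ t in (0 : ℝ)..r, Set.IccExtend zero_le_one α t,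
    by simp, by simp, fun s => (hVc.integral_hasStrictDerivAt 0 s).hasDerivAt, hV⟩

/-- A continuous function on `[0, 1]` has an antiderivative. -/
theorem exists_antiderivative_unitInterval {f : ℝ → ℝ}
    (hf : ContinuousOn f (Set.Icc (0 : ℝ) 1)) :
    ∃ J : ℝ → ℝ, J 0 = 0 ∧
      ∀ s ∈ Set.Icc (0 : ℝ) 1, HasDerivWithinAt J (f s) (Set.Icc 0 1) s := by
  obtain ⟨V, A, hV0, -, -, hV⟩ := exists_double_antiderivative
    (⟨(Set.Icc (0 : ℝ) 1).domRestrict f, hf.domRestrict⟩ : C(Set.Icc (0 : ℝ) 1, ℝ))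
  refine ⟨V, hV0, fun s hs => ?_⟩
  refine (hV s).hasDerivWithinAt.congr_deriv ?_
  rw [Set.IccExtend_of_mem _ _ hs]
  rfl

section Spray

variable {E : Type*} [NormedAddCommGroup E] [InnerProductSpace ℝ E] {Q : E → E → E} {x : E}
  {R κ : ℝ} {γ v : ℝ → E}

-- The Lipschitz bound of a spray already contains its joint continuity in position and velocity;
-- this makes the acceleration along a trial curve a continuous function, as the fixed point map
-- requires.
omit [InnerProductSpace ℝ E] in
theorem IsSpray.continuousOn_comp {U : Set E} {S : Set ℝ} (hQ : IsSpray Q U R κ)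
    (hγ : ContinuousOn γ S) (hv : ContinuousOn v S) (hU : ∀ s ∈ S, γ s ∈ U) :
    ContinuousOn (fun s => Q (γ s) (v s)) S := by
  intro s hs
  rw [ContinuousWithinAt, tendsto_iff_norm_sub_tendsto_zero]
  have h1 : Filter.Tendsto (fun t => κ / R ^ 2 * ‖γ t - γ s‖ * (‖v t‖ + ‖v s‖) ^ 2
      + κ / R * ‖v t - v s‖ * (‖v t‖ + ‖v s‖)) (nhdsWithin s S)
      (nhds (κ / R ^ 2 * ‖γ s - γ s‖ * (‖v s‖ + ‖v s‖) ^ 2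
      + κ / R * ‖v s - v s‖ * (‖v s‖ + ‖v s‖))) := by
    have h2 := hγ s hs
    have h3 := hv s hs
    exact ((((h2.sub_const _).norm.const_mul _).mul ((h3.norm.add_const _).pow 2)).add
      (((h3.sub_const _).norm.const_mul _).mul (h3.norm.add_const _)))
  have h0 : κ / R ^ 2 * ‖γ s - γ s‖ * (‖v s‖ + ‖v s‖) ^ 2
      + κ / R * ‖v s - v s‖ * (‖v s‖ + ‖v s‖) = 0 := by simp
  rw [h0] at h1
  refine squeeze_zero' (Filter.Eventually.of_forall fun t => norm_nonneg _) ?_ h1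
  filter_upwards [self_mem_nhdsWithin] with t ht
  exact hQ.lip _ (hU t ht) _ (hU s hs) _ _

/-- Points of a slightly smaller ball are joined by a spray curve in the ball. -/
theorem IsSpray.exists_curve [CompleteSpace E] (hR : 0 < R) (hκ0 : 0 ≤ κ) (hκ : κ ≤ 1 / 1000)
    (hQ : IsSpray Q (Metric.ball x R) R κ) {a y : E} (ha : ‖a - x‖ ≤ 9 / 10 * R)
    (hy : ‖y - x‖ ≤ 9 / 10 * R) :
    ∃ γ v, IsSprayCurve Q (Metric.ball x R) γ v ∧ γ 0 = a ∧ γ 1 = y := by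
  choose V A hV0 hA0 hA hV using
    exists_double_antiderivative (E := E)
  -- The unknown is the acceleration `α`. The linear term is chosen so that `γ α` runs from `a` to
  -- `y` for every `α`; a fixed point of `α ↦ Q (γ α) (v α)` therefore solves the boundary problem.
  let γ : C(Set.Icc (0 : ℝ) 1, E) → ℝ → E := fun α s => a + s • (y - a - A α 1) + A α s
  let v : C(Set.Icc (0 : ℝ) 1, E) → ℝ → E := fun α s => y - a - A α 1 + V α s
  have hγ : ∀ α s, HasDerivAt (γ α) (v α s) s := by
    intro α s
    have h1 := (((hasDerivAt_id s).smul_const (y - a - A α 1)).const_add a).add (hA α s)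
    exact h1.congr_deriv (by simp [v])
  have hv : ∀ α s, HasDerivAt (v α) (Set.IccExtend zero_le_one α s) s := fun α s =>
    (hV α s).const_add _
  have hVle : ∀ α β, ∀ s ∈ Set.Icc (0 : ℝ) 1, ‖V α s - V β s‖ ≤ ‖α - β‖ := by
    intro α β s hs
    have := norm_sub_le_of_deriv_le_unitInterval (s := 0) (t := s)
      (fun t _ => ((hV α t).sub (hV β t)).hasDerivWithinAt) (C := ‖α - β‖) ?_ (by simp) hs
    · simpa [hV0] using this
    · intro t ht
      rw [Set.IccExtend_of_mem _ _ ht, Set.IccExtend_of_mem _ _ ht]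
      exact (α - β).norm_coe_le_norm ⟨t, ht⟩
  have hAle : ∀ α β, ∀ s ∈ Set.Icc (0 : ℝ) 1, ‖A α s - A β s‖ ≤ ‖α - β‖ := by
    intro α β s hs
    have := norm_sub_le_of_deriv_le_unitInterval (s := 0) (t := s)
      (fun t _ => ((hA α t).sub (hA β t)).hasDerivWithinAt) (hVle α β) (by simp) hs
    simpa [hA0] using this
  have h1mem : (1 : ℝ) ∈ Set.Icc (0 : ℝ) 1 := by simp
  have hγle : ∀ α β, ∀ s ∈ Set.Icc (0 : ℝ) 1, ‖γ α s - γ β s‖ ≤ 2 * ‖α - β‖ := by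
    intro α β s hs
    have e : γ α s - γ β s = (A α s - A β s) - s • (A α 1 - A β 1) := by
      simp only [γ]; module
    rw [e]
    refine (norm_sub_le _ _).trans ?_
    rw [norm_smul, Real.norm_of_nonneg hs.1]
    have h1 := hAle α β s hs
    have h2 := hAle α β 1 h1mem
    have h3 : s * ‖A α 1 - A β 1‖ ≤ 1 * ‖α - β‖ := by
      have := hs.2
      gcongr
    linarith
  have hvle : ∀ α β, ∀ s ∈ Set.Icc (0 : ℝ) 1, ‖v α s - v β s‖ ≤ 2 * ‖α - β‖ := by
    intro α β s hs
    have e : v α s - v β s = (V α s - V β s) - (A α 1 - A β 1) := by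
      simp only [v]; module
    rw [e]
    have h1 := hVle α β s hs
    have h2 := hAle α β 1 h1mem
    refine (norm_sub_le _ _).trans ?_
    linarith
  have hz : ∀ s ∈ Set.Icc (0 : ℝ) 1, V 0 s = 0 ∧ A 0 s = 0 := by
    have h1 : ∀ s ∈ Set.Icc (0 : ℝ) 1, V 0 s = 0 := by
      intro s hs
      have := norm_sub_le_of_deriv_le_unitInterval (s := 0) (t := s) (C := 0)
        (fun t _ => (hV 0 t).hasDerivWithinAt) (fun t ht => by
          rw [Set.IccExtend_of_mem _ _ ht]; simp) (by simp) hs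
      simpa [hV0] using this
    refine fun s hs => ⟨h1 s hs, ?_⟩
    have := norm_sub_le_of_deriv_le_unitInterval (s := 0) (t := s) (C := 0)
        (fun t _ => (hA 0 t).hasDerivWithinAt) (fun t ht => by simp [h1 t ht]) (by simp) hs
    simpa [hA0] using this
  have hya : ‖y - a‖ ≤ 9 / 5 * R := by
    have : y - a = (y - x) - (a - x) := by abel
    rw [this]
    refine (norm_sub_le _ _).trans (by linarith)
  -- For `α = 0` the curve is the segment from `a` to `y`. Radius `R / 50` moves positions and
  -- velocities by at most `R / 25`, which keeps the curve in the ball, since `9 / 10 + 1 / 25 < 1`,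
  -- and the speed below `2 * R`, since `9 / 5 + 1 / 25 < 2`.
  have hmem : ∀ α ∈ Metric.closedBall (0 : C(Set.Icc (0 : ℝ) 1, E)) (R / 50),
      ∀ s ∈ Set.Icc (0 : ℝ) 1, γ α s ∈ Metric.ball x R ∧ ‖v α s‖ ≤ 2 * R := by
    intro α hα s hs
    rw [mem_closedBall_zero_iff] at hα
    have h1 := hγle α 0 s hs
    have h2 := hvle α 0 s hs
    rw [sub_zero] at h1 h2
    have e1 : γ 0 s - x = (1 - s) • (a - x) + s • (y - x) := by
      simp only [γ, hz s hs, hz 1 h1mem]; module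
    have e2 : v 0 s = y - a := by simp [v, hz s hs, hz 1 h1mem]
    rw [e2] at h2
    have h3 : ‖γ 0 s - x‖ ≤ 9 / 10 * R := by
      rw [e1]
      refine (norm_add_le _ _).trans ?_
      rw [norm_smul, norm_smul, Real.norm_of_nonneg hs.1,
        Real.norm_of_nonneg (sub_nonneg.2 hs.2)]
      nlinarith [mul_le_mul_of_nonneg_left ha (sub_nonneg.2 hs.2),
        mul_le_mul_of_nonneg_left hy hs.1]
    constructor
    · rw [mem_ball_iff_norm]
      have e : γ α s - x = (γ α s - γ 0 s) + (γ 0 s - x) := by abel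
      rw [e]
      refine (norm_add_le _ _).trans_lt ?_
      linarith
    · have e : v α s = (v α s - (y - a)) + (y - a) := by abel
      rw [e]
      refine (norm_add_le _ _).trans ?_
      linarith
  have hcont : ∀ α ∈ Metric.closedBall (0 : C(Set.Icc (0 : ℝ) 1, E)) (R / 50),
      ContinuousOn (fun s => Q (γ α s) (v α s)) (Set.Icc 0 1) := fun α hα =>
    hQ.continuousOn_comp (fun s _ => (hγ α s).continuousAt.continuousWithinAt)
      (fun s _ => (hv α s).continuousAt.continuousWithinAt) (fun s hs => (hmem α hα s hs).1)
  let T : Metric.closedBall (0 : C(Set.Icc (0 : ℝ) 1, E)) (R / 50) →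
      Metric.closedBall (0 : C(Set.Icc (0 : ℝ) 1, E)) (R / 50) := fun α =>
    ⟨⟨(Set.Icc (0 : ℝ) 1).domRestrict (fun s => Q (γ α s) (v α s)), (hcont α α.2).domRestrict⟩, by
      rw [mem_closedBall_zero_iff, ContinuousMap.norm_le _ (by positivity)]
      intro s
      obtain ⟨h1, h2⟩ := hmem α α.2 s s.2
      calc ‖Q (γ α s) (v α s)‖ ≤ κ / R * ‖v α s‖ ^ 2 := hQ.bound _ h1 _
        _ ≤ κ / R * (2 * R) ^ 2 := by gcongr
        _ = κ * 4 * R := by field_simp; ring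
        _ ≤ R / 50 := by nlinarith⟩
  have hT : ContractingWith (1 / 2) T := by
    refine ⟨by norm_num, LipschitzWith.of_dist_le_mul fun α β => ?_⟩
    have hn : (0 : ℝ) ≤ ‖(α : C(Set.Icc (0 : ℝ) 1, E)) - β‖ := norm_nonneg _
    rw [Subtype.dist_eq, Subtype.dist_eq, dist_eq_norm, dist_eq_norm,
      ContinuousMap.norm_le _ (by positivity)]
    intro s
    obtain ⟨h1, h2⟩ := hmem α α.2 s s.2
    obtain ⟨h3, h4⟩ := hmem β β.2 s s.2
    have h5 := hγle α β s s.2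
    have h6 := hvle α β s s.2
    have h7 : ‖v α s‖ + ‖v β s‖ ≤ 4 * R := by linarith
    calc ‖Q (γ α s) (v α s) - Q (γ β s) (v β s)‖
        ≤ κ / R ^ 2 * ‖γ α s - γ β s‖ * (‖v α s‖ + ‖v β s‖) ^ 2
          + κ / R * ‖v α s - v β s‖ * (‖v α s‖ + ‖v β s‖) := hQ.lip _ h1 _ h3 _ _
      _ ≤ κ / R ^ 2 * (2 * ‖(α : C(Set.Icc (0 : ℝ) 1, E)) - β‖) * (4 * R) ^ 2
          + κ / R * (2 * ‖(α : C(Set.Icc (0 : ℝ) 1, E)) - β‖) * (4 * R) := by gcongr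
      _ = 40 * κ * ‖(α : C(Set.Icc (0 : ℝ) 1, E)) - β‖ := by field_simp; ring
      _ ≤ ((1 / 2 : NNReal) : ℝ) * ‖(α : C(Set.Icc (0 : ℝ) 1, E)) - β‖ := by
        push_cast
        gcongr
        linarith
  have : CompleteSpace (Metric.closedBall (0 : C(Set.Icc (0 : ℝ) 1, E)) (R / 50)) :=
    Metric.isClosed_closedBall.isComplete.completeSpace_coe
  have : Nonempty (Metric.closedBall (0 : C(Set.Icc (0 : ℝ) 1, E)) (R / 50)) :=
    ⟨⟨0, Metric.mem_closedBall_self (by positivity)⟩⟩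
  obtain ⟨α, hα, -⟩ := hT.exists_fixedPoint (Classical.arbitrary _) (edist_ne_top _ _)
  refine ⟨γ α, v α, ⟨fun s hs => (hmem α α.2 s hs).1,
    fun s _ => (hγ α s).hasDerivWithinAt, fun s hs => ?_⟩, ?_, ?_⟩
  · refine (hv α s).hasDerivWithinAt.congr_deriv ?_
    rw [Set.IccExtend_of_mem _ _ hs]
    exact congrArg (fun β : Metric.closedBall (0 : C(Set.Icc (0 : ℝ) 1, E)) (R / 50) =>
      (β : C(Set.Icc (0 : ℝ) 1, E)) ⟨s, hs⟩) hα.symm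
  · simp [γ, hA0]
  · simp only [γ]; module

end Spray

/-! ### Correcting the apex of a tetrahedron -/

open scoped InnerProductSpace in
/-- An almost regular tetrahedron with apex `y₀` over the triangle `a` can be corrected, by moving
the apex only, so that perturbed squared distances `F k` from the apex to the three base points
take the value `ℓ ^ 2` exactly. -/
theorem exists_apex {E : Type*} [NormedAddCommGroup E] [InnerProductSpace ℝ E] {a : Fin 3 → E}
    {y₀ : E} {ℓ τ δ : ℝ} {F : Fin 3 → E → ℝ} (hℓ : 0 < ℓ) (hτ0 : 0 ≤ τ) (hτ : τ ≤ 1 / 1000)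
    (hδ0 : 0 ≤ δ) (hδ : δ ≤ τ / 10)
    (hside : ∀ k, |‖y₀ - a k‖ ^ 2 - ℓ ^ 2| ≤ δ * ℓ ^ 2)
    (hbase : ∀ j k, j ≠ k → |‖a j - a k‖ ^ 2 - ℓ ^ 2| ≤ δ * ℓ ^ 2)
    (hF₀ : ∀ k, |F k y₀ - ‖y₀ - a k‖ ^ 2| ≤ δ * ℓ ^ 2)
    (hF : ∀ k, ∀ y y', ‖y - y₀‖ ≤ 10 * τ * ℓ → ‖y' - y₀‖ ≤ 10 * τ * ℓ →
      |(F k y - ‖y - a k‖ ^ 2) - (F k y' - ‖y' - a k‖ ^ 2)| ≤ δ * ℓ * ‖y - y'‖) :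
    ∃ y, ‖y - y₀‖ ≤ 10 * τ * ℓ ∧ ∀ k, F k y = ℓ ^ 2 := by
  set b : Fin 3 → E := fun k => y₀ - a k with hb
  have hℓ2 : 0 < ℓ ^ 2 := by positivity
  have hinner : ∀ j k, |⟪b j, b k⟫_ℝ - (if j = k then 1 else 1 / 2) * ℓ ^ 2|
      ≤ 3 / 2 * δ * ℓ ^ 2 := by
    intro j k
    split_ifs with h
    · subst h
      rw [real_inner_self_eq_norm_sq, one_mul]
      exact (hside j).trans (by nlinarith)
    · have h1 := norm_sub_sq_real (b j) (b k)
      have e : b j - b k = a k - a j := by simp only [hb]; abel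
      rw [e] at h1
      have h2 := abs_le.1 (hbase k j (Ne.symm h))
      have h3 := abs_le.1 (hside j)
      have h4 := abs_le.1 (hside k)
      simp only [hb] at h1 ⊢
      rw [abs_le]
      constructor <;> nlinarith
  have hbn : ∀ k, ‖b k‖ ≤ 6 / 5 * ℓ := by
    intro k
    have h3 := abs_le.1 (hside k)
    refine abs_le_of_sq_le_sq' (a := ‖b k‖) ?_ (by positivity) |>.2
    simp only [hb]
    nlinarith
  -- For a regular tetrahedron the Gram matrix of `b` is `ℓ ^ 2 / 2` times (identity plus all-ones),
  -- and the inverse of half that sum is twice the identity minus half the all-ones matrix. Thus `β`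
  -- is, up to the factor `ℓ ^ 2` and errors of order `δ`, the dual family of `b`.
  set β : Fin 3 → E := fun k => (2 : ℝ) • b k - (1 / 2 : ℝ) • ∑ i, b i with hβ
  have hdual : ∀ j k, |⟪b j, β k⟫_ℝ - (if j = k then 1 else 0) * ℓ ^ 2| ≤ 6 * δ * ℓ ^ 2 := by
    intro j k
    have e : ⟪b j, β k⟫_ℝ = 2 * ⟪b j, b k⟫_ℝ - 1 / 2 * ∑ i, ⟪b j, b i⟫_ℝ := by
      simp only [hβ, inner_sub_right, inner_smul_right, inner_sum]
    rw [e, Fin.sum_univ_three]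
    have hk := abs_le.1 (hinner j k)
    have h0 := abs_le.1 (hinner j 0)
    have h1 := abs_le.1 (hinner j 1)
    have h2 := abs_le.1 (hinner j 2)
    have hpos : 0 ≤ δ * ℓ ^ 2 := by positivity
    -- Each row of the model Gram matrix has sum `2 = 1 + 1 / 2 + 1 / 2`.
    have hs : (if j = 0 then 1 else 1 / 2 : ℝ) + (if j = 1 then 1 else 1 / 2)
        + (if j = 2 then 1 else 1 / 2) = 2 := by
      fin_cases j <;> norm_num [Fin.ext_iff]
    replace hs := congrArg (fun r => r * ℓ ^ 2) hs
    simp only [add_mul] at hs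
    have hc : (if j = k then 1 else 0 : ℝ) * ℓ ^ 2
        = 2 * ((if j = k then 1 else 1 / 2) * ℓ ^ 2) - ℓ ^ 2 := by
      split_ifs <;> ring
    rw [hc, abs_le]
    constructor <;> linarith [hk.1, hk.2, h0.1, h0.2, h1.1, h1.2, h2.1, h2.2]
  have hβn : ∀ k, ‖β k‖ ≤ 10 / 3 * ℓ := by
    have hn : ∀ p q r : E, ‖p‖ ≤ 6 / 5 * ℓ → ‖q‖ ≤ 6 / 5 * ℓ → ‖r‖ ≤ 6 / 5 * ℓ →
        ‖(3 / 2 : ℝ) • p - ((1 / 2 : ℝ) • q + (1 / 2 : ℝ) • r)‖ ≤ 10 / 3 * ℓ := by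
      intro p q r hp hq hr
      have h1 := norm_sub_le ((3 / 2 : ℝ) • p) ((1 / 2 : ℝ) • q + (1 / 2 : ℝ) • r)
      have h2 := norm_add_le ((1 / 2 : ℝ) • q) ((1 / 2 : ℝ) • r)
      simp only [norm_smul, Real.norm_eq_abs] at h1 h2
      norm_num [abs_of_pos] at h1 h2
      linarith
    intro k
    have e : β k = (3 / 2 : ℝ) • b k - ((1 / 2 : ℝ) • b (k + 1) + (1 / 2 : ℝ) • b (k + 2)) := by
      simp only [hβ, Fin.sum_univ_three]
      fin_cases k
      · change (2 : ℝ) • b 0 - (1 / 2 : ℝ) • (b 0 + b 1 + b 2) =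
          (3 / 2 : ℝ) • b 0 - ((1 / 2 : ℝ) • b 1 + (1 / 2 : ℝ) • b 2)
        module
      · change (2 : ℝ) • b 1 - (1 / 2 : ℝ) • (b 0 + b 1 + b 2) =
          (3 / 2 : ℝ) • b 1 - ((1 / 2 : ℝ) • b 2 + (1 / 2 : ℝ) • b 0)
        module
      · change (2 : ℝ) • b 2 - (1 / 2 : ℝ) • (b 0 + b 1 + b 2) =
          (3 / 2 : ℝ) • b 2 - ((1 / 2 : ℝ) • b 0 + (1 / 2 : ℝ) • b 1)
        module
    rw [e]
    exact hn _ _ _ (hbn _) (hbn _) (hbn _)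
  set B : (Fin 3 → ℝ) → E := fun t => ∑ k, t k • β k with hB
  have hBsub : ∀ t t', B t - B t' = B (t - t') := by
    intro t t'
    simp only [hB, Pi.sub_apply, sub_smul, Finset.sum_sub_distrib]
  have hB0 : B 0 = 0 := by simp [hB]
  have hBn : ∀ t, ‖B t‖ ≤ 10 * ℓ * ‖t‖ := by
    intro t
    calc ‖B t‖ ≤ ∑ k, ‖t k • β k‖ := norm_sum_le _ _
      _ ≤ ∑ _k : Fin 3, ‖t‖ * (10 / 3 * ℓ) := by
        refine Finset.sum_le_sum fun k _ => ?_
        rw [norm_smul]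
        exact mul_le_mul (norm_le_pi_norm t k) (hβn k) (norm_nonneg _) (norm_nonneg _)
      _ = 10 * ℓ * ‖t‖ := by
        rw [Finset.sum_const, Finset.card_univ, Fintype.card_fin, nsmul_eq_mul]
        push_cast; ring
  have hAB : ∀ k t, |⟪b k, B t⟫_ℝ - t k * ℓ ^ 2| ≤ 18 * δ * ℓ ^ 2 * ‖t‖ := by
    intro k t
    have e : ⟪b k, B t⟫_ℝ - t k * ℓ ^ 2
        = ∑ j, t j * (⟪b k, β j⟫_ℝ - (if k = j then 1 else 0) * ℓ ^ 2) := by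
      simp only [hB, inner_sum, inner_smul_right, mul_sub, Finset.sum_sub_distrib]
      congr 1
      simp
    rw [e]
    calc _ ≤ ∑ j, |t j * (⟪b k, β j⟫_ℝ - (if k = j then 1 else 0) * ℓ ^ 2)| :=
          Finset.abs_sum_le_sum_abs _ _
      _ ≤ ∑ _j : Fin 3, ‖t‖ * (6 * δ * ℓ ^ 2) := by
        refine Finset.sum_le_sum fun j _ => ?_
        rw [abs_mul]
        exact mul_le_mul (norm_le_pi_norm t j) (hdual k j) (abs_nonneg _) (norm_nonneg _)
      _ = 18 * δ * ℓ ^ 2 * ‖t‖ := by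
        rw [Finset.sum_const, Finset.card_univ, Fintype.card_fin, nsmul_eq_mul]
        push_cast; ring
  -- Newton's method with frozen derivative: moving the apex by `B t` changes the `k`-th squared
  -- distance by about `2 * ℓ ^ 2 * t k`. Only the Lipschitz bound on the perturbation enters, so
  -- `F` need not be differentiable.
  set Ψ : (Fin 3 → ℝ) → Fin 3 → ℝ := fun t k => t k - (F k (y₀ + B t) - ℓ ^ 2) / (2 * ℓ ^ 2)
    with hΨ
  have hball : ∀ t, ‖t‖ ≤ τ → ‖y₀ + B t - y₀‖ ≤ 10 * τ * ℓ := by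
    intro t ht
    rw [add_sub_cancel_left]
    refine (hBn t).trans ?_
    nlinarith
  have hlip : ∀ t t', ‖t‖ ≤ τ → ‖t'‖ ≤ τ → ‖Ψ t - Ψ t'‖ ≤ 1 / 2 * ‖t - t'‖ := by
    intro t t' ht ht'
    rw [pi_norm_le_iff_of_nonneg (by positivity)]
    intro k
    have hD : 0 ≤ ‖t - t'‖ := norm_nonneg _
    have h1 := hAB k (t - t')
    rw [← hBsub, inner_sub_right, Pi.sub_apply] at h1
    have h2 := hF k _ _ (hball t ht) (hball t' ht')
    have e : y₀ + B t - (y₀ + B t') = B t - B t' := by abel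
    rw [e, show y₀ + B t - a k = b k + B t by simp only [hb]; abel,
      show y₀ + B t' - a k = b k + B t' by simp only [hb]; abel,
      norm_add_sq_real, norm_add_sq_real] at h2
    have h3 : ‖B t - B t'‖ ≤ 10 * ℓ * ‖t - t'‖ := by rw [hBsub]; exact hBn _
    have h4 : |‖B t‖ ^ 2 - ‖B t'‖ ^ 2| ≤ 200 * τ * ℓ ^ 2 * ‖t - t'‖ := by
      have h5 := abs_norm_sub_norm_le (B t) (B t')
      have h6 : ‖B t‖ ≤ 10 * ℓ * τ := (hBn t).trans (by gcongr)
      have h7 : ‖B t'‖ ≤ 10 * ℓ * τ := (hBn t').trans (by gcongr)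
      have e2 : ‖B t‖ ^ 2 - ‖B t'‖ ^ 2 = (‖B t‖ - ‖B t'‖) * (‖B t‖ + ‖B t'‖) := by ring
      rw [e2, abs_mul, abs_of_nonneg (show 0 ≤ ‖B t‖ + ‖B t'‖ by positivity)]
      calc _ ≤ (10 * ℓ * ‖t - t'‖) * (10 * ℓ * τ + 10 * ℓ * τ) := by
            gcongr
            exact h5.trans h3
        _ = 200 * τ * ℓ ^ 2 * ‖t - t'‖ := by ring
    have h8 : δ * ℓ * ‖B t - B t'‖ ≤ 10 * δ * ℓ ^ 2 * ‖t - t'‖ := by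
      calc δ * ℓ * ‖B t - B t'‖ ≤ δ * ℓ * (10 * ℓ * ‖t - t'‖) := by gcongr
        _ = _ := by ring
    have e3 : (Ψ t - Ψ t') k = ((t k - t' k) * (2 * ℓ ^ 2)
        - (F k (y₀ + B t) - F k (y₀ + B t'))) / (2 * ℓ ^ 2) := by
      simp only [hΨ, Pi.sub_apply]
      field_simp
      ring
    rw [e3, Real.norm_eq_abs, abs_div, abs_of_pos (show 0 < 2 * ℓ ^ 2 by positivity),
      div_le_iff₀ (by positivity)]
    have h9 : 0 ≤ ℓ ^ 2 * ‖t - t'‖ := by positivity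
    have h10 : δ * (ℓ ^ 2 * ‖t - t'‖) ≤ 1 / 10000 * (ℓ ^ 2 * ‖t - t'‖) := by
      gcongr; linarith
    have h11 : τ * (ℓ ^ 2 * ‖t - t'‖) ≤ 1 / 1000 * (ℓ ^ 2 * ‖t - t'‖) := by
      gcongr
    rw [abs_le] at h1 h2 h4 ⊢
    constructor <;> linarith [h1.1, h1.2, h2.1, h2.2, h4.1, h4.2]
  have hΨ0 : ‖Ψ 0‖ ≤ τ / 10 := by
    rw [pi_norm_le_iff_of_nonneg (by positivity)]
    intro k
    have h1 := abs_le.1 (hside k)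
    have h2 := abs_le.1 (hF₀ k)
    simp only [hΨ, hB0, Pi.zero_apply, zero_sub, add_zero, norm_neg]
    rw [Real.norm_eq_abs, abs_div, abs_of_pos (show 0 < 2 * ℓ ^ 2 by positivity),
      div_le_iff₀ (by positivity), abs_le]
    have h3 : δ * ℓ ^ 2 ≤ τ / 10 * ℓ ^ 2 := by gcongr
    constructor <;> linarith
  have hmaps : ∀ t, ‖t‖ ≤ τ → ‖Ψ t‖ ≤ τ := by
    intro t ht
    have h1 := hlip t 0 ht (by simpa using hτ0)
    rw [sub_zero] at h1
    have h2 := norm_le_norm_sub_add (Ψ t) (Ψ 0)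
    linarith
  let T : Metric.closedBall (0 : Fin 3 → ℝ) τ → Metric.closedBall (0 : Fin 3 → ℝ) τ := fun t =>
    ⟨Ψ t, mem_closedBall_zero_iff.2 (hmaps t (mem_closedBall_zero_iff.1 t.2))⟩
  have hT : ContractingWith (1 / 2) T := by
    refine ⟨by norm_num, LipschitzWith.of_dist_le_mul fun t t' => ?_⟩
    rw [Subtype.dist_eq, Subtype.dist_eq, dist_eq_norm, dist_eq_norm]
    push_cast
    exact hlip t t' (mem_closedBall_zero_iff.1 t.2) (mem_closedBall_zero_iff.1 t'.2)
  have : CompleteSpace (Metric.closedBall (0 : Fin 3 → ℝ) τ) :=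
    Metric.isClosed_closedBall.isComplete.completeSpace_coe
  have : Nonempty (Metric.closedBall (0 : Fin 3 → ℝ) τ) := ⟨⟨0, Metric.mem_closedBall_self hτ0⟩⟩
  obtain ⟨t, ht, -⟩ := hT.exists_fixedPoint (Classical.arbitrary _) (edist_ne_top _ _)
  refine ⟨y₀ + B t, hball t (mem_closedBall_zero_iff.1 t.2), fun k => ?_⟩
  have h : Ψ t k = (t : Fin 3 → ℝ) k :=
    congrFun (congrArg (fun r : Metric.closedBall (0 : Fin 3 → ℝ) τ => (r : Fin 3 → ℝ)) ht) k
  simp only [hΨ] at h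
  have h2 : (F k (y₀ + B t) - ℓ ^ 2) / (2 * ℓ ^ 2) = 0 := by linarith
  rw [div_eq_zero_iff] at h2
  rcases h2 with h2 | h2
  · linarith
  · exact absurd h2 (by positivity)

/-! ### Gentle functions on Euclidean space -/

/-- Euclidean coordinate space. -/
abbrev Space : Type := EuclideanSpace ℝ (Fin 3)

theorem Space.abs_apply_le (w : Space) (i : Fin 3) : |w i| ≤ ‖w‖ :=
  PiLp.norm_apply_le w i

/-- The sharp constant is the square root of `3`, rounded up to `2`. -/
theorem Space.norm_le_of_abs_le {w : Space} {C : ℝ} (h : ∀ i, |w i| ≤ C) : ‖w‖ ≤ 2 * C := by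
  have hC : 0 ≤ C := (abs_nonneg _).trans (h 0)
  have h2 : ‖w‖ ^ 2 ≤ (2 * C) ^ 2 := by
    rw [EuclideanSpace.norm_sq_eq, Fin.sum_univ_three]
    have : ∀ i, ‖w i‖ ^ 2 ≤ C ^ 2 := fun i => by
      have := h i
      rw [Real.norm_eq_abs]; gcongr
    nlinarith [this 0, this 1, this 2]
  exact (abs_le_of_sq_le_sq' h2 (by positivity)).2

theorem Space.abs_sum_le {n : Fin 3 → ℝ} {η : ℝ} (h : ∀ j, |n j| ≤ η) (w : Space) :
    |∑ j, n j * w j| ≤ 3 * η * ‖w‖ := by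
  calc |∑ j, n j * w j| ≤ ∑ j, |n j * w j| := Finset.abs_sum_le_sum_abs _ _
    _ ≤ ∑ _j : Fin 3, η * ‖w‖ := by
      refine Finset.sum_le_sum fun j _ => ?_
      rw [abs_mul]
      exact mul_le_mul (h j) (w.abs_apply_le j) (abs_nonneg _) ((abs_nonneg _).trans (h j))
    _ = 3 * η * ‖w‖ := by simp; ring

theorem Space.abs_sum_sum_le {n : Fin 3 → Fin 3 → ℝ} {η : ℝ} (h : ∀ i j, |n i j| ≤ η)
    (u w : Space) : |∑ i, ∑ j, n i j * u i * w j| ≤ 9 * η * ‖u‖ * ‖w‖ := by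
  have e : ∑ i, ∑ j, n i j * u i * w j = ∑ i, (∑ j, n i j * w j) * u i := by
    refine Finset.sum_congr rfl fun i _ => ?_
    rw [Finset.sum_mul]
    exact Finset.sum_congr rfl fun j _ => by ring
  rw [e]
  refine (abs_sum_le (fun i => abs_sum_le (h i) w) u).trans (le_of_eq ?_)
  ring

/-- A function with gradient `df` is within `ε` of the constant `c`, and its gradient is small and
Lipschitz at the length scale `R`. -/
structure IsGentleFunction (f : Space → ℝ) (df : Fin 3 → Space → ℝ) (x : Space) (R ε c : ℝ) :
    Prop where
  hasFDerivAt : ∀ p ∈ Metric.ball x R,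
    HasFDerivAt f (∑ k, df k p • (EuclideanSpace.proj k : Space →L[ℝ] ℝ)) p
  near : ∀ p ∈ Metric.ball x R, |f p - c| ≤ ε
  deriv_le : ∀ p ∈ Metric.ball x R, ∀ k, |df k p| ≤ ε / R
  deriv_lip : ∀ p ∈ Metric.ball x R, ∀ p' ∈ Metric.ball x R, ∀ k,
    |df k p - df k p'| ≤ 4 * ε / R ^ 2 * ‖p - p'‖

section GentleFunction

variable {f : Space → ℝ} {df : Fin 3 → Space → ℝ} {x : Space} {R ε c : ℝ}

/-- Mean value inequality on the convex ball, with the sum of three partial derivatives bounded by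
`4` rather than `3` times `ε / R`. -/
theorem IsGentleFunction.lip (hf : IsGentleFunction f df x R ε c) {p p' : Space}
    (hp : p ∈ Metric.ball x R) (hp' : p' ∈ Metric.ball x R) :
    |f p - f p'| ≤ 4 * ε / R * ‖p - p'‖ := by
  refine (convex_ball x R).norm_image_sub_le_of_norm_hasFDerivWithin_le (𝕜 := ℝ)
    (f := f) (fun q hq => (hf.hasFDerivAt q hq).hasFDerivWithinAt) (fun q hq => ?_) hp' hp
  have hd : 0 ≤ ε / R := (abs_nonneg _).trans (hf.deriv_le q hq 0)
  refine ContinuousLinearMap.opNorm_le_bound _ (by rw [mul_div_assoc]; positivity) fun w => ?_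
  have e : (∑ k, df k q • (EuclideanSpace.proj k : Space →L[ℝ] ℝ)) w = ∑ k, df k q * w k := by
    simp
  rw [e, Real.norm_eq_abs]
  refine (Space.abs_sum_le (hf.deriv_le q hq) w).trans ?_
  rw [mul_div_assoc]
  gcongr
  norm_num

theorem IsGentleFunction.comp_curve (hf : IsGentleFunction f df x R ε c) {γ v : ℝ → Space}
    {S : Set ℝ} {s : ℝ} (hγ : HasDerivWithinAt γ (v s) S s) (hmem : γ s ∈ Metric.ball x R) :
    HasDerivWithinAt (fun s => f (γ s)) (∑ k, df k (γ s) * v s k) S s := by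
  refine ((hf.hasFDerivAt _ hmem).comp_hasDerivWithinAt s hγ).congr_deriv ?_
  simp

end GentleFunction

/-! ### The equation of light rays in a static metric -/

/-- The coefficients, as functions on space, of the static metric
`-lapse (dx⁰)² + metric i j dxⁱ dxʲ`, together with their partial derivatives. -/
structure StaticCoefficients where
  lapse : Space → ℝ
  metric : Fin 3 → Fin 3 → Space → ℝ
  dLapse : Fin 3 → Space → ℝ
  dMetric : Fin 3 → Fin 3 → Fin 3 → Space → ℝ

namespace StaticCoefficients

/-- The coefficients are symmetric and gentle at the length scale `R`. -/
structure IsGentle (m : StaticCoefficients) (x : Space) (R ε : ℝ) : Prop where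
  lapse : IsGentleFunction m.lapse m.dLapse x R ε 1
  metric : ∀ i j, IsGentleFunction (m.metric i j) (fun k => m.dMetric k i j) x R ε
    (if i = j then 1 else 0)
  symm : ∀ i j, ∀ p ∈ Metric.ball x R, m.metric i j p = m.metric j i p

/-- Spatial Christoffel symbols of the first kind. -/
noncomputable def spatialChristoffel (m : StaticCoefficients) (i j k : Fin 3) (p : Space) : ℝ :=
  (m.dMetric j i k p + m.dMetric k i j p - m.dMetric i j k p) / 2

/-- The quadratic form giving the force on a light ray, multiplied by the lapse. -/
noncomputable def forceCoef (m : StaticCoefficients) (i j k : Fin 3) (p : Space) : ℝ :=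
  -m.lapse p * m.spatialChristoffel i j k p - m.dLapse i p * m.metric j k p / 2

/-- The force on a light ray with spatial velocity `v`, multiplied by the lapse. -/
noncomputable def force (m : StaticCoefficients) (p v : Space) : Space :=
  WithLp.toLp 2 fun i => ∑ j, ∑ k, m.forceCoef i j k p * v j * v k

/-- The linear map with matrix `lapse * metric`. -/
noncomputable def mass (m : StaticCoefficients) (p : Space) : Space →ₗ[ℝ] Space where
  toFun w := WithLp.toLp 2 fun i => ∑ j, m.lapse p * m.metric i j p * w j
  map_add' u w := by
    ext i
    simp [mul_add, Finset.sum_add_distrib]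
  map_smul' c w := by
    ext i
    simp only [PiLp.smul_apply, smul_eq_mul, RingHom.id_apply, Finset.mul_sum]
    exact Finset.sum_congr rfl fun j _ => by ring

/-- The spatial acceleration of a light ray. -/
noncomputable def acc (m : StaticCoefficients) (p v : Space) : Space :=
  Function.invFun (m.mass p) (m.force p v)

/-- The lapse times the squared spatial speed: the square of the conserved energy of a light
ray. -/
noncomputable def kinetic (m : StaticCoefficients) (p v : Space) : ℝ :=
  m.lapse p * ∑ i, ∑ j, m.metric i j p * v i * v j

variable {m : StaticCoefficients} {x : Space} {R ε : ℝ}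

@[simp] theorem mass_apply (p w : Space) (i : Fin 3) :
    m.mass p w i = ∑ j, m.lapse p * m.metric i j p * w j := rfl

@[simp] theorem force_apply (p v : Space) (i : Fin 3) :
    m.force p v i = ∑ j, ∑ k, m.forceCoef i j k p * v j * v k := rfl

theorem abs_mul_sub_mul_le {a a' b b' A B α β : ℝ} (ha : |a - a'| ≤ α) (hb : |b - b'| ≤ β)
    (hA : |a'| ≤ A) (hB : |b| ≤ B) : |a * b - a' * b'| ≤ α * B + A * β := by
  have e : a * b - a' * b' = (a - a') * b + a' * (b - b') := by ring
  rw [e]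
  refine (abs_add_le _ _).trans ?_
  rw [abs_mul, abs_mul]
  exact add_le_add (mul_le_mul ha hB (abs_nonneg _) ((abs_nonneg _).trans ha))
    (mul_le_mul hA hb (abs_nonneg _) ((abs_nonneg _).trans hA))

theorem IsGentle.eps_nonneg (hR : 0 < R) (hm : m.IsGentle x R ε) : 0 ≤ ε :=
  (abs_nonneg _).trans (hm.lapse.near x (Metric.mem_ball_self hR))

section Bounds

variable (hR : 0 < R) (hε : ε ≤ 1 / 1000) (hm : m.IsGentle x R ε) {p : Space}
  (hp : p ∈ Metric.ball x R)

include hR hε hm hp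

omit hR in
theorem IsGentle.lapse_mem : |m.lapse p| ≤ 1001 / 1000 ∧ 999 / 1000 ≤ m.lapse p := by
  have h := abs_le.1 (hm.lapse.near p hp)
  rw [abs_le]
  refine ⟨⟨?_, ?_⟩, ?_⟩ <;> linarith [h.1, h.2]

omit hR in
theorem IsGentle.abs_metric_le (i j : Fin 3) : |m.metric i j p| ≤ 1001 / 1000 := by
  have h := abs_le.1 ((hm.metric i j).near p hp)
  rw [abs_le]
  split_ifs at h <;> constructor <;> linarith [h.1, h.2]

theorem IsGentle.abs_mass_sub_le (i j : Fin 3) :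
    |m.lapse p * m.metric i j p - (if i = j then 1 else 0)| ≤ 3 * ε := by
  have h1 := hm.lapse.near p hp
  have h2 := (hm.metric i j).near p hp
  have h0 := hm.eps_nonneg hR
  have h3 := abs_mul_sub_mul_le h1 h2 (A := 1) (by simp) (hm.abs_metric_le hε hp i j)
  rw [one_mul] at h3
  linarith

omit hR hε in
theorem IsGentle.abs_spatialChristoffel_le (i j k : Fin 3) :
    |m.spatialChristoffel i j k p| ≤ 3 / 2 * (ε / R) := by
  have h1 := abs_le.1 ((hm.metric i k).deriv_le p hp j)
  have h2 := abs_le.1 ((hm.metric i j).deriv_le p hp k)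
  have h3 := abs_le.1 ((hm.metric j k).deriv_le p hp i)
  simp only [spatialChristoffel]
  rw [abs_le]
  constructor <;> linarith [h1.1, h1.2, h2.1, h2.2, h3.1, h3.2]

theorem IsGentle.abs_forceCoef_le (i j k : Fin 3) : |m.forceCoef i j k p| ≤ 4 * (ε / R) := by
  have h0 := hm.eps_nonneg hR
  have h1 := (hm.lapse_mem hε hp).1
  have h2 := hm.abs_spatialChristoffel_le hp i j k
  have h3 := hm.lapse.deriv_le p hp i
  have h4 := hm.abs_metric_le hε hp j k
  have h5 : 0 ≤ ε / R := by positivity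
  have h6 := mul_le_mul h1 h2 (abs_nonneg _) (by norm_num)
  have h7 := mul_le_mul h3 h4 (abs_nonneg _) h5
  rw [← abs_mul] at h6 h7
  simp only [forceCoef]
  rw [abs_le] at h6 h7 ⊢
  constructor <;> linarith [h6.1, h6.2, h7.1, h7.2]

theorem IsGentle.norm_mass_sub_le (w : Space) : ‖m.mass p w - w‖ ≤ 18 * ε * ‖w‖ := by
  have h : ∀ i, |(m.mass p w - w) i| ≤ 3 * (3 * ε) * ‖w‖ := by
    intro i
    have e : (m.mass p w - w) i
        = ∑ j, (m.lapse p * m.metric i j p - (if i = j then 1 else 0)) * w j := by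
      simp [sub_mul, Finset.sum_sub_distrib]
    rw [e]
    exact Space.abs_sum_le (hm.abs_mass_sub_le hR hε hp i) w
  refine (Space.norm_le_of_abs_le h).trans (le_of_eq ?_)
  ring

/-- The mass matrix is within `18 * ε` of the identity, so it is invertible with inverse of norm at
most `2`. -/
theorem IsGentle.norm_le_mass (w : Space) : ‖w‖ ≤ 2 * ‖m.mass p w‖ := by
  have h1 := hm.norm_mass_sub_le hR hε hp w
  have h2 := norm_sub_norm_le w (m.mass p w)
  rw [norm_sub_rev] at h2
  have h3 : 18 * ε * ‖w‖ ≤ 1 / 2 * ‖w‖ := by gcongr; linarith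
  linarith

theorem IsGentle.mass_injective : Function.Injective (m.mass p) := by
  rw [injective_iff_map_eq_zero]
  intro w hw
  have := hm.norm_le_mass hR hε hp w
  rw [hw] at this
  simpa using this

/-- Injectivity implies surjectivity in finite dimension, so the choice in `acc` is a genuine
solution of the linear system. -/
theorem IsGentle.mass_acc (v : Space) : m.mass p (m.acc p v) = m.force p v :=
  Function.invFun_eq
    (LinearMap.injective_iff_surjective.1 (hm.mass_injective hR hε hp) (m.force p v))

theorem IsGentle.eq_acc {a v : Space} (h : m.mass p a = m.force p v) : a = m.acc p v :=
  hm.mass_injective hR hε hp (h.trans (hm.mass_acc hR hε hp v).symm)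

theorem IsGentle.acc_bound (v : Space) : ‖m.acc p v‖ ≤ 144 * ε / R * ‖v‖ ^ 2 := by
  have h1 := hm.norm_le_mass hR hε hp (m.acc p v)
  rw [hm.mass_acc hR hε hp] at h1
  have h2 : ‖m.force p v‖ ≤ 2 * (9 * (4 * (ε / R)) * ‖v‖ * ‖v‖) :=
    Space.norm_le_of_abs_le fun i =>
      Space.abs_sum_sum_le (hm.abs_forceCoef_le hR hε hp i) v v
  calc ‖m.acc p v‖ ≤ 2 * (2 * (9 * (4 * (ε / R)) * ‖v‖ * ‖v‖)) := by linarith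
    _ = 144 * ε / R * ‖v‖ ^ 2 := by ring

theorem IsGentle.abs_forceCoef_sub_le {p' : Space} (hp' : p' ∈ Metric.ball x R) (i j k : Fin 3) :
    |m.forceCoef i j k p - m.forceCoef i j k p'| ≤ 24 * ε / R ^ 2 * ‖p - p'‖ := by
  have h0 := hm.eps_nonneg hR
  have hd : 0 ≤ ε / R ^ 2 * ‖p - p'‖ := by positivity
  have h1 : |m.spatialChristoffel i j k p - m.spatialChristoffel i j k p'|
      ≤ 6 * (ε / R ^ 2 * ‖p - p'‖) := by
    have h1 := abs_le.1 ((hm.metric i k).deriv_lip p hp p' hp' j)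
    have h2 := abs_le.1 ((hm.metric i j).deriv_lip p hp p' hp' k)
    have h3 := abs_le.1 ((hm.metric j k).deriv_lip p hp p' hp' i)
    have e : 4 * ε / R ^ 2 * ‖p - p'‖ = 4 * (ε / R ^ 2 * ‖p - p'‖) := by ring
    rw [e] at h1 h2 h3
    simp only [spatialChristoffel]
    rw [abs_le]
    constructor <;> linarith [h1.1, h1.2, h2.1, h2.2, h3.1, h3.2]
  have h2 := abs_mul_sub_mul_le (hm.lapse.lip hp hp') h1 (hm.lapse_mem hε hp').1
    (hm.abs_spatialChristoffel_le hp i j k)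
  have h3 := abs_mul_sub_mul_le (hm.lapse.deriv_lip p hp p' hp' i) ((hm.metric j k).lip hp hp')
    (hm.lapse.deriv_le p' hp' i) (hm.abs_metric_le hε hp j k)
  have e1 : 4 * ε / R * ‖p - p'‖ * (3 / 2 * (ε / R)) = 6 * ε * (ε / R ^ 2 * ‖p - p'‖) := by ring
  have e2 : ε / R * (4 * ε / R * ‖p - p'‖) = 4 * ε * (ε / R ^ 2 * ‖p - p'‖) := by ring
  have e3 : 4 * ε / R ^ 2 * ‖p - p'‖ = 4 * (ε / R ^ 2 * ‖p - p'‖) := by ring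
  have e4 : 24 * ε / R ^ 2 * ‖p - p'‖ = 24 * (ε / R ^ 2 * ‖p - p'‖) := by ring
  rw [e1] at h2
  rw [e2, e3] at h3
  rw [e4]
  have h4 : ε * (ε / R ^ 2 * ‖p - p'‖) ≤ 1 / 1000 * (ε / R ^ 2 * ‖p - p'‖) := by gcongr
  simp only [forceCoef]
  rw [abs_le] at h2 h3 ⊢
  constructor <;> linarith [h2.1, h2.2, h3.1, h3.2]

theorem IsGentle.norm_force_sub_le {p' : Space} (hp' : p' ∈ Metric.ball x R) (v v' : Space) :
    ‖m.force p v - m.force p' v'‖ ≤ 432 * (ε / R ^ 2) * ‖p - p'‖ * (‖v‖ + ‖v'‖) ^ 2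
      + 72 * (ε / R) * ‖v - v'‖ * (‖v‖ + ‖v'‖) := by
  have h0 := hm.eps_nonneg hR
  have h : ∀ i, |(m.force p v - m.force p' v') i| ≤
      9 * (24 * ε / R ^ 2 * ‖p - p'‖) * ‖v‖ * ‖v‖ + (9 * (4 * (ε / R)) * ‖v - v'‖ * ‖v‖
        + 9 * (4 * (ε / R)) * ‖v'‖ * ‖v - v'‖) := by
    intro i
    have e : (m.force p v - m.force p' v') i
        = ∑ j, ∑ k, (m.forceCoef i j k p - m.forceCoef i j k p') * v j * v k
        + (∑ j, ∑ k, m.forceCoef i j k p' * (v - v') j * v k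
        + ∑ j, ∑ k, m.forceCoef i j k p' * v' j * (v - v') k) := by
      simp only [PiLp.sub_apply, force_apply, ← Finset.sum_add_distrib, ← Finset.sum_sub_distrib]
      exact Finset.sum_congr rfl fun j _ => Finset.sum_congr rfl fun k _ => by ring
    rw [e]
    refine (abs_add_le _ _).trans (add_le_add ?_ ((abs_add_le _ _).trans (add_le_add ?_ ?_)))
    · exact Space.abs_sum_sum_le (hm.abs_forceCoef_sub_le hR hε hp hp' i) v v
    · exact Space.abs_sum_sum_le (hm.abs_forceCoef_le hR hε hp' i) (v - v') v
    · exact Space.abs_sum_sum_le (hm.abs_forceCoef_le hR hε hp' i) v' (v - v')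
  refine (Space.norm_le_of_abs_le h).trans ?_
  have h1 : ‖v‖ * ‖v‖ ≤ (‖v‖ + ‖v'‖) ^ 2 := by nlinarith [norm_nonneg v, norm_nonneg v']
  have h2 : 432 * (ε / R ^ 2) * ‖p - p'‖ * (‖v‖ * ‖v‖)
      ≤ 432 * (ε / R ^ 2) * ‖p - p'‖ * (‖v‖ + ‖v'‖) ^ 2 := by gcongr
  refine le_trans (le_of_eq ?_) (add_le_add_left h2 _)
  ring

theorem IsGentle.norm_mass_sub_mass_le {p' : Space} (hp' : p' ∈ Metric.ball x R) (w : Space) :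
    ‖m.mass p w - m.mass p' w‖ ≤ 96 * (ε / R) * ‖p - p'‖ * ‖w‖ := by
  have h0 := hm.eps_nonneg hR
  have h : ∀ i, |(m.mass p w - m.mass p' w) i| ≤ 3 * (16 * (ε / R) * ‖p - p'‖) * ‖w‖ := by
    intro i
    have e : (m.mass p w - m.mass p' w) i
        = ∑ j, (m.lapse p * m.metric i j p - m.lapse p' * m.metric i j p') * w j := by
      simp [sub_mul, Finset.sum_sub_distrib]
    rw [e]
    refine Space.abs_sum_le (fun j => ?_) w
    have h1 := abs_mul_sub_mul_le (hm.lapse.lip hp hp') ((hm.metric i j).lip hp hp')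
      (hm.lapse_mem hε hp').1 (hm.abs_metric_le hε hp i j)
    have hd : 0 ≤ ε / R * ‖p - p'‖ := by positivity
    have e1 : 4 * ε / R * ‖p - p'‖ = 4 * (ε / R * ‖p - p'‖) := by ring
    rw [e1] at h1
    linarith
  refine (Space.norm_le_of_abs_le h).trans (le_of_eq ?_)
  ring

end Bounds

/-- The acceleration is known only through `mass p (acc p v) = force p v`. Its variation is
therefore measured after applying `mass p`: it splits into the variation of the force and that of
the mass matrix acting on a fixed acceleration, and `norm_le_mass` removes the matrix. The constant
`1000` covers all contributions. -/
theorem IsGentle.isSpray_acc (hR : 0 < R) (hε : ε ≤ 1 / 1000) (hm : m.IsGentle x R ε) :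
    IsSpray m.acc (Metric.ball x R) R (1000 * ε) := by
  have h0 := hm.eps_nonneg hR
  refine ⟨fun p hp v => ?_, fun p hp p' hp' v v' => ?_⟩
  · refine (hm.acc_bound hR hε hp v).trans ?_
    gcongr
    norm_num
  · have h1 := hm.norm_le_mass hR hε hp (m.acc p v - m.acc p' v')
    have e : m.mass p (m.acc p v - m.acc p' v') = (m.force p v - m.force p' v')
        - (m.mass p (m.acc p' v') - m.mass p' (m.acc p' v')) := by
      rw [map_sub, hm.mass_acc hR hε hp, hm.mass_acc hR hε hp']
      abel
    rw [e] at h1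
    have h2 := norm_sub_le (m.force p v - m.force p' v')
      (m.mass p (m.acc p' v') - m.mass p' (m.acc p' v'))
    have h3 := hm.norm_force_sub_le hR hε hp hp' v v'
    have h4 := hm.norm_mass_sub_mass_le hR hε hp hp' (m.acc p' v')
    have h5 : 96 * (ε / R) * ‖p - p'‖ * ‖m.acc p' v'‖
        ≤ 14 * (ε / R ^ 2) * ‖p - p'‖ * (‖v‖ + ‖v'‖) ^ 2 := by
      have h6 : ‖v'‖ ^ 2 ≤ (‖v‖ + ‖v'‖) ^ 2 := by
        have := norm_nonneg v
        gcongr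
        linarith
      calc 96 * (ε / R) * ‖p - p'‖ * ‖m.acc p' v'‖
          ≤ 96 * (ε / R) * ‖p - p'‖ * (144 * (1 / 1000) / R * (‖v‖ + ‖v'‖) ^ 2) := by
            gcongr
            refine (hm.acc_bound hR hε hp' v').trans ?_
            gcongr
        _ = 96 * 144 / 1000 * (ε / R ^ 2) * ‖p - p'‖ * (‖v‖ + ‖v'‖) ^ 2 := by ring
        _ ≤ 14 * (ε / R ^ 2) * ‖p - p'‖ * (‖v‖ + ‖v'‖) ^ 2 := by gcongr; norm_num
    have h7 : 0 ≤ ε / R ^ 2 * ‖p - p'‖ * (‖v‖ + ‖v'‖) ^ 2 := by positivity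
    have h8 : 0 ≤ ε / R * ‖v - v'‖ * (‖v‖ + ‖v'‖) := by positivity
    calc ‖m.acc p v - m.acc p' v'‖
        ≤ 892 * (ε / R ^ 2 * ‖p - p'‖ * (‖v‖ + ‖v'‖) ^ 2)
          + 144 * (ε / R * ‖v - v'‖ * (‖v‖ + ‖v'‖)) := by linarith
      _ ≤ 1000 * (ε / R ^ 2 * ‖p - p'‖ * (‖v‖ + ‖v'‖) ^ 2)
          + 1000 * (ε / R * ‖v - v'‖ * (‖v‖ + ‖v'‖)) := by linarith
      _ = _ := by ring

theorem acc_neg (p v : Space) : m.acc p (-v) = m.acc p v := by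
  have : m.force p (-v) = m.force p v := by
    ext i
    simp
  rw [acc, this, acc]

theorem kinetic_neg (p v : Space) : m.kinetic p (-v) = m.kinetic p v := by
  simp [kinetic]

/-- Polarised form of the comparison of `kinetic` with the Euclidean norm. -/
theorem IsGentle.kinetic_sub_le (hR : 0 < R) (hε : ε ≤ 1 / 1000) (hm : m.IsGentle x R ε)
    {p : Space} (hp : p ∈ Metric.ball x R) (v v' : Space) :
    |(m.kinetic p v - ‖v‖ ^ 2) - (m.kinetic p v' - ‖v'‖ ^ 2)|
      ≤ 27 * ε * (‖v‖ + ‖v'‖) * ‖v - v'‖ := by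
  have e : (m.kinetic p v - ‖v‖ ^ 2) - (m.kinetic p v' - ‖v'‖ ^ 2)
      = ∑ i, ∑ j, (m.lapse p * m.metric i j p - (if i = j then 1 else 0)) * (v - v') i * v j
      + ∑ i, ∑ j, (m.lapse p * m.metric i j p - (if i = j then 1 else 0)) * v' i * (v - v') j := by
    rw [EuclideanSpace.norm_sq_eq, EuclideanSpace.norm_sq_eq]
    simp only [kinetic, Fin.sum_univ_three, Real.norm_eq_abs, sq_abs, PiLp.sub_apply]
    norm_num [Fin.ext_iff]
    ring
  rw [e]
  refine (abs_add_le _ _).trans (le_trans (add_le_add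
    (Space.abs_sum_sum_le (hm.abs_mass_sub_le hR hε hp) _ _)
    (Space.abs_sum_sum_le (hm.abs_mass_sub_le hR hε hp) _ _)) (le_of_eq ?_))
  ring

theorem IsGentle.abs_kinetic_sub_le (hR : 0 < R) (hε : ε ≤ 1 / 1000) (hm : m.IsGentle x R ε)
    {p : Space} (hp : p ∈ Metric.ball x R) (v : Space) :
    |m.kinetic p v - ‖v‖ ^ 2| ≤ 27 * ε * ‖v‖ ^ 2 := by
  have h := hm.kinetic_sub_le hR hε hp v 0
  have e : m.kinetic p 0 = 0 := by simp [kinetic]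
  rw [e] at h
  simp only [norm_zero, sub_zero, add_zero] at h
  norm_num at h
  refine h.trans (le_of_eq ?_)
  ring

/-- Conservation of energy. In `2 * lapse * metric (acc, v)` the Christoffel part of the force
cancels the derivative of the metric along the ray, and the lapse part cancels the derivative of the
lapse. -/
theorem IsGentle.hasDerivWithinAt_kinetic (hR : 0 < R) (hε : ε ≤ 1 / 1000)
    (hm : m.IsGentle x R ε) {γ v : ℝ → Space} (hγ : IsSprayCurve m.acc (Metric.ball x R) γ v)
    {s : ℝ} (hs : s ∈ Set.Icc (0 : ℝ) 1) :
    HasDerivWithinAt (fun s => m.kinetic (γ s) (v s)) 0 (Set.Icc 0 1) s := by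
  have hmem := hγ.mem s hs
  have hφ := hm.lapse.comp_curve (hγ.pos s hs) hmem
  have hG := fun i j => (hm.metric i j).comp_curve (hγ.pos s hs) hmem
  have hv : ∀ i, HasDerivWithinAt (fun s => v s i) (m.acc (γ s) (v s) i) (Set.Icc 0 1) s :=
    fun i => (EuclideanSpace.proj i : Space →L[ℝ] ℝ).hasFDerivAt.comp_hasDerivWithinAt s
      (hγ.vel s hs)
  have h := hφ.mul (HasDerivWithinAt.fun_sum (u := Finset.univ) fun i _ =>
    HasDerivWithinAt.fun_sum (u := Finset.univ) fun j _ => ((hG i j).mul (hv i)).mul (hv j))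
  refine h.congr_deriv ?_
  have hmass : ∀ i, ∑ j, m.lapse (γ s) * m.metric i j (γ s) * m.acc (γ s) (v s) j
      = ∑ j, ∑ k, m.forceCoef i j k (γ s) * v s j * v s k := fun i =>
    congrArg (fun w : Space => w i) (hm.mass_acc hR hε hmem (v s))
  have hsymm := fun i j => hm.symm i j _ hmem
  have h0 := hmass 0
  have h1 := hmass 1
  have h2 := hmass 2
  simp only [forceCoef, spatialChristoffel, Fin.sum_univ_three] at h0 h1 h2 ⊢
  rw [hsymm 1 0, hsymm 2 0, hsymm 2 1] at *
  simp only [Pi.mul_apply]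
  rw [hsymm 1 0, hsymm 2 0, hsymm 2 1]
  -- Pairing the equation of motion with twice the velocity; after the symmetry of the metric has
  -- been used, the rest is a polynomial identity.
  linear_combination 2 * v s 0 * h0 + 2 * v s 1 * h1 + 2 * v s 2 * h2

end StaticCoefficients

-- Polarization: `‖p‖ ^ 2 - ‖q‖ ^ 2` is the inner product of `p - q` and `p + q`. A second
-- difference of squares thus becomes two products, each with one small factor.
open scoped InnerProductSpace in
theorem abs_norm_sq_sub_sub_le {E : Type*} [NormedAddCommGroup E] [InnerProductSpace ℝ E]
    {v v' u u' : E} {α β σ τ : ℝ} (h1 : ‖v - v' - (u - u')‖ ≤ α) (h2 : ‖v + u‖ ≤ σ)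
    (h3 : ‖v' - u'‖ ≤ β) (h4 : ‖v - v' + (u - u')‖ ≤ τ) :
    |(‖v‖ ^ 2 - ‖v'‖ ^ 2) - (‖u‖ ^ 2 - ‖u'‖ ^ 2)| ≤ α * σ + β * τ := by
  have e : (‖v‖ ^ 2 - ‖v'‖ ^ 2) - (‖u‖ ^ 2 - ‖u'‖ ^ 2)
      = ⟪v - v' - (u - u'), v + u⟫_ℝ + ⟪v' - u', v - v' + (u - u')⟫_ℝ := by
    have e1 : v - v' - (u - u') = (v - u) - (v' - u') := by abel
    have e2 : v - v' + (u - u') = (v + u) - (v' + u') := by abel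
    rw [e1, e2, inner_sub_right, inner_sub_left]
    have e3 : ∀ p q : E, ⟪p - q, p + q⟫_ℝ = ‖p‖ ^ 2 - ‖q‖ ^ 2 := fun p q => by
      rw [inner_sub_left, inner_add_right, inner_add_right, real_inner_self_eq_norm_sq,
        real_inner_self_eq_norm_sq, real_inner_comm]
      ring
    rw [e3, e3]
    ring
  rw [e]
  refine (abs_add_le _ _).trans (add_le_add ((abs_real_inner_le_norm _ _).trans ?_)
    ((abs_real_inner_le_norm _ _).trans ?_))
  · exact mul_le_mul h1 h2 (norm_nonneg _) ((norm_nonneg _).trans h1)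
  · exact mul_le_mul h3 h4 (norm_nonneg _) ((norm_nonneg _).trans h3)

/-- Squared lengths `n²`, `n'²` that are perturbed to `P`, `P'` and rescaled by clock factors `I`,
`I'` near `1` keep their difference, up to a small error. -/
theorem abs_mul_sq_sub_le {R ε P P' I I' n n' b b' D : ℝ} (hR : 0 < R) (h0 : 0 ≤ ε)
    (hε : ε ≤ 1 / 1000000) (hn : n ≤ 2 * b) (hn' : n' ≤ 2 * b') (hn0 : 0 ≤ n) (hn0' : 0 ≤ n')
    (hb' : b' ≤ 2 * R) (hI : -(2 * ε) ≤ I - 1 ∧ I - 1 ≤ 2 * ε)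
    (hI' : -(2 * ε) ≤ I' - 1 ∧ I' - 1 ≤ 2 * ε) (hII : |I - I'| ≤ 16 * ε / R * D) (hD : 0 ≤ D)
    (hnn : |n - n'| ≤ 2 * D)
    (hN : |(P - n ^ 2) - (P' - n' ^ 2)| ≤ 27 * ε * (n + n') * (2 * D))
    (hP' : -(27 * ε * n' ^ 2) ≤ P' - n' ^ 2 ∧ P' - n' ^ 2 ≤ 27 * ε * n' ^ 2)
    (hnb : |(n ^ 2 - n' ^ 2) - (b ^ 2 - b' ^ 2)| ≤ 1236000 * ε * ((b + b') * D)) :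
    |(P * I ^ 2 - b ^ 2) - (P' * I' ^ 2 - b' ^ 2)| ≤ 2000000 * ε * (b + b') * D := by
  have hb0 : 0 ≤ b := by linarith
  have hb0' : 0 ≤ b' := by linarith
  have hSD : 0 ≤ (b + b') * D := by positivity
  have hεSD : ε * ((b + b') * D) ≤ 1 / 1000000 * ((b + b') * D) := by gcongr
  have hpos : 0 ≤ ε * ((b + b') * D) := by positivity
  have hNle : |(P - n ^ 2) - (P' - n' ^ 2)| ≤ 108 * ε * ((b + b') * D) := by
    calc _ ≤ 27 * ε * (n + n') * (2 * D) := hN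
      _ ≤ 27 * ε * (2 * b + 2 * b') * (2 * D) := by gcongr
      _ = _ := by ring
  have hnn2 : |n ^ 2 - n' ^ 2| ≤ 4 * ((b + b') * D) := by
    have e : n ^ 2 - n' ^ 2 = (n - n') * (n + n') := by ring
    rw [e, abs_mul, abs_of_nonneg (show 0 ≤ n + n' by positivity)]
    calc _ ≤ (2 * D) * (2 * b + 2 * b') := by gcongr
      _ = _ := by ring
  have hPP : |P - P'| ≤ 8 * ((b + b') * D) := by
    rw [abs_le] at hNle hnn2 ⊢
    constructor <;> linarith [hNle.1, hNle.2, hnn2.1, hnn2.2]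
  have hI2 : |I ^ 2 - 1| ≤ 6 * ε := by
    rw [abs_le]
    constructor <;> nlinarith [hI.1, hI.2]
  have hII2 : |I ^ 2 - I' ^ 2| ≤ 48 * ε / R * D := by
    have e : I ^ 2 - I' ^ 2 = (I - I') * (I + I') := by ring
    rw [e, abs_mul, abs_of_nonneg (show 0 ≤ I + I' by linarith [hI.1, hI'.1])]
    calc _ ≤ 16 * ε / R * D * 3 :=
          mul_le_mul hII (by linarith [hI.2, hI'.2]) (by linarith [hI.1, hI'.1]) (by positivity)
      _ = _ := by ring
  have hP2 : |P'| ≤ 16 * R * (b + b') := by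
    have h1 : n' ^ 2 ≤ (2 * (2 * R)) * (2 * (b + b')) := by
      rw [sq]
      exact mul_le_mul (by linarith) (by linarith) hn0' (by positivity)
    rw [abs_le]
    have h2 : ε * n' ^ 2 ≤ 1 / 1000000 * n' ^ 2 := by gcongr
    have h3 : 0 ≤ n' ^ 2 := by positivity
    constructor <;> linarith [hP'.1, hP'.2]
  have t1 : |(P - P') * (I ^ 2 - 1)| ≤ 48 * ε * ((b + b') * D) := by
    rw [abs_mul]
    calc _ ≤ 8 * ((b + b') * D) * (6 * ε) := by gcongr
      _ = _ := by ring
  have t2 : |P' * (I ^ 2 - I' ^ 2)| ≤ 768 * ε * ((b + b') * D) := by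
    rw [abs_mul]
    calc _ ≤ 16 * R * (b + b') * (48 * ε / R * D) := by gcongr
      _ = _ := by field_simp; ring
  have e : (P * I ^ 2 - b ^ 2) - (P' * I' ^ 2 - b' ^ 2)
      = (P - P') * (I ^ 2 - 1) + P' * (I ^ 2 - I' ^ 2) + ((P - n ^ 2) - (P' - n' ^ 2))
        + ((n ^ 2 - n' ^ 2) - (b ^ 2 - b' ^ 2)) := by ring
  rw [e]
  refine (abs_add_le _ _).trans (le_trans (add_le_add ((abs_add_le _ _).trans
    (add_le_add ((abs_add_le _ _).trans (add_le_add t1 t2)) hNle)) hnb) ?_)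
  linarith

/-! ### Light rays and their travel times -/

namespace StaticCoefficients

variable {m : StaticCoefficients} {x : Space} {R ε : ℝ}

theorem IsGentle.kinetic_eq (hR : 0 < R) (hε : ε ≤ 1 / 1000) (hm : m.IsGentle x R ε)
    {γ v : ℝ → Space} (hγ : IsSprayCurve m.acc (Metric.ball x R) γ v) {s t : ℝ}
    (hs : s ∈ Set.Icc (0 : ℝ) 1) (ht : t ∈ Set.Icc (0 : ℝ) 1) :
    m.kinetic (γ t) (v t) = m.kinetic (γ s) (v s) := by
  have h := norm_sub_le_of_deriv_le_unitInterval (f := fun s => m.kinetic (γ s) (v s))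
    (f' := fun _ => 0) (C := 0)
    (fun r hr => hm.hasDerivWithinAt_kinetic hR hε hγ hr) (by simp) hs ht
  exact sub_eq_zero.1 (norm_le_zero_iff.1 h)

/-- The conserved kinetic form is close to the squared Euclidean speed. This supplies the hypothesis
on speeds under which spray curves were studied. -/
theorem IsGentle.speed_ratio (hR : 0 < R) (hε : ε ≤ 1 / 1000) (hm : m.IsGentle x R ε)
    {γ v : ℝ → Space} (hγ : IsSprayCurve m.acc (Metric.ball x R) γ v) :
    ∀ s ∈ Set.Icc (0 : ℝ) 1, ∀ t ∈ Set.Icc (0 : ℝ) 1, ‖v t‖ ≤ 2 * ‖v s‖ := by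
  intro s hs t ht
  have h1 := abs_le.1 (hm.abs_kinetic_sub_le hR hε (hγ.mem s hs) (v s))
  have h2 := abs_le.1 (hm.abs_kinetic_sub_le hR hε (hγ.mem t ht) (v t))
  rw [hm.kinetic_eq hR hε hγ hs ht] at h2
  have h3 : ε * ‖v s‖ ^ 2 ≤ 1 / 1000 * ‖v s‖ ^ 2 := by gcongr
  have h4 : ε * ‖v t‖ ^ 2 ≤ 1 / 1000 * ‖v t‖ ^ 2 := by gcongr
  refine (abs_le_of_sq_le_sq' ?_ (by positivity)).2
  nlinarith [sq_nonneg ‖v s‖]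

theorem IsGentle.kinetic_pos (hR : 0 < R) (hε : ε ≤ 1 / 1000) (hm : m.IsGentle x R ε)
    {p v : Space} (hp : p ∈ Metric.ball x R) (hv : v ≠ 0) : 0 < m.kinetic p v := by
  have h1 := (abs_le.1 (hm.abs_kinetic_sub_le hR hε hp v)).1
  have h2 : 0 < ‖v‖ ^ 2 := by have := norm_pos_iff.2 hv; positivity
  have h3 : ε * ‖v‖ ^ 2 ≤ 1 / 1000 * ‖v‖ ^ 2 := by gcongr
  linarith

/-- The spatial curve `γ`, with velocity `v`, is a light ray in `U` from `a` to `y`, and `J` is a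
primitive of the inverse lapse along it. -/
structure IsRay (m : StaticCoefficients) (U : Set Space) (a y : Space) (γ v : ℝ → Space)
    (J : ℝ → ℝ) : Prop where
  curve : IsSprayCurve m.acc U γ v
  clock : ∀ s ∈ Set.Icc (0 : ℝ) 1, HasDerivWithinAt J (m.lapse (γ s))⁻¹ (Set.Icc 0 1) s
  source : γ 0 = a
  target : γ 1 = y

/-- The coordinate time `x⁰` needed by the light ray. -/
noncomputable def rayTime (m : StaticCoefficients) (γ v : ℝ → Space) (J : ℝ → ℝ) : ℝ :=
  Real.sqrt (m.kinetic (γ 0) (v 0)) * (J 1 - J 0)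

/-- A light ray in `U` leads from `a` to `y` in the coordinate time `T`. -/
def HasTravelTime (m : StaticCoefficients) (U : Set Space) (a y : Space) (T : ℝ) : Prop :=
  ∃ γ v J, m.IsRay U a y γ v J ∧ T = m.rayTime γ v J

section Ray

variable (hR : 0 < R) (hε : ε ≤ 1 / 1000000) (hm : m.IsGentle x R ε)

include hR hε hm

omit hR in
theorem IsGentle.continuousOn_inv_lapse {γ v : ℝ → Space}
    (hγ : IsSprayCurve m.acc (Metric.ball x R) γ v) :
    ContinuousOn (fun s => (m.lapse (γ s))⁻¹) (Set.Icc 0 1) := by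
  intro s hs
  refine (hm.lapse.comp_curve (hγ.pos s hs) (hγ.mem s hs)).continuousWithinAt.inv₀ ?_
  have := (hm.lapse_mem (by linarith) (hγ.mem s hs)).2
  positivity

theorem IsGentle.exists_ray {a y : Space} (ha : ‖a - x‖ ≤ 9 / 10 * R)
    (hy : ‖y - x‖ ≤ 9 / 10 * R) : ∃ γ v J, m.IsRay (Metric.ball x R) a y γ v J := by
  have h0 := hm.eps_nonneg hR
  obtain ⟨γ, v, hγ, h1, h2⟩ := (hm.isSpray_acc hR (by linarith)).exists_curve hR (by linarith)
    (by linarith) ha hy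
  obtain ⟨J, -, hJ⟩ := exists_antiderivative_unitInterval
    (hm.continuousOn_inv_lapse hε hγ)
  exact ⟨γ, v, J, hγ, hJ, h1, h2⟩

theorem IsGentle.exists_travelTime {a y : Space} (ha : ‖a - x‖ ≤ 9 / 10 * R)
    (hy : ‖y - x‖ ≤ 9 / 10 * R) : ∃ T, m.HasTravelTime (Metric.ball x R) a y T := by
  obtain ⟨γ, v, J, h⟩ := hm.exists_ray hR hε ha hy
  exact ⟨_, γ, v, J, h, rfl⟩

theorem IsGentle.clock_sub_le {a y : Space} {γ v : ℝ → Space} {J : ℝ → ℝ}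
    (h : m.IsRay (Metric.ball x R) a y γ v J) : |J 1 - J 0 - 1| ≤ 2 * ε := by
  refine norm_increment_sub_le (w := (1 : ℝ)) h.clock fun s hs => ?_
  have h1 := hm.lapse.near _ (h.curve.mem s hs)
  have h2 := (hm.lapse_mem (by linarith) (h.curve.mem s hs)).2
  have h3 : (m.lapse (γ s))⁻¹ - 1 = -(m.lapse (γ s) - 1) / m.lapse (γ s) := by
    have : m.lapse (γ s) ≠ 0 := by positivity
    field_simp
    ring
  have h0 := hm.eps_nonneg hR
  rw [h3, Real.norm_eq_abs, abs_div, abs_neg, abs_of_pos (show 0 < m.lapse (γ s) by positivity),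
    div_le_iff₀ (by positivity)]
  nlinarith

theorem IsGentle.travelTime_nonneg {a y : Space} {T : ℝ}
    (h : m.HasTravelTime (Metric.ball x R) a y T) : 0 ≤ T := by
  obtain ⟨γ, v, J, h, rfl⟩ := h
  have := abs_le.1 (hm.clock_sub_le hR hε h)
  exact mul_nonneg (Real.sqrt_nonneg _) (by linarith)

/-- The constant curve is a degenerate ray. It lifts to no signal, but it serves as the reference
from which travel times are compared with distances. -/
theorem IsGentle.travelTime_self {a : Space} (ha : a ∈ Metric.ball x R) :
    m.HasTravelTime (Metric.ball x R) a a 0 := by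
  refine ⟨fun _ => a, fun _ => 0, fun s => s * (m.lapse a)⁻¹,
    ⟨⟨fun _ _ => ha, fun s _ => hasDerivWithinAt_const _ _ _, fun s _ => ?_⟩, fun s _ => ?_, rfl,
      rfl⟩, ?_⟩
  · refine (hasDerivWithinAt_const _ _ _).congr_deriv ?_
    have := hm.acc_bound hR (by linarith) ha 0
    exact (by simpa using this : m.acc a 0 = 0).symm
  · simpa using (hasDerivWithinAt_id s (Set.Icc (0 : ℝ) 1)).mul_const (m.lapse a)⁻¹
  · simp [rayTime, kinetic]

theorem IsGentle.ray_compare {a y y' : Space} {γ v γ' v' : ℝ → Space} {J J' : ℝ → ℝ}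
    (h : m.IsRay (Metric.ball x R) a y γ v J) (h' : m.IsRay (Metric.ball x R) a y' γ' v' J')
    {s : ℝ} (hs : s ∈ Set.Icc (0 : ℝ) 1) :
    ‖γ s - γ' s‖ ≤ 2 * ‖y - y'‖ ∧ ‖v s - v' s - (y - y')‖ ≤ 400000 * ε * ‖y - y'‖ ∧
      ‖v s - v' s‖ ≤ 2 * ‖y - y'‖ := by
  have h0 := hm.eps_nonneg hR
  have hε' : ε ≤ 1 / 1000 := by linarith
  have := h.curve.compare hR (by linarith) (by linarith) (hm.isSpray_acc hR hε')
    (hm.speed_ratio hR hε' h.curve) h'.curve (hm.speed_ratio hR hε' h'.curve)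
    (h.source.trans h'.source.symm) hs
  rw [h.target, h'.target] at this
  refine ⟨this.1, this.2.1.trans (le_of_eq (by ring)), this.2.2⟩

theorem IsGentle.ray_velocity {a y : Space} {γ v : ℝ → Space} {J : ℝ → ℝ}
    (h : m.IsRay (Metric.ball x R) a y γ v J) {s : ℝ} (hs : s ∈ Set.Icc (0 : ℝ) 1) :
    ‖v s‖ ≤ 2 * ‖y - a‖ ∧ ‖v s - (y - a)‖ ≤ 12000 * ε * ‖y - a‖ := by
  have h0 := hm.eps_nonneg hR
  have hε' : ε ≤ 1 / 1000 := by linarith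
  have := h.curve.velocity_sub_le hR (by linarith) (by linarith) (hm.isSpray_acc hR hε')
    (hm.speed_ratio hR hε' h.curve) hs
  rw [h.target, h.source] at this
  exact ⟨this.1, this.2.trans (le_of_eq (by ring))⟩

theorem IsGentle.ray_unique {a y : Space} {γ v γ' v' : ℝ → Space} {J J' : ℝ → ℝ}
    (h : m.IsRay (Metric.ball x R) a y γ v J) (h' : m.IsRay (Metric.ball x R) a y γ' v' J')
    {s : ℝ} (hs : s ∈ Set.Icc (0 : ℝ) 1) : γ s = γ' s ∧ v s = v' s := by
  have := hm.ray_compare hR hε h h' hs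
  simp only [sub_self, norm_zero, mul_zero] at this
  exact ⟨sub_eq_zero.1 (norm_le_zero_iff.1 this.1), sub_eq_zero.1 (norm_le_zero_iff.1 this.2.2)⟩

theorem IsGentle.ray_velocity_ne_zero {a y : Space} (hay : a ≠ y) {γ v : ℝ → Space} {J : ℝ → ℝ}
    (h : m.IsRay (Metric.ball x R) a y γ v J) {s : ℝ} (hs : s ∈ Set.Icc (0 : ℝ) 1) : v s ≠ 0 := by
  intro h0
  have h1 := (hm.ray_velocity hR hε h hs).2
  have h2 : 0 < ‖y - a‖ := norm_pos_iff.2 (sub_ne_zero.2 hay.symm)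
  rw [h0, zero_sub, norm_neg] at h1
  nlinarith

/-- Time reversal: the acceleration is even in the velocity, and the conserved energy may be
evaluated at either end. -/
theorem IsGentle.travelTime_symm {a y : Space} {T : ℝ}
    (h : m.HasTravelTime (Metric.ball x R) a y T) :
    m.HasTravelTime (Metric.ball x R) y a T := by
  obtain ⟨γ, v, J, h, rfl⟩ := h
  have hflip : ∀ s ∈ Set.Icc (0 : ℝ) 1, 1 - s ∈ Set.Icc (0 : ℝ) 1 := fun s hs =>
    ⟨by linarith [hs.2], by linarith [hs.1]⟩
  have hd : ∀ s : ℝ, HasDerivWithinAt (fun s : ℝ => 1 - s) (-1) (Set.Icc 0 1) s := fun s => by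
    simpa using (hasDerivWithinAt_id s (Set.Icc (0 : ℝ) 1)).const_sub 1
  refine ⟨fun s => γ (1 - s), fun s => -v (1 - s), fun s => -J (1 - s),
    ⟨⟨fun s hs => h.curve.mem _ (hflip s hs), fun s hs => ?_, fun s hs => ?_⟩, fun s hs => ?_,
      by simp [h.target], by simp [h.source]⟩, ?_⟩
  · exact ((h.curve.pos _ (hflip s hs)).scomp s (hd s) hflip).congr_deriv (by simp)
  · rw [acc_neg]
    exact ((h.curve.vel _ (hflip s hs)).scomp s (hd s) hflip).neg.congr_deriv (by simp)
  · exact ((h.clock _ (hflip s hs)).scomp s (hd s) hflip).neg.congr_deriv (by simp)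
  · simp only [rayTime, sub_zero, sub_self, kinetic_neg]
    rw [hm.kinetic_eq hR (by linarith) h.curve (s := 0) (t := 1) (by simp) (by simp)]
    ring

/-- Nearby targets give nearby rays, and the inverse lapse is Lipschitz; integrating along both rays
compares their clocks. -/
theorem IsGentle.clock_sub_clock_le {a y y' : Space} {γ v γ' v' : ℝ → Space} {J J' : ℝ → ℝ}
    (h : m.IsRay (Metric.ball x R) a y γ v J) (h' : m.IsRay (Metric.ball x R) a y' γ' v' J') :
    |(J 1 - J 0) - (J' 1 - J' 0)| ≤ 16 * ε / R * ‖y - y'‖ := by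
  have h0 := hm.eps_nonneg hR
  have hε' : ε ≤ 1 / 1000 := by linarith
  have := norm_sub_le_of_deriv_le_unitInterval (s := 0) (t := 1)
    (fun s hs => (h.clock s hs).sub (h'.clock s hs)) (C := 16 * ε / R * ‖y - y'‖) ?_
    (by simp) (by simp)
  · rw [Real.norm_eq_abs] at this
    refine le_trans (le_of_eq ?_) this
    congr 1
    simp only [Pi.sub_apply]
    ring
  · intro s hs
    have h1 := (hm.lapse_mem hε' (h.curve.mem s hs)).2
    have h2 := (hm.lapse_mem hε' (h'.curve.mem s hs)).2
    have h3 := hm.lapse.lip (h.curve.mem s hs) (h'.curve.mem s hs)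
    have h4 := (hm.ray_compare hR hε h h' hs).1
    have h5 : (m.lapse (γ s))⁻¹ - (m.lapse (γ' s))⁻¹
        = -(m.lapse (γ s) - m.lapse (γ' s)) / (m.lapse (γ s) * m.lapse (γ' s)) := by
      have : m.lapse (γ s) ≠ 0 := by positivity
      have : m.lapse (γ' s) ≠ 0 := by positivity
      field_simp
      ring
    have h6 : 1 / 2 ≤ m.lapse (γ s) * m.lapse (γ' s) := by nlinarith
    rw [h5, Real.norm_eq_abs, abs_div, abs_neg, abs_of_pos (show 0 < m.lapse (γ s) *
      m.lapse (γ' s) by linarith), div_le_iff₀ (by linarith)]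
    calc |m.lapse (γ s) - m.lapse (γ' s)| ≤ 4 * ε / R * (2 * ‖y - y'‖) := h3.trans (by gcongr)
      _ = 16 * ε / R * ‖y - y'‖ * (1 / 2) := by ring
      _ ≤ _ := by gcongr

/-- The squared travel time from a fixed point differs from the squared Euclidean distance by a
function with a small Lipschitz constant. -/
theorem IsGentle.travelTime_sq_sub_le {a y y' : Space} {T T' : ℝ}
    (h : m.HasTravelTime (Metric.ball x R) a y T)
    (h' : m.HasTravelTime (Metric.ball x R) a y' T') :
    |(T ^ 2 - ‖y - a‖ ^ 2) - (T' ^ 2 - ‖y' - a‖ ^ 2)|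
      ≤ 2000000 * ε * (‖y - a‖ + ‖y' - a‖) * ‖y - y'‖ := by
  obtain ⟨γ, v, J, h, rfl⟩ := h
  obtain ⟨γ', v', J', h', rfl⟩ := h'
  have h0 := hm.eps_nonneg hR
  have hε' : ε ≤ 1 / 1000 := by linarith
  have hz : (0 : ℝ) ∈ Set.Icc (0 : ℝ) 1 := by simp
  have hI := abs_le.1 (hm.clock_sub_le hR hε h)
  have hI' := abs_le.1 (hm.clock_sub_le hR hε h')
  have hII := hm.clock_sub_clock_le hR hε h h'
  obtain ⟨hv, hvu⟩ := hm.ray_velocity hR hε h hz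
  obtain ⟨hv', hvu'⟩ := hm.ray_velocity hR hε h' hz
  obtain ⟨-, hvv1, hvv⟩ := hm.ray_compare hR hε h h' hz
  have ha : a ∈ Metric.ball x R := h.source ▸ h.curve.mem 0 hz
  have hy' : y' ∈ Metric.ball x R := h'.target ▸ h'.curve.mem 1 (by simp)
  have hu' : ‖y' - a‖ ≤ 2 * R := by
    rw [mem_ball_iff_norm] at ha hy'
    have e : y' - a = (y' - x) - (a - x) := by abel
    rw [e]
    exact (norm_sub_le _ _).trans (by linarith)
  have hP := Real.sq_sqrt
    (x := m.kinetic (γ 0) (v 0)) (by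
      have := (abs_le.1 (hm.abs_kinetic_sub_le hR hε' (h.curve.mem 0 hz) (v 0))).1
      nlinarith [sq_nonneg ‖v 0‖])
  have hP' := Real.sq_sqrt
    (x := m.kinetic (γ' 0) (v' 0)) (by
      have := (abs_le.1 (hm.abs_kinetic_sub_le hR hε' (h'.curve.mem 0 hz) (v' 0))).1
      nlinarith [sq_nonneg ‖v' 0‖])
  simp only [rayTime, mul_pow]
  rw [hP, hP', h.source, h'.source]
  have hN := hm.kinetic_sub_le hR hε' ha (v 0) (v' 0)
  have hK' := abs_le.1 (hm.abs_kinetic_sub_le hR hε' ha (v' 0))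
  have hvv2 := abs_norm_sub_norm_le (v 0) (v' 0)
  -- The squared travel time is kinetic energy times squared clock increment. Three small
  -- discrepancies are combined: kinetic form against Euclidean norm, clock increment against `1`,
  -- and initial velocity against the chord, the last one treated in the `calc` below.
  refine abs_mul_sq_sub_le hR h0 hε hv hv' (norm_nonneg _) (norm_nonneg _) hu' hI hI' hII
    (norm_nonneg _) (hvv2.trans hvv) (hN.trans (by gcongr)) hK' ?_
  calc _ ≤ 400000 * ε * ‖y - y'‖ * (3 * (‖y - a‖ + ‖y' - a‖))
        + 12000 * ε * ‖y' - a‖ * (3 * ‖y - y'‖) := by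
        have := norm_nonneg (y' - a)
        have := norm_nonneg (y - a)
        refine abs_norm_sq_sub_sub_le ?_ ?_ hvu' ?_
        · rw [sub_sub_sub_cancel_right]
          exact hvv1
        · exact (norm_add_le _ _).trans (by linarith)
        · rw [sub_sub_sub_cancel_right]
          exact (norm_add_le _ _).trans (by linarith)
    _ ≤ 1200000 * (ε * ((‖y - a‖ + ‖y' - a‖) * ‖y - y'‖))
        + 36000 * (ε * ((‖y - a‖ + ‖y' - a‖) * ‖y - y'‖)) := by
        have : ε * (‖y' - a‖ * ‖y - y'‖) ≤ ε * ((‖y - a‖ + ‖y' - a‖) * ‖y - y'‖) := by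
          gcongr
          exact le_add_of_nonneg_left (norm_nonneg _)
        linarith
    _ = 1236000 * ε * ((‖y - a‖ + ‖y' - a‖) * ‖y - y'‖) := by ring

/-- The Lipschitz estimate with `y = y'` makes the squares equal, and travel times are nonnegative.
-/
theorem IsGentle.travelTime_unique {a y : Space} {T T' : ℝ}
    (h : m.HasTravelTime (Metric.ball x R) a y T)
    (h' : m.HasTravelTime (Metric.ball x R) a y T') : T = T' := by
  have h1 := hm.travelTime_sq_sub_le hR hε h h'
  simp only [sub_self, norm_zero, mul_zero, sub_sub_sub_cancel_right] at h1
  have h2 := sub_eq_zero.1 (abs_nonpos_iff.1 h1)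
  exact (pow_left_inj₀ (hm.travelTime_nonneg hR hε h) (hm.travelTime_nonneg hR hε h')
    two_ne_zero).1 h2

/-- The Lipschitz estimate with `y' = a`, where the travel time and the distance both vanish. -/
theorem IsGentle.abs_travelTime_sq_sub_le {a y : Space} {T : ℝ}
    (h : m.HasTravelTime (Metric.ball x R) a y T) :
    |T ^ 2 - ‖y - a‖ ^ 2| ≤ 2000000 * ε * ‖y - a‖ ^ 2 := by
  have ha : a ∈ Metric.ball x R := by
    obtain ⟨γ, v, J, h, -⟩ := h
    exact h.source ▸ h.curve.mem 0 (by simp)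
  have h1 := hm.travelTime_sq_sub_le hR hε h (hm.travelTime_self hR hε ha)
  simp only [sub_self, norm_zero, add_zero] at h1
  norm_num at h1
  exact h1.trans (le_of_eq (by ring))

end Ray

end StaticCoefficients

/-! ### From functions on spacetime to functions on space -/

/-- The spatial position of an event. -/
noncomputable def spatial (q : Event) : Space := WithLp.toLp 2 fun i => q i.succ

/-- The event at the time `t` and the position `p`. -/
def atTime (t : ℝ) (p : Space) : Event := Fin.cons t fun i => p i

/-- The time slice `x⁰ = 0`. -/
noncomputable def slice : Space →L[ℝ] Event :=
  ContinuousLinearMap.pi (Fin.cons 0 fun i => (EuclideanSpace.proj i : Space →L[ℝ] ℝ))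

@[simp] theorem spatial_apply (q : Event) (i : Fin 3) : spatial q i = q i.succ := rfl

@[simp] theorem atTime_zero (t : ℝ) (p : Space) : atTime t p 0 = t := rfl

@[simp] theorem atTime_succ (t : ℝ) (p : Space) (i : Fin 3) : atTime t p i.succ = p i := rfl

@[simp] theorem slice_zero (p : Space) : slice p 0 = 0 := rfl

@[simp] theorem slice_succ (p : Space) (i : Fin 3) : slice p i.succ = p i := rfl

@[simp] theorem spatial_atTime (t : ℝ) (p : Space) : spatial (atTime t p) = p := by
  ext i; simp

@[simp] theorem spatial_slice (p : Space) : spatial (slice p) = p := by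
  ext i; simp

theorem atTime_spatial (q : Event) : atTime (q 0) (spatial q) = q := by
  ext μ; refine Fin.cases ?_ (fun i => ?_) μ <;> simp

theorem event_ext {P Q : Event} (h0 : P 0 = Q 0) (h : spatial P = spatial Q) : P = Q := by
  rw [← atTime_spatial P, ← atTime_spatial Q, h0, h]

theorem update_zero_eq_slice (q : Event) : Function.update q 0 0 = slice (spatial q) := by
  ext μ; refine Fin.cases ?_ (fun i => ?_) μ <;> simp

theorem slice_eq_sum (w : Space) : slice w = ∑ k : Fin 3, w k • (Pi.single k.succ 1 : Event) := by
  ext μ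
  refine Fin.cases ?_ (fun i => ?_) μ
  · simp [Finset.sum_apply, (Fin.succ_ne_zero _).symm]
  · simp [Finset.sum_apply, Pi.single_apply]

theorem mem_tube_iff {x : Fin 3 → ℝ} {R : ℝ} (hR : 0 < R) (q : Event) :
    q ∈ tube x R ↔ spatial q ∈ Metric.ball (WithLp.toLp 2 x : Space) R := by
  rw [mem_ball_iff_norm, ← sq_lt_sq₀ (norm_nonneg _) hR.le, EuclideanSpace.norm_sq_eq]
  simp [tube, hR]

theorem isOpen_tube {x : Fin 3 → ℝ} {R : ℝ} : IsOpen (tube x R) := by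
  refine IsOpen.and ?_ isOpen_const
  exact isOpen_lt (by fun_prop) continuous_const

theorem hasFDerivAt_comp_slice {f : Event → ℝ} {p : Space} (hf : DifferentiableAt ℝ f (slice p)) :
    HasFDerivAt (fun p => f (slice p))
      (∑ k : Fin 3, partialDeriv k.succ f (slice p) • (EuclideanSpace.proj k : Space →L[ℝ] ℝ))
      p := by
  refine (hf.hasFDerivAt.comp p slice.hasFDerivAt).congr_fderiv ?_
  ext w
  simp only [ContinuousLinearMap.comp_apply, slice_eq_sum, map_sum, map_smul, smul_eq_mul]
  simp [partialDeriv, mul_comm]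

theorem contDiffOn_partialDeriv {f : Event → ℝ} {V : Set Event} (hV : IsOpen V)
    (hf : ContDiffOn ℝ ∞ f V) (μ : Fin 4) : ContDiffOn ℝ ∞ (partialDeriv μ f) V :=
  (hf.fderiv_of_isOpen hV (m := ∞) (by simp)).clm_apply contDiffOn_const

section Stationary

variable {f : Event → ℝ} {V : Set Event}

theorem partialDeriv_zero_of_stationary (hV : IsOpen V) (hf : ContDiffOn ℝ ∞ f V)
    (hs : ∀ q ∈ V, ∀ t, f (Function.update q 0 t) = f q) {q : Event} (hq : q ∈ V) :
    partialDeriv 0 f q = 0 := by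
  have hd : DifferentiableAt ℝ f q :=
    ((hf q hq).contDiffAt (hV.mem_nhds hq)).differentiableAt (by simp)
  have h1 : HasDerivAt (fun t : ℝ => Function.update q 0 t) (Pi.single 0 1) (q 0) :=
    hasDerivAt_update q 0 (q 0)
  have h2 := HasFDerivAt.comp_hasDerivAt (q 0) (f := fun t : ℝ => Function.update q 0 t)
    (by simpa using hd.hasFDerivAt) h1
  have h3 : (f ∘ fun t : ℝ => Function.update q 0 t) = fun _ => f q := funext fun t => hs q hq t
  rw [h3] at h2
  exact h2.unique (hasDerivAt_const _ _)

/-- Translation in time carries a neighbourhood of the point in the slice `x⁰ = 0` to one of `q` and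
leaves `f` unchanged there. The coefficients of a static metric, read off on the slice, thus also
yield its derivatives at all times. -/
theorem partialDeriv_eq_slice (hV : IsOpen V)
    (hs : ∀ q ∈ V, ∀ t, f (Function.update q 0 t) = f q)
    (hslice : ∀ q ∈ V, slice (spatial q) ∈ V) {q : Event} (hq : q ∈ V) (μ : Fin 4) :
    partialDeriv μ f q = partialDeriv μ f (slice (spatial q)) := by
  set c : Event := Pi.single 0 (q 0) with hc
  have hqc : slice (spatial q) + c = q := by
    ext ν; refine Fin.cases ?_ (fun i => ?_) ν <;> simp [hc, Fin.succ_ne_zero]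
  have h1 : (fun r => f (r + c)) =ᶠ[nhds (slice (spatial q))] f := by
    filter_upwards [hV.mem_nhds (hslice q hq)] with r hr
    have : r + c = Function.update r 0 (r 0 + q 0) := by
      ext ν; refine Fin.cases ?_ (fun i => ?_) ν <;> simp [hc, Fin.succ_ne_zero]
    rw [this, hs r hr]
  have h2 := h1.fderiv_eq (𝕜 := ℝ)
  rw [fderiv_comp_add_right, hqc] at h2
  rw [partialDeriv, partialDeriv, h2]

theorem partialDeriv_eq_zero_of_eqOn (hV : IsOpen V) (hs : ∀ q ∈ V, f q = 0) {q : Event}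
    (hq : q ∈ V) (μ : Fin 4) : partialDeriv μ f q = 0 := by
  have h1 : f =ᶠ[nhds q] fun _ => 0 := by
    filter_upwards [hV.mem_nhds hq] with r hr using hs r hr
  rw [partialDeriv, h1.fderiv_eq]
  simp

end Stationary

/-- The coefficients of a static metric, as functions on space. -/
noncomputable def staticCoefficients (g : MetricField) : StaticCoefficients where
  lapse p := -g (slice p) 0 0
  metric i j p := g (slice p) i.succ j.succ
  dLapse k p := -partialDeriv k.succ (fun r => g r 0 0) (slice p)
  dMetric k i j p := partialDeriv k.succ (fun r => g r i.succ j.succ) (slice p)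

section Gentle

variable {x : Fin 3 → ℝ} {R ε : ℝ} {g : MetricField}

/-- The bound on second derivatives becomes, by the mean value inequality on the ball, a Lipschitz
bound on first derivatives; this is the only form in which curvature enters. -/
theorem isGentleFunction_comp_slice {f : Event → ℝ} {c : ℝ} (hR : 0 < R)
    (hf : ContDiffOn ℝ ∞ f (tube x R)) (h0 : ∀ q ∈ tube x R, |f q - c| ≤ ε)
    (h1 : ∀ q ∈ tube x R, ∀ α, R * |partialDeriv α f q| ≤ ε)
    (h2 : ∀ q ∈ tube x R, ∀ α β, R ^ 2 * |partialDeriv α (partialDeriv β f) q| ≤ ε) :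
    IsGentleFunction (fun p => f (slice p)) (fun k p => partialDeriv k.succ f (slice p))
      (WithLp.toLp 2 x) R ε c := by
  have hmem : ∀ p ∈ Metric.ball (WithLp.toLp 2 x : Space) R, slice p ∈ tube x R := fun p hp => by
    rw [mem_tube_iff hR]; simpa using hp
  have hε : 0 ≤ ε := (abs_nonneg _).trans
    (h0 _ (hmem (WithLp.toLp 2 x) (Metric.mem_ball_self hR)))
  have hdiff : ∀ f : Event → ℝ, ContDiffOn ℝ ∞ f (tube x R) →
      ∀ p ∈ Metric.ball (WithLp.toLp 2 x : Space) R, DifferentiableAt ℝ f (slice p) :=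
    fun f hf p hp => ((hf _ (hmem p hp)).contDiffAt
      (isOpen_tube.mem_nhds (hmem p hp))).differentiableAt (by simp)
  refine ⟨fun p hp => hasFDerivAt_comp_slice (hdiff f hf p hp), fun p hp => h0 _ (hmem p hp),
    fun p hp k => ?_, fun p hp p' hp' k => ?_⟩
  · rw [le_div_iff₀ hR, mul_comm]
    exact h1 _ (hmem p hp) _
  · refine (convex_ball _ R).norm_image_sub_le_of_norm_hasFDerivWithin_le (𝕜 := ℝ)
      (f := fun p => partialDeriv k.succ f (slice p)) (fun q hq => (hasFDerivAt_comp_slice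
        (hdiff _ (contDiffOn_partialDeriv isOpen_tube hf k.succ) q hq)).hasFDerivWithinAt)
      (fun q hq => ?_) hp' hp
    refine ContinuousLinearMap.opNorm_le_bound _ (by positivity) fun w => ?_
    have e : (∑ j : Fin 3, partialDeriv j.succ (partialDeriv k.succ f) (slice q) •
        (EuclideanSpace.proj j : Space →L[ℝ] ℝ)) w
        = ∑ j : Fin 3, partialDeriv j.succ (partialDeriv k.succ f) (slice q) * w j := by
      simp
    rw [e, Real.norm_eq_abs]
    refine (Space.abs_sum_le (η := ε / R ^ 2) (fun j => ?_) w).trans ?_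
    · rw [le_div_iff₀ (by positivity), mul_comm]
      exact h2 _ (hmem q hq) _ _
    · rw [mul_div_assoc]
      gcongr
      norm_num

theorem partialDeriv_neg (μ : Fin 4) (f : Event → ℝ) :
    partialDeriv μ (fun r => -f r) = fun q => -partialDeriv μ f q := by
  funext q
  rw [partialDeriv, partialDeriv, fderiv_fun_neg]
  rfl

theorem staticCoefficients_isGentle (hR : 0 < R) (hg : IsStaticMetric (tube x R) g)
    (hε : IsGentle (tube x R) R ε g) :
    (staticCoefficients g).IsGentle (WithLp.toLp 2 x) R ε := by
  refine ⟨?_, fun i j => ?_, fun i j p hp => ?_⟩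
  · have := isGentleFunction_comp_slice (f := fun q => -g q 0 0) (c := 1) (x := x) (ε := ε) hR
      (hg.smooth 0 0).neg (fun q hq => ?_) (fun q hq α => ?_) (fun q hq α β => ?_)
    · simp only [partialDeriv_neg] at this
      exact this
    · have := (hε q hq 0 0).1
      simp only [minkowski, Matrix.diagonal_apply_eq, Matrix.cons_val_zero] at this
      rw [← abs_neg]
      convert this using 2
      ring
    · rw [partialDeriv_neg, abs_neg]
      exact (hε q hq 0 0).2.1 α
    · rw [partialDeriv_neg, partialDeriv_neg, abs_neg]
      exact (hε q hq 0 0).2.2 α β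
  · refine isGentleFunction_comp_slice (f := fun q => g q i.succ j.succ) hR (hg.smooth _ _)
      (fun q hq => ?_) (fun q hq => (hε q hq _ _).2.1) (fun q hq => (hε q hq _ _).2.2)
    have := (hε q hq i.succ j.succ).1
    convert this using 3
    simp only [minkowski, Matrix.diagonal_apply, Fin.succ_inj]
    split_ifs
    · fin_cases i <;> rfl
    · rfl
  · exact hg.symm _ ((mem_tube_iff hR _).2 (by simpa using hp)) _ _

end Gentle

theorem Space.hasDerivWithinAt_iff {f : ℝ → Space} {f' : Space} {S : Set ℝ} {s : ℝ} :
    HasDerivWithinAt f f' S s ↔ ∀ i, HasDerivWithinAt (fun s => f s i) (f' i) S s := by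
  simp only [hasDerivWithinAt_iff_hasFDerivWithinAt, hasFDerivWithinAt_euclidean]
  rfl

/-! ### Null geodesics as lifted light rays -/

section Static

variable {x : Fin 3 → ℝ} {R ε : ℝ} {g : MetricField}

section Components

variable (hR : 0 < R) (hg : IsStaticMetric (tube x R) g) {q : Event} (hq : q ∈ tube x R)

include hR in
theorem slice_spatial_mem_tube {q : Event} (hq : q ∈ tube x R) :
    slice (spatial q) ∈ tube x R := by
  rw [mem_tube_iff hR] at hq ⊢
  simpa using hq

include hg in
theorem IsStaticMetric.stationary_apply (μ ν : Fin 4) :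
    ∀ q ∈ tube x R, ∀ t, g (Function.update q 0 t) μ ν = g q μ ν := fun q hq t => by
  rw [hg.stationary q hq t]

include hg hq

theorem IsStaticMetric.eq_slice : g q = g (slice (spatial q)) := by
  rw [← update_zero_eq_slice, hg.stationary q hq 0]

theorem IsStaticMetric.lapse_eq : g q 0 0 = -(staticCoefficients g).lapse (spatial q) := by
  rw [hg.eq_slice hq]
  simp [staticCoefficients]

theorem IsStaticMetric.metric_eq (i j : Fin 3) :
    g q i.succ j.succ = (staticCoefficients g).metric i j (spatial q) := by
  rw [hg.eq_slice hq]
  rfl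

theorem IsStaticMetric.metricForm_eq (v : Event) :
    metricForm g q v v = -(staticCoefficients g).lapse (spatial q) * v 0 ^ 2
      + ∑ i, ∑ j, (staticCoefficients g).metric i j (spatial q) * spatial v i * spatial v j := by
  have h1 := fun i : Fin 3 => hg.orthogonal q hq i
  have h2 := fun i : Fin 3 => (hg.symm q hq i.succ 0).trans (h1 i)
  simp only [metricForm, Fin.sum_univ_succ (n := 3), h1, h2, hg.lapse_eq hq, hg.metric_eq hq,
    spatial_apply]
  simp
  ring

include hR

omit hR in
theorem IsStaticMetric.partialDeriv_zero (μ ν : Fin 4) :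
    partialDeriv 0 (fun r => g r μ ν) q = 0 :=
  partialDeriv_zero_of_stationary isOpen_tube (hg.smooth μ ν) (hg.stationary_apply μ ν) hq

theorem IsStaticMetric.partialDeriv_lapse (k : Fin 3) :
    partialDeriv k.succ (fun r => g r 0 0) q = -(staticCoefficients g).dLapse k (spatial q) := by
  rw [partialDeriv_eq_slice isOpen_tube (hg.stationary_apply 0 0)
    (fun q hq => slice_spatial_mem_tube hR hq) hq]
  simp [staticCoefficients]

theorem IsStaticMetric.partialDeriv_metric (k i j : Fin 3) :
    partialDeriv k.succ (fun r => g r i.succ j.succ) q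
      = (staticCoefficients g).dMetric k i j (spatial q) := by
  rw [partialDeriv_eq_slice isOpen_tube (hg.stationary_apply _ _)
    (fun q hq => slice_spatial_mem_tube hR hq) hq]
  rfl

omit hR in
theorem IsStaticMetric.partialDeriv_cross (μ : Fin 4) (i : Fin 3) :
    partialDeriv μ (fun r => g r 0 i.succ) q = 0 :=
  partialDeriv_eq_zero_of_eqOn isOpen_tube (fun q hq => hg.orthogonal q hq i) hq μ

omit hR in
theorem IsStaticMetric.partialDeriv_cross' (μ : Fin 4) (i : Fin 3) :
    partialDeriv μ (fun r => g r i.succ 0) q = 0 :=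
  partialDeriv_eq_zero_of_eqOn isOpen_tube
    (fun q hq => (hg.symm q hq i.succ 0).trans (hg.orthogonal q hq i)) hq μ

/-- The geodesic equation of a static metric, split into its time and space components. -/
theorem IsStaticMetric.geodesic_iff (v a : Event) :
    (∀ μ, ∑ ν, g q μ ν * a ν + ∑ α, ∑ β, christoffel g q μ α β * v α * v β = 0) ↔
      ((staticCoefficients g).lapse (spatial q) * a 0
        + (∑ k, (staticCoefficients g).dLapse k (spatial q) * spatial v k) * v 0 = 0) ∧
      ∀ i, ∑ j, (staticCoefficients g).metric i j (spatial q) * spatial a j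
        + ∑ j, ∑ k, (staticCoefficients g).spatialChristoffel i j k (spatial q)
          * spatial v j * spatial v k
        + (staticCoefficients g).dLapse i (spatial q) / 2 * v 0 ^ 2 = 0 := by
  have h1 := fun i : Fin 3 => hg.orthogonal q hq i
  have h2 := fun i : Fin 3 => (hg.symm q hq i.succ 0).trans (h1 i)
  rw [Fin.forall_fin_succ]
  refine and_congr ?_ (forall_congr' fun i => ?_)
  · have e : ∑ ν, g q 0 ν * a ν + ∑ α, ∑ β, christoffel g q 0 α β * v α * v β
        = -((staticCoefficients g).lapse (spatial q) * a 0
        + (∑ k, (staticCoefficients g).dLapse k (spatial q) * spatial v k) * v 0) := by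
      simp only [Fin.sum_univ_succ (n := 3), christoffel, h1, hg.lapse_eq hq,
        hg.partialDeriv_zero hq, hg.partialDeriv_lapse hR hq, hg.partialDeriv_cross hq,
        spatial_apply, Fin.sum_univ_three]
      ring
    rw [e, neg_eq_zero]
  · have e : ∑ ν, g q i.succ ν * a ν + ∑ α, ∑ β, christoffel g q i.succ α β * v α * v β
        = ∑ j, (staticCoefficients g).metric i j (spatial q) * spatial a j
        + ∑ j, ∑ k, (staticCoefficients g).spatialChristoffel i j k (spatial q)
          * spatial v j * spatial v k
        + (staticCoefficients g).dLapse i (spatial q) / 2 * v 0 ^ 2 := by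
      simp only [Fin.sum_univ_succ (n := 3), christoffel, h2, hg.metric_eq hq,
        hg.partialDeriv_zero hq, hg.partialDeriv_lapse hR hq, hg.partialDeriv_cross hq,
        hg.partialDeriv_cross' hq, hg.partialDeriv_metric hR hq, spatial_apply,
        StaticCoefficients.spatialChristoffel, Fin.sum_univ_three]
      ring
    rw [e]

end Components

variable (hR : 0 < R) (hε : ε ≤ 1 / 1000000) (hg : IsStaticMetric (tube x R) g)
  (hgentle : _root_.IsGentle (tube x R) R ε g)

include hR hε hg hgentle

theorem lapse_pos {q : Event} (hq : q ∈ tube x R) :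
    0 < (staticCoefficients g).lapse (spatial q) := by
  have := ((staticCoefficients_isGentle hR hg hgentle).lapse_mem (by linarith)
    ((mem_tube_iff hR q).1 hq)).2
  linarith

/-- The spatial projection of a null geodesic is a light ray. -/
theorem IsNullGeodesic.exists_isRay {γ : Worldline} (hγ : IsNullGeodesic g (tube x R) γ) :
    ∃ w J, (staticCoefficients g).IsRay (Metric.ball (WithLp.toLp 2 x) R) (spatial (γ 0))
      (spatial (γ 1)) (fun s => spatial (γ s)) w J ∧
      ∀ s ∈ Set.Icc (0 : ℝ) 1,
        γ s 0 = Real.sqrt ((staticCoefficients g).kinetic (spatial (γ 0)) (w 0)) * J s := by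
  set m := staticCoefficients g
  have hm : m.IsGentle (WithLp.toLp 2 x) R ε := staticCoefficients_isGentle hR hg hgentle
  obtain ⟨v, a, h⟩ := hγ
  have hε' : ε ≤ 1 / 1000 := by linarith
  have hsp : ∀ {f f' : ℝ → Event} {s : ℝ}, HasDerivWithinAt f (f' s) (Set.Icc 0 1) s →
      HasDerivWithinAt (fun s => spatial (f s)) (spatial (f' s)) (Set.Icc 0 1) s := by
    intro f f' s hf
    rw [hasDerivWithinAt_pi] at hf
    rw [Space.hasDerivWithinAt_iff]
    exact fun i => hf i.succ
  have hnull : ∀ s ∈ Set.Icc (0 : ℝ) 1, m.lapse (spatial (γ s)) * v s 0 ^ 2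
      = ∑ i, ∑ j, m.metric i j (spatial (γ s)) * spatial (v s) i * spatial (v s) j := by
    intro s hs
    obtain ⟨hmem, -, -, -, hn, -⟩ := h s hs
    rw [hg.metricForm_eq hmem] at hn
    linarith
  have hcurve : IsSprayCurve m.acc (Metric.ball (WithLp.toLp 2 x) R)
      (fun s => spatial (γ s)) (fun s => spatial (v s)) := by
    refine ⟨fun s hs => (mem_tube_iff hR _).1 (h s hs).1, fun s hs => hsp (h s hs).2.1,
      fun s hs => ?_⟩
    obtain ⟨hmem, -, hv, hgeo, -, -⟩ := h s hs
    have hacc : spatial (a s) = m.acc (spatial (γ s)) (spatial (v s)) := by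
      refine hm.eq_acc hR hε' ((mem_tube_iff hR _).1 hmem) ?_
      ext i
      have h1 := ((hg.geodesic_iff hR hmem (v s) (a s)).1 hgeo).2 i
      have h2 := hnull s hs
      simp only [StaticCoefficients.mass_apply, StaticCoefficients.force_apply,
        StaticCoefficients.forceCoef, Fin.sum_univ_three] at h1 h2 ⊢
      -- The spatial geodesic equation is multiplied by the lapse, and the null condition eliminates
      -- the square of the time velocity.
      linear_combination m.lapse (spatial (γ s)) * h1 - m.dLapse i (spatial (γ s)) / 2 * h2
    rw [← hacc]
    exact hsp hv
  set E := Real.sqrt (m.kinetic (spatial (γ 0)) (spatial (v 0))) with hE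
  have hv0 : ∀ s ∈ Set.Icc (0 : ℝ) 1, E = m.lapse (spatial (γ s)) * v s 0 := by
    intro s hs
    have h1 := lapse_pos hR hε hg hgentle (h s hs).1
    have h2 := (h s hs).2.2.2.2.2
    have h3 := hm.kinetic_eq hR hε' hcurve hs (t := 0) (by simp)
    rw [hE, h3, StaticCoefficients.kinetic, ← hnull s hs,
      show m.lapse (spatial (γ s)) * (m.lapse (spatial (γ s)) * v s 0 ^ 2)
        = (m.lapse (spatial (γ s)) * v s 0) ^ 2 by ring]
    exact Real.sqrt_sq (mul_pos h1 h2).le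
  have hE0 : 0 < E := by
    rw [hv0 0 (by simp)]
    exact mul_pos (lapse_pos hR hε hg hgentle (h 0 (by simp)).1) (h 0 (by simp)).2.2.2.2.2
  -- Since `E` equals lapse times time velocity along the whole geodesic, `x⁰` divided by `E` is a
  -- primitive of the inverse lapse.
  refine ⟨fun s => spatial (v s), fun s => γ s 0 / E, ⟨hcurve, fun s hs => ?_, rfl, rfl⟩,
    fun s _ => (mul_div_cancel₀ _ hE0.ne').symm⟩
  · have h1 := (hasDerivWithinAt_pi.1 (h s hs).2.1 0).div_const E
    refine h1.congr_deriv ?_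
    have h2 := lapse_pos hR hε hg hgentle (h s hs).1
    have h3 := (h s hs).2.2.2.2.2
    rw [hv0 s hs]
    field_simp

/-- A light ray lifts to a null geodesic with a prescribed initial time. -/
theorem StaticCoefficients.IsRay.isNullGeodesic {a y : Space} (hay : a ≠ y) {γ w : ℝ → Space}
    {J : ℝ → ℝ}
    (h : (staticCoefficients g).IsRay (Metric.ball (WithLp.toLp 2 x) R) a y γ w J) (t : ℝ) :
    IsNullGeodesic g (tube x R) (fun s => atTime
      (t + Real.sqrt ((staticCoefficients g).kinetic (γ 0) (w 0)) * (J s - J 0)) (γ s)) := by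
  set m := staticCoefficients g
  have hm : m.IsGentle (WithLp.toLp 2 x) R ε := staticCoefficients_isGentle hR hg hgentle
  have hε' : ε ≤ 1 / 1000 := by linarith
  have hz : (0 : ℝ) ∈ Set.Icc (0 : ℝ) 1 := by simp
  have hK := hm.kinetic_pos hR hε' (h.curve.mem 0 hz) (hm.ray_velocity_ne_zero hR hε hay h hz)
  set E := Real.sqrt (m.kinetic (γ 0) (w 0)) with hE
  have hE0 : 0 < E := Real.sqrt_pos.2 hK
  have hlift : ∀ {τ : ℝ → ℝ} {τ' : ℝ} {f : ℝ → Space} {f' : Space} {s : ℝ},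
      HasDerivWithinAt τ τ' (Set.Icc 0 1) s → HasDerivWithinAt f f' (Set.Icc 0 1) s →
      HasDerivWithinAt (fun s => atTime (τ s) (f s)) (atTime τ' f') (Set.Icc 0 1) s := by
    intro τ τ' f f' s hτ hf
    rw [Space.hasDerivWithinAt_iff] at hf
    rw [hasDerivWithinAt_pi]
    exact fun μ => Fin.cases hτ hf μ
  have hmem : ∀ τ : ℝ, ∀ s ∈ Set.Icc (0 : ℝ) 1, atTime τ (γ s) ∈ tube x R := by
    intro τ s hs
    rw [mem_tube_iff hR, spatial_atTime]
    exact h.curve.mem s hs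
  have hlapse : ∀ s ∈ Set.Icc (0 : ℝ) 1, 0 < m.lapse (γ s) := by
    intro s hs
    simpa using lapse_pos hR hε hg hgentle (hmem 0 s hs)
  have hnull : ∀ s ∈ Set.Icc (0 : ℝ) 1, m.lapse (γ s) * (E * (m.lapse (γ s))⁻¹) ^ 2
      = ∑ i, ∑ j, m.metric i j (γ s) * w s i * w s j := by
    intro s hs
    have h1 := hm.kinetic_eq hR hε' h.curve hs hz
    have h2 := hlapse s hs
    rw [mul_pow, hE, Real.sq_sqrt hK.le, h1, StaticCoefficients.kinetic]
    field_simp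
  refine ⟨fun s => atTime (E * (m.lapse (γ s))⁻¹) (w s), fun s => atTime
    (E * (-(∑ k, m.dLapse k (γ s) * w s k) / m.lapse (γ s) ^ 2)) (m.acc (γ s) (w s)),
    fun s hs => ?_⟩
  have hl := hlapse s hs
  have hq := hmem (t + E * (J s - J 0)) s hs
  refine ⟨hq, ?_, ?_, ?_, ?_, ?_⟩
  · exact hlift (((h.clock s hs).sub_const (J 0)).const_mul E |>.const_add t)
      (h.curve.pos s hs)
  · exact hlift (((hm.lapse.comp_curve (h.curve.pos s hs) (h.curve.mem s hs)).fun_inv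
      hl.ne').const_mul E) (h.curve.vel s hs)
  · rw [hg.geodesic_iff hR hq]
    simp only [spatial_atTime, atTime_zero]
    refine ⟨by field_simp; ring, fun i => ?_⟩
    have h1 := congrArg (fun u : Space => u i) (hm.mass_acc hR hε' (h.curve.mem s hs) (w s))
    have h2 := hnull s hs
    refine (mul_eq_zero_iff_left hl.ne').1 ?_
    simp only [StaticCoefficients.mass_apply, StaticCoefficients.force_apply,
      StaticCoefficients.forceCoef, Fin.sum_univ_three] at h1 h2 ⊢
    linear_combination h1 + m.dLapse i (γ s) / 2 * h2
  · rw [hg.metricForm_eq hq]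
    simp only [spatial_atTime, atTime_zero]
    linarith [hnull s hs]
  · simp only [atTime_zero]
    positivity

theorem IsNullGeodesic.hasTravelTime {γ : Worldline} (hγ : IsNullGeodesic g (tube x R) γ) :
    (staticCoefficients g).HasTravelTime (Metric.ball (WithLp.toLp 2 x) R) (spatial (γ 0))
      (spatial (γ 1)) (γ 1 0 - γ 0 0) := by
  obtain ⟨w, J, h, hJ⟩ := hγ.exists_isRay hR hε hg hgentle
  refine ⟨_, w, J, h, ?_⟩
  rw [StaticCoefficients.rayTime, hJ 1 (by simp), hJ 0 (by simp)]
  ring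

theorem Signal.hasTravelTime {P Q : Event} (h : Signal g (tube x R) P Q) :
    (staticCoefficients g).HasTravelTime (Metric.ball (WithLp.toLp 2 x) R) (spatial P)
      (spatial Q) (Q 0 - P 0) := by
  obtain ⟨γ, hγ, rfl, rfl⟩ := h
  exact hγ.hasTravelTime hR hε hg hgentle

theorem StaticCoefficients.HasTravelTime.signal {P Q : Event} (hPQ : spatial P ≠ spatial Q)
    (h : (staticCoefficients g).HasTravelTime (Metric.ball (WithLp.toLp 2 x) R) (spatial P)
      (spatial Q) (Q 0 - P 0)) : Signal g (tube x R) P Q := by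
  obtain ⟨γ, w, J, h, hT⟩ := h
  refine ⟨_, h.isNullGeodesic hR hε hg hgentle hPQ (P 0), ?_, ?_⟩
  · refine event_ext ?_ ?_ <;> simp [h.source]
  · rw [StaticCoefficients.rayTime] at hT
    refine event_ext ?_ ?_
    · simp only [atTime_zero]; linarith
    · simp [h.target]

/-- Null geodesics with the same spatial ends and one simultaneous end coincide. -/
theorem IsNullGeodesic.eqOn {γ δ : Worldline} (hγ : IsNullGeodesic g (tube x R) γ)
    (hδ : IsNullGeodesic g (tube x R) δ) (h0 : spatial (γ 0) = spatial (δ 0))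
    (h1 : spatial (γ 1) = spatial (δ 1)) (ht : γ 0 0 = δ 0 0 ∨ γ 1 0 = δ 1 0) :
    Set.EqOn γ δ (Set.Icc 0 1) := by
  have hm := staticCoefficients_isGentle hR hg hgentle
  obtain ⟨w, J, h, hJ⟩ := hγ.exists_isRay hR hε hg hgentle
  obtain ⟨w', J', h', hJ'⟩ := hδ.exists_isRay hR hε hg hgentle
  rw [← h0, ← h1] at h'
  have hu := fun s hs => hm.ray_unique hR hε h h' (s := s) hs
  have hw : w 0 = w' 0 := (hu 0 (by simp)).2
  -- The two clocks are primitives of one function along a common spatial ray, so they differ by a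
  -- constant; agreement in time at one end then spreads to the whole interval.
  have hJJ : ∀ s ∈ Set.Icc (0 : ℝ) 1, ∀ r ∈ Set.Icc (0 : ℝ) 1, J r - J' r = J s - J' s := by
    intro s hs r hr
    have := norm_sub_le_of_deriv_le_unitInterval (C := 0)
      (fun s hs => (h.clock s hs).sub (h'.clock s hs)) (fun s hs => by
        rw [(hu s hs).1, sub_self, norm_zero]) hs hr
    exact sub_eq_zero.1 (norm_le_zero_iff.1 this)
  have key : ∀ s ∈ Set.Icc (0 : ℝ) 1, ∀ r ∈ Set.Icc (0 : ℝ) 1,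
      γ s 0 = δ s 0 → γ r 0 = δ r 0 := by
    intro s hs r hr hsr
    rw [hJ s hs, hJ' s hs, ← h0, ← hw] at hsr
    rw [hJ r hr, hJ' r hr, ← h0, ← hw]
    have := hJJ s hs r hr
    linear_combination hsr + Real.sqrt ((staticCoefficients g).kinetic (spatial (γ 0)) (w 0)) * this
  intro s hs
  refine event_ext ?_ (hu s hs).1
  rcases ht with ht | ht
  · exact key 0 (by simp) s hs ht
  · exact key 1 (by simp) s hs ht

end Static

/-! ### Almost regular tetrahedra with equal travel times -/

theorem abs_norm_sq_sub_sq_le {E : Type*} [NormedAddCommGroup E] {p q p' q' : E} {L r : ℝ}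
    (h : ‖p - q‖ = L) (hr : ‖p' - p‖ + ‖q' - q‖ ≤ r) (hrL : r ≤ L) :
    |‖p' - q'‖ ^ 2 - L ^ 2| ≤ 3 * r * L := by
  have h1 : |‖p' - q'‖ - L| ≤ r := by
    rw [← h]
    refine (abs_norm_sub_norm_le _ _).trans (le_trans ?_ hr)
    rw [show p' - q' - (p - q) = (p' - p) - (q' - q) by abel]
    exact norm_sub_le _ _
  have hr0 : 0 ≤ r := (abs_nonneg _).trans h1
  rw [abs_le] at h1
  have e : ‖p' - q'‖ ^ 2 - L ^ 2 = (‖p' - q'‖ - L) * (‖p' - q'‖ + L) := by ring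
  have hs : 0 ≤ ‖p' - q'‖ + L := by linarith [norm_nonneg (p' - q')]
  have hs3 : ‖p' - q'‖ + L ≤ 3 * L := by linarith [h1.2]
  rw [e, abs_mul, abs_of_nonneg hs]
  calc |‖p' - q'‖ - L| * (‖p' - q'‖ + L) ≤ r * (3 * L) :=
        mul_le_mul (abs_le.2 h1) hs3 hs hr0
    _ = 3 * r * L := by ring

/-- A regular tetrahedron with a prescribed vertex. -/
theorem exists_regular_tetrahedron (X : Space) {L : ℝ} (hL : 0 < L) :
    ∃ e : Fin 4 → Space, e 0 = X ∧ ∀ i j, i ≠ j → ‖e i - e j‖ = L := by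
  -- The tetrahedron is inscribed in a cube of side `l`, its edges being diagonals of the faces.
  set l := L / Real.sqrt 2 with hl
  have hl2 : l ^ 2 * 2 = L ^ 2 := by
    rw [hl, div_pow, Real.sq_sqrt zero_le_two]
    field_simp
  refine ⟨![X, X + WithLp.toLp 2 ![0, l, l], X + WithLp.toLp 2 ![l, 0, l],
    X + WithLp.toLp 2 ![l, l, 0]], rfl, fun i j hij => ?_⟩
  rw [← sq_eq_sq₀ (norm_nonneg _) hL.le, EuclideanSpace.norm_sq_eq, Fin.sum_univ_three]
  fin_cases i <;> fin_cases j <;>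
    first
    | exact absurd rfl hij
    | (simp [sq_abs]; linarith)

/-- The squared distance from the mirror point of `s` in the triangle `p q r` to `p`, for an
almost regular tetrahedron. -/
theorem Space.norm_sq_mirror_sub_vertex (p q r s : Space) :
    ‖(2 / 3 : ℝ) • (p + q + r) - s - p‖ ^ 2 = 2 / 9 * ‖p - q‖ ^ 2 + 2 / 9 * ‖p - r‖ ^ 2
      - 1 / 3 * ‖p - s‖ ^ 2 - 4 / 9 * ‖q - r‖ ^ 2 + 2 / 3 * ‖q - s‖ ^ 2 + 2 / 3 * ‖r - s‖ ^ 2 := by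
  simp only [EuclideanSpace.norm_sq_eq, Fin.sum_univ_three, PiLp.sub_apply, PiLp.add_apply,
    PiLp.smul_apply, smul_eq_mul, Real.norm_eq_abs, sq_abs]
  ring

/-- If all six edges equal `L`, the right-hand side is `8 / 3 * L ^ 2`: a vertex and its mirror
image are about `1.63 * L` apart. -/
theorem Space.norm_sq_mirror_sub_apex (p q r s : Space) :
    ‖(2 / 3 : ℝ) • (p + q + r) - s - s‖ ^ 2 = -(4 / 9) * ‖p - q‖ ^ 2 - 4 / 9 * ‖p - r‖ ^ 2
      - 4 / 9 * ‖q - r‖ ^ 2 + 4 / 3 * ‖p - s‖ ^ 2 + 4 / 3 * ‖q - s‖ ^ 2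
      + 4 / 3 * ‖r - s‖ ^ 2 := by
  simp only [EuclideanSpace.norm_sq_eq, Fin.sum_univ_three, PiLp.sub_apply, PiLp.add_apply,
    PiLp.smul_apply, smul_eq_mul, Real.norm_eq_abs, sq_abs]
  ring

namespace StaticCoefficients

variable {m : StaticCoefficients} {x : Space} {R ε : ℝ} (hR : 0 < R)
  (hm : m.IsGentle x R ε)

include hR hm

/-- The apex of an almost regular tetrahedron can be moved slightly so that its travel times from
the base points are equal to `L`. -/
theorem IsGentle.exists_equidistant {a : Fin 3 → Space} {y₀ : Space} {L τ : ℝ} (hL : 0 < L)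
    (hLR : L ≤ R) (hτ : τ ≤ 1 / 1000) (hετ : 100000000 * ε ≤ τ)
    (ha : ∀ k, ‖a k - x‖ ≤ 9 / 10 * R) (hy₀ : ‖y₀ - x‖ ≤ 17 / 20 * R)
    (hside : ∀ k, |‖y₀ - a k‖ ^ 2 - L ^ 2| ≤ τ / 10 * L ^ 2)
    (hbase : ∀ j k, j ≠ k → |‖a j - a k‖ ^ 2 - L ^ 2| ≤ τ / 10 * L ^ 2) :
    ∃ y, ‖y - y₀‖ ≤ 10 * τ * L ∧ ‖y - x‖ ≤ 9 / 10 * R ∧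
      ∀ k, m.HasTravelTime (Metric.ball x R) (a k) y L := by
  classical
  have h0 := hm.eps_nonneg hR
  have hε : ε ≤ 1 / 1000000 := by linarith
  have hτ0 : 0 ≤ τ := by linarith
  have hnear : ∀ y, ‖y - y₀‖ ≤ 10 * τ * L → ‖y - x‖ ≤ 9 / 10 * R := by
    intro y hy
    have h1 := norm_sub_le_norm_sub_add_norm_sub y y₀ x
    nlinarith
  have hex : ∀ k y, ‖y - y₀‖ ≤ 10 * τ * L →
      ∃ T, m.HasTravelTime (Metric.ball x R) (a k) y T := fun k y hy =>
    hm.exists_travelTime hR hε (ha k) (hnear y hy)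
  -- The squared travel time as a total function; the value `0` is never met in the neighbourhood of
  -- `y₀` where `F` is used, since rays exist there.
  set F : Fin 3 → Space → ℝ := fun k y =>
    if h : ∃ T, m.HasTravelTime (Metric.ball x R) (a k) y T then h.choose ^ 2 else 0 with hF
  have hFT : ∀ k y T, m.HasTravelTime (Metric.ball x R) (a k) y T → F k y = T ^ 2 := by
    intro k y T hT
    have h : ∃ T, m.HasTravelTime (Metric.ball x R) (a k) y T := ⟨T, hT⟩
    simp only [hF, dif_pos h]
    rw [hm.travelTime_unique hR hε h.choose_spec hT]
  have hyy : ‖y₀ - y₀‖ ≤ 10 * τ * L := by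
    rw [sub_self, norm_zero]; positivity
  have hdist0 : ∀ k, ‖y₀ - a k‖ ≤ 11 / 10 * L := by
    intro k
    have h1 := (abs_le.1 (hside k)).2
    refine (abs_le_of_sq_le_sq' ?_ (by positivity)).2
    nlinarith [sq_nonneg L]
  have hdist : ∀ k y, ‖y - y₀‖ ≤ 10 * τ * L → ‖y - a k‖ ≤ 5 / 4 * L := by
    intro k y hy
    have h1 := norm_sub_le_norm_sub_add_norm_sub y y₀ (a k)
    have h2 := hdist0 k
    nlinarith
  have hF₀ : ∀ k, |F k y₀ - ‖y₀ - a k‖ ^ 2| ≤ τ / 10 * L ^ 2 := by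
    intro k
    obtain ⟨T, hT⟩ := hex k y₀ hyy
    rw [hFT k y₀ T hT]
    refine (hm.abs_travelTime_sq_sub_le hR hε hT).trans ?_
    have h1 := hdist0 k
    calc 2000000 * ε * ‖y₀ - a k‖ ^ 2 ≤ 2000000 * ε * (11 / 10 * L) ^ 2 := by gcongr
      _ = 2420000 * ε * L ^ 2 := by ring
      _ ≤ τ / 10 * L ^ 2 := by gcongr; linarith
  have hFlip : ∀ k y y', ‖y - y₀‖ ≤ 10 * τ * L → ‖y' - y₀‖ ≤ 10 * τ * L →
      |(F k y - ‖y - a k‖ ^ 2) - (F k y' - ‖y' - a k‖ ^ 2)| ≤ τ / 10 * L * ‖y - y'‖ := by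
    intro k y y' hy hy'
    obtain ⟨T, hT⟩ := hex k y hy
    obtain ⟨T', hT'⟩ := hex k y' hy'
    rw [hFT k y T hT, hFT k y' T' hT']
    refine (hm.travelTime_sq_sub_le hR hε hT hT').trans ?_
    have h1 := hdist k y hy
    have h2 := hdist k y' hy'
    calc 2000000 * ε * (‖y - a k‖ + ‖y' - a k‖) * ‖y - y'‖
        ≤ 2000000 * ε * (5 / 4 * L + 5 / 4 * L) * ‖y - y'‖ := by gcongr
      _ = 5000000 * ε * L * ‖y - y'‖ := by ring
      _ ≤ τ / 10 * L * ‖y - y'‖ := by gcongr; linarith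
  obtain ⟨y, hy, hFy⟩ := exists_apex (a := a) (y₀ := y₀) (F := F) hL hτ0 hτ
    (show 0 ≤ τ / 10 by positivity) le_rfl hside hbase hF₀ hFlip
  refine ⟨y, hy, hnear y hy, fun k => ?_⟩
  obtain ⟨T, hT⟩ := hex k y hy
  have h1 := hFy k
  rw [hFT k y T hT] at h1
  rwa [← (pow_left_inj₀ (hm.travelTime_nonneg hR hε hT) hL.le two_ne_zero).1 h1]

/-- Among the vertices `b` of a slightly distorted regular tetrahedron one vertex `b n` can be
replaced by a point with travel times equal to `L` from the other vertices. -/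
theorem IsGentle.exists_correction {L r τ : ℝ} (hL : 0 < L) (hLR : L ≤ 3 / 5 * R) (hr0 : 0 ≤ r)
    (hr : 60 * r ≤ τ) (hτ : τ ≤ 1 / 1000) (hετ : 100000000 * ε ≤ τ) {e b : Fin 4 → Space}
    (he0 : e 0 = x) (he : ∀ i j, i ≠ j → ‖e i - e j‖ = L) (hbe : ∀ i, ‖b i - e i‖ ≤ r * L)
    (hb : ∀ i, ‖b i - x‖ ≤ 9 / 10 * R) {n : Fin 4} (hn : n ≠ 0) :
    ∃ y, ‖y - e n‖ ≤ 10 * τ * L ∧ ‖y - x‖ ≤ 9 / 10 * R ∧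
      ∀ i, i ≠ n → m.HasTravelTime (Metric.ball x R) (b i) y L := by
  have hside : ∀ {i j : Fin 4} {p q : Space}, i ≠ j → ‖p - e i‖ ≤ r * L → ‖q - e j‖ ≤ r * L →
      |‖p - q‖ ^ 2 - L ^ 2| ≤ τ / 10 * L ^ 2 := by
    intro i j p q hij hp hq
    refine (abs_norm_sq_sub_sq_le (he i j hij) (add_le_add hp hq) (by nlinarith)).trans ?_
    nlinarith [sq_nonneg L]
  obtain ⟨y, hy, hyx, hyT⟩ := hm.exists_equidistant hR (a := fun k => b (n.succAbove k))
    (y₀ := e n) hL (by linarith) hτ hετ (fun k => hb _)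
    (by rw [← he0, he n 0 hn]; linarith)
    (fun k => hside (Fin.succAbove_ne n k).symm (by rw [sub_self, norm_zero]; positivity) (hbe _))
    (fun j k hjk => hside (fun h => hjk (Fin.succAbove_right_injective h)) (hbe _) (hbe _))
  refine ⟨y, hy, hyx, fun i hi => ?_⟩
  obtain ⟨k, rfl⟩ := Fin.exists_succAbove_eq hi
  exact hyT k

/-- Vertices `1`, `2`, `3` are corrected in this order, vertex `0` staying at `x`. Each correction
uses the current positions of the other three; every pair has the right travel time after its later
member has been corrected, and is not moved again. -/
theorem IsGentle.exists_tetrahedron {L : ℝ} (hL : 0 < L) (hLR : L ≤ 3 / 5 * R)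
    (hε : ε ≤ 1 / 10 ^ 18) :
    ∃ a : Fin 4 → Space, a 0 = x ∧ (∀ i, ‖a i - x‖ ≤ 9 / 10 * R) ∧
      ∀ i j, i ≠ j → m.HasTravelTime (Metric.ball x R) (a i) (a j) L := by
  have h0 := hm.eps_nonneg hR
  have hε' : ε ≤ 1 / 1000000 := hε.trans (by norm_num)
  obtain ⟨e, he0, he⟩ := exists_regular_tetrahedron x hL
  have hex : ∀ i, ‖e i - x‖ ≤ 9 / 10 * R := by
    intro i
    rcases eq_or_ne i 0 with rfl | hi
    · rw [he0, sub_self, norm_zero]; positivity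
    · rw [← he0, he i 0 hi]; linarith
  have hself : ∀ (p : Space) {r : ℝ}, 0 ≤ r → ‖p - p‖ ≤ r * L := fun p r hr => by
    rw [sub_self, norm_zero]; positivity
  -- A correction with tolerance `τ` displaces a vertex by up to `10 * τ * L`, which is an input
  -- error for the next one, where `60 * r ≤ τ` is needed. The tolerances therefore grow by factors
  -- of `1000`, up to the limit `1 / 1000`; the smallest one, with `100000000 * ε ≤ τ`, dictates the
  -- size of `ε`.
  obtain ⟨p, hpe, hpx, hp⟩ := hm.exists_correction hR hL hLR le_rfl (τ := 1 / 1000000000)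
    (by norm_num) (by norm_num) (by linarith) he0 he (fun i => hself _ le_rfl) hex (n := 1)
    (by decide)
  obtain ⟨q, hqe, hqx, hq⟩ := hm.exists_correction hR hL hLR (r := 10 * (1 / 1000000000))
    (by norm_num) (τ := 1 / 1000000) (by norm_num) (by norm_num) (by linarith) he0 he
    (b := ![e 0, p, e 2, e 3])
    (by
      rw [Fin.forall_fin_succ, Fin.forall_fin_succ, Fin.forall_fin_two]
      exact ⟨hself (e 0) (by norm_num), hpe, hself (e 2) (by norm_num), hself (e 3) (by norm_num)⟩)
    (by
      rw [Fin.forall_fin_succ, Fin.forall_fin_succ, Fin.forall_fin_two]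
      exact ⟨hex 0, hpx, hex 2, hex 3⟩) (n := 2) (by decide)
  obtain ⟨r, -, hrx, hr⟩ := hm.exists_correction hR hL hLR (r := 10 * (1 / 1000000))
    (by norm_num) (τ := 1 / 1000) (by norm_num) (by norm_num) (by linarith) he0 he
    (b := ![e 0, p, q, e 3])
    (by
      rw [Fin.forall_fin_succ, Fin.forall_fin_succ, Fin.forall_fin_two]
      exact ⟨hself (e 0) (by norm_num), hpe.trans (by gcongr; norm_num), hqe,
        hself (e 3) (by norm_num)⟩)
    (by
      rw [Fin.forall_fin_succ, Fin.forall_fin_succ, Fin.forall_fin_two]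
      exact ⟨hex 0, hpx, hqx, hex 3⟩) (n := 3) (by decide)
  refine ⟨![e 0, p, q, r], he0, ?_, fun i j hij => ?_⟩
  · rw [Fin.forall_fin_succ, Fin.forall_fin_succ, Fin.forall_fin_two]
    exact ⟨hex 0, hpx, hqx, hrx⟩
  · have h : ∀ i j : Fin 4, i < j → m.HasTravelTime (Metric.ball x R)
        ((![e 0, p, q, r] : Fin 4 → Space) i) ((![e 0, p, q, r] : Fin 4 → Space) j) L := by
      intro i j hij
      fin_cases i <;> fin_cases j <;> first | exact absurd hij (by decide) | skip
      · exact hp 0 (by decide)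
      · exact hq 0 (by decide)
      · exact hr 0 (by decide)
      · exact hq 1 (by decide)
      · exact hr 1 (by decide)
      · exact hr 2 (by decide)
    rcases lt_or_gt_of_ne hij with hlt | hlt
    · exact h i j hlt
    · exact hm.travelTime_symm hR hε' (h j i hlt)

/-- Opposite to a vertex `a d` of a tetrahedron with all travel times equal to `L` there is a
further point, whose travel times from the other three vertices are equal to `L`. -/
theorem IsGentle.exists_fifth_point {L : ℝ} (hL : 0 < L) (hLR : L ≤ 51 / 100 * R)
    (hε : ε ≤ 1 / 10 ^ 18) {a : Fin 4 → Space} (ha0 : a 0 = x)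
    (ha : ∀ i j, i ≠ j → m.HasTravelTime (Metric.ball x R) (a i) (a j) L) (d : Fin 4) :
    (∀ i, ‖a i - x‖ ≤ 9 / 10 * R) ∧
    ∃ y, ‖y - x‖ ≤ 9 / 10 * R ∧ (∀ i, y ≠ a i) ∧
      ∀ i, i ≠ d → m.HasTravelTime (Metric.ball x R) (a i) y L := by
  have h0 := hm.eps_nonneg hR
  have hε' : ε ≤ 1 / 1000000 := hε.trans (by norm_num)
  have hL2 : 0 < L ^ 2 := by positivity
  have hdist : ∀ i j, i ≠ j → |‖a i - a j‖ ^ 2 - L ^ 2| ≤ 1 / 1000000 * L ^ 2 := by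
    intro i j hij
    have h1 := abs_le.1 (hm.abs_travelTime_sq_sub_le hR hε' (ha j i hij.symm))
    have h2 : 2000000 * ε * ‖a i - a j‖ ^ 2 ≤ 1 / 10000000 * ‖a i - a j‖ ^ 2 := by
      gcongr; linarith
    rw [abs_le]
    constructor <;> linarith [h1.1, h1.2]
  have hball : ∀ i, ‖a i - x‖ ≤ 17 / 20 * R := by
    intro i
    rcases eq_or_ne i 0 with rfl | hi
    · rw [ha0, sub_self, norm_zero]; positivity
    · have h1 := (abs_le.1 (hdist i 0 hi)).2
      rw [ha0] at h1
      refine (abs_le_of_sq_le_sq' ?_ (by positivity)).2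
      nlinarith
  refine ⟨fun i => (hball i).trans (by linarith), ?_⟩
  -- Twice the centroid of the face opposite to `a d`, minus `a d`: for a regular tetrahedron, the
  -- reflection of `a d` in that face.
  set y₀ : Space := (2 / 3 : ℝ) • (a (d.succAbove 0) + a (d.succAbove 1) + a (d.succAbove 2)) - a d
    with hy₀
  have hd : ∀ j k : Fin 3, j ≠ k →
      |‖a (d.succAbove j) - a (d.succAbove k)‖ ^ 2 - L ^ 2| ≤ 1 / 1000000 * L ^ 2 := fun j k hjk =>
    hdist _ _ (fun h => hjk (Fin.succAbove_right_injective h))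
  have hdd : ∀ j : Fin 3, |‖a (d.succAbove j) - a d‖ ^ 2 - L ^ 2| ≤ 1 / 1000000 * L ^ 2 :=
    fun j => hdist _ _ (Fin.succAbove_ne d j)
  have h01 := abs_le.1 (hd 0 1 (by decide))
  have h02 := abs_le.1 (hd 0 2 (by decide))
  have h12 := abs_le.1 (hd 1 2 (by decide))
  have h0d := abs_le.1 (hdd 0)
  have h1d := abs_le.1 (hdd 1)
  have h2d := abs_le.1 (hdd 2)
  have hside : ∀ k : Fin 3, |‖y₀ - a (d.succAbove k)‖ ^ 2 - L ^ 2| ≤ 1 / 100000 * L ^ 2 := by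
    have h10 := norm_sub_rev (a (d.succAbove 1)) (a (d.succAbove 0))
    have h20 := norm_sub_rev (a (d.succAbove 2)) (a (d.succAbove 0))
    have h21 := norm_sub_rev (a (d.succAbove 2)) (a (d.succAbove 1))
    have e0 := Space.norm_sq_mirror_sub_vertex (a (d.succAbove 0)) (a (d.succAbove 1))
      (a (d.succAbove 2)) (a d)
    have e1 := Space.norm_sq_mirror_sub_vertex (a (d.succAbove 1)) (a (d.succAbove 0))
      (a (d.succAbove 2)) (a d)
    have e2 := Space.norm_sq_mirror_sub_vertex (a (d.succAbove 2)) (a (d.succAbove 0))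
      (a (d.succAbove 1)) (a d)
    rw [h10, show a (d.succAbove 1) + a (d.succAbove 0) + a (d.succAbove 2)
      = a (d.succAbove 0) + a (d.succAbove 1) + a (d.succAbove 2) by abel] at e1
    rw [h20, h21, show a (d.succAbove 2) + a (d.succAbove 0) + a (d.succAbove 1)
      = a (d.succAbove 0) + a (d.succAbove 1) + a (d.succAbove 2) by abel] at e2
    rw [← hy₀] at e0 e1 e2
    intro k
    rw [abs_le]
    fin_cases k
    · change _ ≤ ‖y₀ - a (d.succAbove 0)‖ ^ 2 - L ^ 2 ∧ ‖y₀ - a (d.succAbove 0)‖ ^ 2 - L ^ 2 ≤ _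
      rw [e0]
      constructor <;> linarith
    · change _ ≤ ‖y₀ - a (d.succAbove 1)‖ ^ 2 - L ^ 2 ∧ ‖y₀ - a (d.succAbove 1)‖ ^ 2 - L ^ 2 ≤ _
      rw [e1]
      constructor <;> linarith
    · change _ ≤ ‖y₀ - a (d.succAbove 2)‖ ^ 2 - L ^ 2 ∧ ‖y₀ - a (d.succAbove 2)‖ ^ 2 - L ^ 2 ≤ _
      rw [e2]
      constructor <;> linarith
  have hopp := Space.norm_sq_mirror_sub_apex (a (d.succAbove 0)) (a (d.succAbove 1))
    (a (d.succAbove 2)) (a d)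
  rw [← hy₀] at hopp
  have hbounds : ∀ i, 9 / 10 * L ^ 2 ≤ ‖y₀ - a i‖ ^ 2 ∧ ‖y₀ - a i‖ ^ 2 ≤ 27 / 10 * L ^ 2 := by
    intro i
    rcases eq_or_ne i d with rfl | hi
    · rw [hopp]
      constructor <;> linarith
    · obtain ⟨k, rfl⟩ := Fin.exists_succAbove_eq hi
      have := abs_le.1 (hside k)
      constructor <;> linarith [this.1, this.2]
  -- Here the size of the tube matters. If the omitted vertex is the one at `x`, its mirror image is
  -- the farthest point needed; it fits because `27 / 10 * (51 / 100) ^ 2 < (17 / 20) ^ 2`.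
  have hy₀x : ‖y₀ - x‖ ≤ 17 / 20 * R := by
    have h1 := (hbounds 0).2
    rw [ha0] at h1
    refine (abs_le_of_sq_le_sq' ?_ (by positivity)).2
    nlinarith
  obtain ⟨y, hy, hyx, hyT⟩ := hm.exists_equidistant hR (a := fun k => a (d.succAbove k))
    (y₀ := y₀) hL (by linarith) (τ := 1 / 1000) le_rfl (by linarith)
    (fun k => (hball _).trans (by linarith)) hy₀x
    (fun k => (hside k).trans (by linarith)) (fun j k hjk => (hd j k hjk).trans (by linarith))
  refine ⟨y, hyx, fun i hyi => ?_, fun i hi => ?_⟩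
  · rw [hyi, norm_sub_rev] at hy
    have h1 := (hbounds i).1
    -- The correction moves `y₀` by at most `L / 100`, too little to reach any vertex.
    have h2 : ‖y₀ - a i‖ ^ 2 ≤ (10 * (1 / 1000) * L) ^ 2 := by gcongr
    nlinarith
  · obtain ⟨k, rfl⟩ := Fin.exists_succAbove_eq hi
    exact hyT k

end StaticCoefficients

/-! ### Channels and echo counts -/

section Channels

variable {g : MetricField} {V : Set Event} {A B : Worldline} {Δ : ℝ}

theorem TwoWayChannel.symm (h : TwoWayChannel g V A B Δ) : TwoWayChannel g V B A Δ := by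
  obtain ⟨AB, BA, h1, h2, h3, h4⟩ := h
  exact ⟨BA, AB, h2, h1, h4, h3⟩

theorem RadarLinkable.symm (h : RadarLinkable g V A B) : RadarLinkable g V B A := And.symm h

/-- Every tick of `A` is answered, without delay, at a tick of `B`, and the answer arrives `Δ`
readings later. -/
theorem TwoWayChannel.exists_echo (h : TwoWayChannel g V A B Δ) (m : ℤ) :
    ∃ n : ℤ, Signal g V (A m) (B n) ∧ Signal g V (B n) (A (m + Δ)) := by
  obtain ⟨AB, BA, h1, h2, h3, h4⟩ := h
  obtain ⟨n, n', hn, hleast, hn'⟩ := h3 m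
  obtain ⟨_, k, hk⟩ := h1.nullPhases _ hn
  obtain rfl : n = k := (Prod.ext_iff.1 hk).2
  obtain ⟨r, _, hr, -⟩ := h4 k
  -- The echo condition for `B` at its tick `k` shows that `B` can transmit at `k` itself, so the
  -- least admissible transmission reading is `k`.
  have e : n' = k := le_antisymm (hleast.2 ⟨le_rfl, r, hr⟩) hleast.1.1
  rw [e] at hn'
  exact ⟨k, h1.carried _ hn, h2.carried _ hn'⟩

/-- The set of pairs of integer readings that differ by `d`. -/
def shiftPairs (d : ℤ) : Set (ℝ × ℝ) := {q | ∃ m : ℤ, q = ((m : ℝ), ((m + d : ℤ) : ℝ))}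

theorem isNullPhaseChannel_shiftPairs {d : ℤ}
    (h : ∀ m : ℤ, Signal g V (A m) (B ((m + d : ℤ) : ℝ))) :
    IsNullPhaseChannel g V A B (shiftPairs d) where
  carried := by
    rintro _ ⟨m, rfl⟩
    exact h m
  nullPhases := by
    rintro _ ⟨m, rfl⟩
    exact ⟨m, m + d, rfl⟩
  orderPreserving := by
    rintro _ ⟨m, rfl⟩ _ ⟨k, rfl⟩ hmk
    have hmk' : m < k := Int.cast_lt.1 hmk
    exact Int.cast_lt.2 (by omega)
  repeating := by
    refine ⟨0, d, 1, 1, one_pos, one_pos, fun l => ⟨l, ?_⟩⟩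
    rw [show 0 + l * 1 = l by ring, show d + l * 1 = l + d by ring]

theorem hasEchoCount_shiftPairs (d e m : ℤ) :
    HasEchoCount (shiftPairs d) (shiftPairs e) m ((d + e : ℤ) : ℝ) := by
  refine ⟨((m + d : ℤ) : ℝ), ((m + d : ℤ) : ℝ), ⟨m, rfl⟩,
    ⟨⟨le_rfl, ((m + d + e : ℤ) : ℝ), m + d, rfl⟩, fun s hs => hs.1⟩, m + d, ?_⟩
  push_cast
  rw [add_assoc]

theorem twoWayChannel_of_signals {d e : ℤ} {N : ℕ} (hde : d + e = 2 * N)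
    (hAB : ∀ m : ℤ, Signal g V (A m) (B ((m + d : ℤ) : ℝ)))
    (hBA : ∀ n : ℤ, Signal g V (B n) (A ((n + e : ℤ) : ℝ))) :
    TwoWayChannel g V A B (2 * N) := by
  have e1 : (2 * N : ℝ) = ((d + e : ℤ) : ℝ) := by rw [hde]; push_cast; rfl
  have e2 : (2 * N : ℝ) = ((e + d : ℤ) : ℝ) := by rw [e1, add_comm]
  refine ⟨_, _, isNullPhaseChannel_shiftPairs hAB, isNullPhaseChannel_shiftPairs hBA,
    fun m => ?_, fun m => ?_⟩
  · rw [e1]; exact hasEchoCount_shiftPairs d e m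
  · rw [e2]; exact hasEchoCount_shiftPairs e d m

end Channels

/-- A strictly increasing map that misses no integer cannot advance by more than one per step. -/
theorem Int.eq_add_of_strictMono_of_surjective {f : ℤ → ℤ} (hf : StrictMono f)
    (hs : Function.Surjective f) (n : ℤ) : f n = n + f 0 := by
  have hstep : ∀ n, f (n + 1) = f n + 1 := by
    intro n
    obtain ⟨k, hk⟩ := hs (f n + 1)
    have h1 : f n < f (n + 1) := hf (by omega)
    have h2 : n < k := hf.lt_iff_lt.1 (by omega)
    have h3 : f (n + 1) ≤ f k := hf.monotone (by omega)
    omega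
  induction n with
  | zero => simp
  | succ n ih => rw [hstep, ih]; ring
  | pred n ih =>
    have := hstep (-n - 1)
    rw [sub_add_cancel, ih] at this
    omega

/-! ### Machines at rest and radar -/

section Machines

variable {g : MetricField} {V : Set Event} {A : Worldline} {a : Space}

theorem IsAtRest.spatial_eq {x : Fin 3 → ℝ} (h : IsAtRest A x) (ζ : ℝ) :
    spatial (A ζ) = WithLp.toLp 2 x := by
  ext i
  exact h ζ i

theorem IsOpenMachine.hasDerivAt (hA : IsOpenMachine g V A) (ζ : ℝ) :
    HasDerivAt A (deriv A ζ) ζ :=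
  (hA.smooth.differentiable (by simp) ζ).hasDerivAt

theorem IsOpenMachine.hasDerivAt_time (hA : IsOpenMachine g V A) (ζ : ℝ) :
    HasDerivAt (fun ζ => A ζ 0) (deriv A ζ 0) ζ :=
  hasDerivAt_pi.1 (hA.hasDerivAt ζ) 0

theorem IsOpenMachine.continuous_time (hA : IsOpenMachine g V A) :
    Continuous fun ζ => A ζ 0 :=
  continuous_iff_continuousAt.2 fun ζ => (hA.hasDerivAt_time ζ).continuousAt

theorem IsOpenMachine.strictMono_time (hA : IsOpenMachine g V A) :
    StrictMono fun ζ => A ζ 0 :=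
  strictMono_of_deriv_pos fun ζ => by
    rw [(hA.hasDerivAt_time ζ).deriv]
    exact hA.future ζ

theorem IsOpenMachine.spatial_deriv (hA : IsOpenMachine g V A) (ha : ∀ ζ, spatial (A ζ) = a)
    (ζ : ℝ) : spatial (deriv A ζ) = 0 := by
  ext i
  have h1 : HasDerivAt (fun ζ => A ζ i.succ) (deriv A ζ i.succ) ζ :=
    hasDerivAt_pi.1 (hA.hasDerivAt ζ) i.succ
  have h2 : (fun ζ => A ζ i.succ) = fun _ => a i := by
    funext ζ
    rw [← ha ζ, spatial_apply]
  rw [h2] at h1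
  exact h1.unique (hasDerivAt_const _ _)

/-- The clock times of a machine whose ticks are evenly spaced exhaust the time axis. -/
theorem IsOpenMachine.exists_time_eq (hA : IsOpenMachine g V A) {P τ : ℝ} (hP : 0 < P)
    (hτ : ∀ m : ℤ, A m 0 = τ + m * P) (t : ℝ) : ∃ ζ, A ζ 0 = t := by
  refine mem_range_of_exists_le_of_exists_ge hA.continuous_time
    ⟨((⌊(t - τ) / P⌋ : ℤ) : ℝ), ?_⟩ ⟨((⌈(t - τ) / P⌉ : ℤ) : ℝ), ?_⟩
  · have := (le_div_iff₀ hP).1 (Int.floor_le ((t - τ) / P))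
    rw [hτ]; linarith
  · have := (div_le_iff₀ hP).1 (Int.le_ceil ((t - τ) / P))
    rw [hτ]; linarith

/-- The machine at rest at `a` whose clock advances by one while `x⁰` advances by `P`. -/
def restMachine (P τ : ℝ) (a : Space) : Worldline := fun ζ => atTime (τ + ζ * P) a

theorem hasDerivAt_restMachine (P τ : ℝ) (a : Space) (ζ : ℝ) :
    HasDerivAt (restMachine P τ a) (atTime P 0) ζ := by
  refine hasDerivAt_pi.2 fun μ => ?_
  refine Fin.cases ?_ (fun i => ?_) μ
  · simpa [restMachine] using ((hasDerivAt_id ζ).mul_const P).const_add τ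
  · simpa [restMachine] using hasDerivAt_const ζ (a i)

theorem contDiff_restMachine (P τ : ℝ) (a : Space) : ContDiff ℝ ∞ (restMachine P τ a) := by
  refine contDiff_pi.2 fun μ => ?_
  refine Fin.cases ?_ (fun i => ?_) μ
  · simpa [restMachine] using contDiff_const.add (contDiff_id.mul contDiff_const)
  · simpa [restMachine] using contDiff_const

theorem isAtRest_restMachine (P τ : ℝ) (a : Space) : IsAtRest (restMachine P τ a) fun i => a i :=
  fun _ _ => rfl

end Machines

section Static

variable {x : Fin 3 → ℝ} {R ε : ℝ} {g : MetricField}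
variable (hR : 0 < R) (hε : ε ≤ 1 / 1000000) (hg : IsStaticMetric (tube x R) g)
  (hgentle : _root_.IsGentle (tube x R) R ε g)

include hg in
theorem IsStaticMetric.metricForm_of_spatial_eq_zero {q v : Event} (hq : q ∈ tube x R)
    (hv : spatial v = 0) :
    metricForm g q v v = -(staticCoefficients g).lapse (spatial q) * v 0 ^ 2 := by
  rw [hg.metricForm_eq hq, hv]
  simp

include hR hε hg hgentle

theorem isOpenMachine_restMachine {P : ℝ} (hP : 0 < P) (τ : ℝ) {a : Space}
    (ha : a ∈ Metric.ball (WithLp.toLp 2 x : Space) R) :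
    IsOpenMachine g (tube x R) (restMachine P τ a) := by
  have hmem : ∀ ζ, restMachine P τ a ζ ∈ tube x R := fun ζ => by
    rw [mem_tube_iff hR, restMachine, spatial_atTime]; exact ha
  refine ⟨contDiff_restMachine P τ a, hmem, fun ζ => ?_, fun ζ => ?_⟩
  · rw [(hasDerivAt_restMachine P τ a ζ).deriv,
      hg.metricForm_of_spatial_eq_zero (hmem ζ) (by simp)]
    have := lapse_pos hR hε hg hgentle (hmem ζ)
    rw [atTime_zero]
    nlinarith [mul_pos this (pow_pos hP 2)]
  · rw [(hasDerivAt_restMachine P τ a ζ).deriv]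
    exact hP

omit hR hε hgentle in
/-- The proper time of a machine at rest is proportional to the elapsed `x⁰`. -/
theorem properTime_of_rest (c : ℝ) {A : Worldline} {a : Space}
    (hA : IsOpenMachine g (tube x R) A) (ha : ∀ ζ, spatial (A ζ) = a) (r s : ℝ) :
    properTime g c A r s
      = Real.sqrt ((staticCoefficients g).lapse a) / c * (A s 0 - A r 0) := by
  have h1 : ∀ ζ, Real.sqrt (-metricForm g (A ζ) (deriv A ζ) (deriv A ζ))
      = Real.sqrt ((staticCoefficients g).lapse a) * deriv A ζ 0 := by
    intro ζ
    rw [hg.metricForm_of_spatial_eq_zero (hA.mem ζ) (hA.spatial_deriv ha ζ), ha ζ, neg_mul,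
      neg_neg, Real.sqrt_mul' _ (sq_nonneg _), Real.sqrt_sq (hA.future ζ).le]
  have hcont : Continuous fun ζ => deriv A ζ 0 :=
    (continuous_apply 0).comp (hA.smooth.continuous_deriv (by simp))
  rw [properTime]
  simp only [h1]
  rw [intervalIntegral.integral_const_mul,
    intervalIntegral.integral_eq_sub_of_hasDerivAt (fun ζ _ => hA.hasDerivAt_time ζ)
      (hcont.intervalIntegrable _ _)]
  ring

/-- The lapse is constant along a worldline at rest, so a proper period amounts to a constant
advance of `x⁰` from tick to tick. Between ticks the clock may run irregularly. -/
theorem hasProperPeriod_iff {c p : ℝ} (hc : 0 < c) {A : Worldline} {a : Space}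
    (hA : IsOpenMachine g (tube x R) A) (ha : ∀ ζ, spatial (A ζ) = a) :
    HasProperPeriod g c A p ↔ ∀ k : ℤ,
      A (k + 1) 0 = A k 0 + c * p / Real.sqrt ((staticCoefficients g).lapse a) := by
  have hφ : 0 < Real.sqrt ((staticCoefficients g).lapse a) := by
    rw [← ha 0]
    exact Real.sqrt_pos.2 (lapse_pos hR hε hg hgentle (hA.mem 0))
  refine forall_congr' fun k => ?_
  rw [properTime_of_rest hg c hA ha]
  constructor
  · intro h
    rw [← h]; field_simp; ring
  · intro h
    rw [h]; field_simp; ring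

section Radar

variable {A B : Worldline} {a b : Space} (hab : a ≠ b)
  (ha : ‖a - WithLp.toLp 2 x‖ ≤ 9 / 10 * R) (hb : ‖b - WithLp.toLp 2 x‖ ≤ 9 / 10 * R)
  (hB : ∀ ζ, spatial (B ζ) = b) (hBt : ∀ t, ∃ ζ, B ζ 0 = t)

include hab ha hb hB hBt

/-- The clock of `B` meets every time, so the lifted ray from `P` ends on its worldline. Any
competitor has the same spatial ends and the same starting time, hence coincides with it. -/
theorem uniqueNullGeodesic_to_rest {P : Event} (hP : spatial P = a) :
    UniqueNullGeodesic g (tube x R) {P} (Set.range B) := by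
  obtain ⟨T, hT⟩ := (staticCoefficients_isGentle hR hg hgentle).exists_travelTime hR hε ha hb
  obtain ⟨ζ, hζ⟩ := hBt (P 0 + T)
  obtain ⟨γ, hγ, h0, h1⟩ : Signal g (tube x R) P (B ζ) :=
    StaticCoefficients.HasTravelTime.signal hR hε hg hgentle (by rwa [hP, hB])
      (by rwa [hP, hB, hζ, add_sub_cancel_left])
  refine ⟨γ, ⟨hγ, h0, ζ, h1.symm⟩, ?_⟩
  rintro δ hδ hδ0 ⟨ξ, hξ⟩
  refine hδ.eqOn hR hε hg hgentle hγ ?_ ?_ (Or.inl ?_)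
  · rw [h0, Set.mem_singleton_iff.1 hδ0]
  · rw [h1, ← hξ, hB, hB]
  · rw [h0, Set.mem_singleton_iff.1 hδ0]

theorem uniqueNullGeodesic_from_rest {P : Event} (hP : spatial P = a) :
    UniqueNullGeodesic g (tube x R) (Set.range B) {P} := by
  obtain ⟨T, hT⟩ := (staticCoefficients_isGentle hR hg hgentle).exists_travelTime hR hε hb ha
  obtain ⟨ζ, hζ⟩ := hBt (P 0 - T)
  obtain ⟨γ, hγ, h0, h1⟩ : Signal g (tube x R) (B ζ) P :=
    StaticCoefficients.HasTravelTime.signal hR hε hg hgentle (by rw [hP, hB]; exact hab.symm)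
      (by rwa [hP, hB, hζ, sub_sub_cancel])
  refine ⟨γ, ⟨hγ, ⟨ζ, h0.symm⟩, h1⟩, ?_⟩
  rintro δ hδ ⟨ξ, hξ⟩ hδ1
  refine hδ.eqOn hR hε hg hgentle hγ ?_ ?_ (Or.inr ?_)
  · rw [h0, ← hξ, hB, hB]
  · rw [h1, Set.mem_singleton_iff.1 hδ1]
  · rw [h1, Set.mem_singleton_iff.1 hδ1]

theorem radarLinkable_of_rest (hA : ∀ ζ, spatial (A ζ) = a) (hAt : ∀ t, ∃ ζ, A ζ 0 = t) :
    RadarLinkable g (tube x R) A B :=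
  ⟨fun ζ => ⟨uniqueNullGeodesic_from_rest hR hε hg hgentle hab ha hb hB hBt (hA ζ),
      uniqueNullGeodesic_to_rest hR hε hg hgentle hab ha hb hB hBt (hA ζ)⟩,
    fun ζ => ⟨uniqueNullGeodesic_from_rest hR hε hg hgentle hab.symm hb ha hA hAt (hB ζ),
      uniqueNullGeodesic_to_rest hR hε hg hgentle hab.symm hb ha hA hAt (hB ζ)⟩⟩

end Radar

/-- Machines at rest whose ticks mark multiples of a common unit `P` of `x⁰`, and whose travel
time is `N` such units, are linked by a two-way channel with echo counts `2 N`. -/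
theorem twoWayChannel_of_rest {A B : Worldline} {a b : Space} (hab : a ≠ b)
    (hA : ∀ ζ, spatial (A ζ) = a) (hB : ∀ ζ, spatial (B ζ) = b) {τ P : ℝ} {k l : ℤ} {N : ℕ}
    (hAt : ∀ m : ℤ, A m 0 = τ + (m + k : ℤ) * P) (hBt : ∀ m : ℤ, B m 0 = τ + (m + l : ℤ) * P)
    (hT : (staticCoefficients g).HasTravelTime (Metric.ball (WithLp.toLp 2 x) R) a b (N * P)) :
    TwoWayChannel g (tube x R) A B (2 * N) := by
  have hT' := (staticCoefficients_isGentle hR hg hgentle).travelTime_symm hR hε hT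
  -- A signal sent by `A` at its tick `m` arrives at `τ + (m + k + N) * P`, which is the tick `m + k
  -- - l + N` of `B`; in the round trip the phases `k` and `l` cancel.
  refine twoWayChannel_of_signals (d := k - l + N) (e := l - k + N) (by ring)
    (fun m => StaticCoefficients.HasTravelTime.signal hR hε hg hgentle (by rwa [hA, hB]) ?_)
    (fun m => StaticCoefficients.HasTravelTime.signal hR hε hg hgentle
      (by rw [hA, hB]; exact hab.symm) ?_)
  · rw [hA, hB, hAt, hBt]
    convert hT using 1
    push_cast; ring
  · rw [hA, hB, hAt, hBt]
    convert hT' using 1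
    push_cast; ring

end Static

/-! ### Synchronized tetrahedral arrangements -/

section Static

variable {x : Fin 3 → ℝ} {R ε : ℝ} {g : MetricField}
variable (hR : 0 < R) (hε : ε ≤ 1 / 10 ^ 18) (hg : IsStaticMetric (tube x R) g)
  (hgentle : _root_.IsGentle (tube x R) R ε g)

/-- The advance of `x⁰` between successive ticks of a machine at `x` with proper period `p`. -/
noncomputable def tickTime (g : MetricField) (c p : ℝ) (x : Fin 3 → ℝ) : ℝ :=
  c * p / Real.sqrt ((staticCoefficients g).lapse (WithLp.toLp 2 x))

include hR hε hg hgentle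

theorem tickTime_pos {c p : ℝ} (hc : 0 < c) (hp : 0 < p) : 0 < tickTime g c p x := by
  have := ((staticCoefficients_isGentle hR hg hgentle).lapse_mem
    (hε.trans (by norm_num)) (Metric.mem_ball_self hR)).2
  exact div_pos (mul_pos hc hp) (Real.sqrt_pos.2 (by linarith))

/-- The edge `N * P` is at most half of `R`, up to the deviation of the lapse at `x` from `1`. -/
theorem mul_tickTime_le {c p : ℝ} {N : ℕ} (hN : 2 * (c * N * p) ≤ R) :
    N * tickTime g c p x ≤ 51 / 100 * R := by
  have h1 := ((staticCoefficients_isGentle hR hg hgentle).lapse_mem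
    (hε.trans (by norm_num)) (Metric.mem_ball_self hR)).2
  have h2 : 99 / 100 ≤ Real.sqrt ((staticCoefficients g).lapse (WithLp.toLp 2 x)) :=
    Real.le_sqrt_of_sq_le (by linarith)
  rw [tickTime, ← mul_div_assoc, div_le_iff₀ (by linarith)]
  nlinarith

theorem exists_isTetrahedral {c p : ℝ} {N : ℕ} (hc : 0 < c) (hp : 0 < p) (hN : 1 ≤ N)
    (hNR : 2 * (c * N * p) ≤ R) : ∃ M, IsTetrahedral g (tube x R) c p N x M := by
  have hε' : ε ≤ 1 / 1000000 := hε.trans (by norm_num)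
  have hm := staticCoefficients_isGentle hR hg hgentle
  have hP := tickTime_pos hR hε hg hgentle hc hp
  have hLR := mul_tickTime_le hR hε hg hgentle hNR
  set P := tickTime g c p x with hPdef
  have hL : 0 < N * P := mul_pos (by exact_mod_cast hN) hP
  obtain ⟨a, ha0, har, haT⟩ := hm.exists_tetrahedron hR hL (by linarith) hε
  have hab : ∀ i, a i ∈ Metric.ball (WithLp.toLp 2 x : Space) R := fun i => by
    rw [mem_ball_iff_norm]; linarith [har i]
  have hne : ∀ i j, i ≠ j → a i ≠ a j := by
    intro i j hij h
    have h1 := haT i j hij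
    rw [← h] at h1
    exact hL.ne' (hm.travelTime_unique hR hε' h1 (hm.travelTime_self hR hε' (hab i)))
  have hmach : ∀ i, IsOpenMachine g (tube x R) (restMachine P 0 (a i)) := fun i =>
    isOpenMachine_restMachine hR hε' hg hgentle hP 0 (hab i)
  have hsp : ∀ i ζ, spatial (restMachine P 0 (a i) ζ) = a i := fun i ζ => spatial_atTime _ _
  have hsurj : ∀ i t, ∃ ζ, restMachine P 0 (a i) ζ 0 = t := fun i =>
    (hmach i).exists_time_eq hP (τ := 0) fun m => rfl
  refine ⟨fun i => restMachine P 0 (a i), ⟨hmach, fun i => ⟨_, isAtRest_restMachine P 0 (a i)⟩,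
    fun i j hij => ?_, fun i j hij => ?_, fun i j hij => ?_⟩, ?_, ?_⟩
  · rw [Set.disjoint_left]
    rintro _ ⟨ζ, rfl⟩ ⟨ξ, hξ⟩
    refine hne i j hij ?_
    rw [← hsp i ζ, ← hsp j ξ]
    exact congrArg spatial hξ.symm
  · exact radarLinkable_of_rest hR hε' hg hgentle (hne i j hij) (har i) (har j) (hsp j) (hsurj j)
      (hsp i) (hsurj i)
  · refine twoWayChannel_of_rest hR hε' hg hgentle (hne i j hij) (hsp i) (hsp j) (τ := 0)
      (k := 0) (l := 0) (P := P) (fun m => ?_) (fun m => ?_) (haT i j hij)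
    · simp [restMachine]
    · simp [restMachine]
  · have := isAtRest_restMachine P 0 (a 0)
    rwa [ha0] at this ⊢
  · refine (hasProperPeriod_iff hR hε' hg hgentle hc (hmach 0) (hsp 0)).2 fun k => ?_
    simp only [restMachine, atTime_zero, hPdef, tickTime, ha0]
    ring

/-- In a tetrahedral arrangement every machine ticks in step with the machine `0`, and all travel
times are equal to `N` ticks. -/
theorem IsTetrahedral.exists_synchronized {c p : ℝ} {N : ℕ} (hc : 0 < c) (hp : 0 < p)
    {M : Fin 4 → Worldline} (hM : IsTetrahedral g (tube x R) c p N x M) :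
    ∃ (a : Fin 4 → Space) (τ : ℝ) (k : Fin 4 → ℤ), a 0 = WithLp.toLp 2 x ∧
      (∀ i ζ, spatial (M i ζ) = a i) ∧
      (∀ i (m : ℤ), M i m 0 = τ + (m + k i : ℤ) * tickTime g c p x) ∧
      ∀ i j, i ≠ j → (staticCoefficients g).HasTravelTime (Metric.ball (WithLp.toLp 2 x) R)
        (a i) (a j) (N * tickTime g c p x) := by
  have hε' : ε ≤ 1 / 1000000 := hε.trans (by norm_num)
  have hm := staticCoefficients_isGentle hR hg hgentle
  have hP := tickTime_pos hR hε hg hgentle hc hp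
  have hM0 : ∀ ζ, spatial (M 0 ζ) = WithLp.toLp 2 x := hM.position.spatial_eq
  have hstep := (hasProperPeriod_iff hR hε' hg hgentle hc (hM.arrangement.machine 0) hM0).1
    hM.period
  change ∀ k : ℤ, M 0 (k + 1) 0 = M 0 k 0 + tickTime g c p x at hstep
  set P := tickTime g c p x
  set τ := M 0 ((0 : ℤ) : ℝ) 0 with hτ
  have ht0 : ∀ m : ℤ, M 0 m 0 = τ + m * P := by
    intro m
    induction m with
    | zero => simp [hτ]
    | succ m ih => push_cast at ih ⊢; have := hstep m; push_cast at this; rw [this, ih]; ring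
    | pred m ih =>
      have := hstep (-m - 1)
      push_cast at ih this ⊢
      rw [sub_add_cancel, ih] at this
      linarith
  choose r hr using hM.arrangement.atRest
  have hsp : ∀ i ζ, spatial (M i ζ) = WithLp.toLp 2 (r i) := fun i => (hr i).spatial_eq
  -- The travel time between two machines at rest is the same at every tick and in both directions,
  -- so each round trip takes `2 * T` of `x⁰`.
  have hecho : ∀ i j, i ≠ j → ∃ T, (staticCoefficients g).HasTravelTime
      (Metric.ball (WithLp.toLp 2 x) R) (WithLp.toLp 2 (r i)) (WithLp.toLp 2 (r j)) T ∧
      ∀ m : ℤ, ∃ n : ℤ, M j n 0 = M i m 0 + T ∧ M i ((m + 2 * N : ℤ) : ℝ) 0 = M j n 0 + T := by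
    intro i j hij
    have hch := hM.arrangement.channel i j hij
    have hS : ∀ m n : ℝ, Signal g (tube x R) (M i m) (M j n) →
        (staticCoefficients g).HasTravelTime (Metric.ball (WithLp.toLp 2 x) R)
          (WithLp.toLp 2 (r i)) (WithLp.toLp 2 (r j)) (M j n 0 - M i m 0) := fun m n h => by
      rw [← hsp i m, ← hsp j n]
      exact h.hasTravelTime hR hε' hg hgentle
    have hS' : ∀ m n : ℝ, Signal g (tube x R) (M j n) (M i m) →
        (staticCoefficients g).HasTravelTime (Metric.ball (WithLp.toLp 2 x) R)
          (WithLp.toLp 2 (r i)) (WithLp.toLp 2 (r j)) (M i m 0 - M j n 0) := fun m n h => by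
      refine hm.travelTime_symm hR hε' ?_
      rw [← hsp i m, ← hsp j n]
      exact h.hasTravelTime hR hε' hg hgentle
    obtain ⟨n, hn, -⟩ := hch.exists_echo 0
    refine ⟨_, hS _ _ hn, fun m => ?_⟩
    obtain ⟨n', h1, h2⟩ := hch.exists_echo m
    have e1 := hm.travelTime_unique hR hε' (hS _ _ h1) (hS _ _ hn)
    have e2 := hm.travelTime_unique hR hε' (hS' _ _ h2) (hS _ _ hn)
    refine ⟨n', by rw [← e1]; ring, ?_⟩
    rw [← e2]
    push_cast
    ring
  have h0 : ∀ j, j ≠ 0 → (staticCoefficients g).HasTravelTime (Metric.ball (WithLp.toLp 2 x) R)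
      (WithLp.toLp 2 (r 0)) (WithLp.toLp 2 (r j)) (N * P) ∧
      ∀ m : ℤ, ∃ n : ℤ, M j n 0 = M 0 m 0 + N * P := by
    intro j hj
    obtain ⟨T, hT, h⟩ := hecho 0 j hj.symm
    -- A round trip from machine `0` lasts `2 * N` of its ticks, whose length is known to be `P`.
    obtain rfl : T = N * P := by
      obtain ⟨n, h1, h2⟩ := h 0
      rw [h1, ht0, ht0] at h2
      push_cast at h2
      linarith
    refine ⟨hT, fun m => ?_⟩
    obtain ⟨n, h1, -⟩ := h m
    exact ⟨n, h1⟩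
  have hk : ∀ j, ∃ k : ℤ, ∀ n : ℤ, M j n 0 = τ + (n + k : ℤ) * P := by
    intro j
    rcases eq_or_ne j 0 with rfl | hj
    · exact ⟨0, fun n => by rw [ht0, add_zero]⟩
    obtain ⟨hT, h⟩ := h0 j hj
    -- Each tick of `j` sends a signal that reaches machine `0` at an integer tick, so it lies a
    -- whole number of units from `τ`. Conversely every tick of machine `0` reaches a tick of `j`,
    -- so `f` misses no integer and must be a translation.
    have hf : ∀ n : ℤ, ∃ f : ℤ, M j n 0 = τ + f * P := by
      intro n
      obtain ⟨T', hT', h'⟩ := hecho j 0 hj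
      obtain ⟨m, h1, -⟩ := h' n
      have e := hm.travelTime_unique hR hε' (hm.travelTime_symm hR hε' hT') hT
      refine ⟨m - N, ?_⟩
      rw [ht0, e] at h1
      push_cast
      linarith
    choose f hf using hf
    have hmono : StrictMono f := by
      intro n n' hnn'
      have h1 : M j n 0 < M j n' 0 :=
        (hM.arrangement.machine j).strictMono_time (Int.cast_lt.2 hnn')
      rw [hf, hf] at h1
      exact Int.cast_lt.1 (lt_of_mul_lt_mul_right (lt_of_add_lt_add_left h1) hP.le)
    have hsurj : Function.Surjective f := by
      intro m
      obtain ⟨n, hn⟩ := h (m - N)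
      refine ⟨n, ?_⟩
      rw [hf, ht0] at hn
      push_cast at hn
      have h2 : (f n : ℝ) * P = m * P := by linarith
      exact_mod_cast mul_right_cancel₀ hP.ne' h2
    refine ⟨f 0, fun n => ?_⟩
    rw [hf, Int.eq_add_of_strictMono_of_surjective hmono hsurj n]
  choose k hk using hk
  refine ⟨fun i => WithLp.toLp 2 (r i), τ, k, ?_, hsp, hk, fun i j hij => ?_⟩
  · exact (hsp 0 0).symm.trans (hM0 0)
  -- All machines are now known to tick with unit `P`, so the echo count determines the travel time
  -- between any two of them.
  · obtain ⟨T, hT, h⟩ := hecho i j hij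
    obtain ⟨n, h1, h2⟩ := h 0
    rw [h1, hk, hk] at h2
    push_cast at h2
    obtain rfl : T = N * P := by linarith
    exact hT

end Static

/-! ### The fifth machine and the nine channels -/

/-- The complete graph on five vertices without the edge from the last vertex to `d`. -/
def completeGraphMinusEdge (d : Fin 4) : SimpleGraph (Fin 5) :=
  (⊤ : SimpleGraph (Fin 5)).deleteEdges {s(Fin.last 4, d.castSucc)}

theorem completeGraphMinusEdge_castSucc_castSucc {d i j : Fin 4} (hij : i ≠ j) :
    (completeGraphMinusEdge d).Adj i.castSucc j.castSucc := by
  rw [completeGraphMinusEdge, SimpleGraph.deleteEdges_adj]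
  rw [SimpleGraph.top_adj, Set.mem_singleton_iff]
  revert d i j
  decide

theorem completeGraphMinusEdge_last_castSucc {d i : Fin 4} :
    (completeGraphMinusEdge d).Adj (Fin.last 4) i.castSucc ↔ i ≠ d := by
  rw [completeGraphMinusEdge, SimpleGraph.deleteEdges_adj]
  rw [SimpleGraph.top_adj, Set.mem_singleton_iff]
  revert d i
  decide

theorem completeGraphMinusEdge_ncard (d : Fin 4) :
    (completeGraphMinusEdge d).edgeSet.ncard = 9 := by
  rw [completeGraphMinusEdge, SimpleGraph.edgeSet_deleteEdges, Set.ncard_sdiff_singleton_of_mem,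
    ← SimpleGraph.coe_edgeFinset, Set.ncard_coe_finset,
    SimpleGraph.card_edgeFinset_top_eq_card_choose_two]
  · rfl
  · rw [SimpleGraph.mem_edgeSet, SimpleGraph.top_adj]
    exact (Fin.castSucc_lt_last d).ne'

theorem mainTheorem4 :
    ∃ ε : ℝ, 0 < ε ∧ ∀ (c p R : ℝ) (N : ℕ) (x : Fin 3 → ℝ) (g : MetricField),
      0 < c → 0 < p → 1 ≤ N → 2 * (c * N * p) ≤ R →
      IsStaticMetric (tube x R) g → IsGentle (tube x R) R ε g →
      (∃ M : Fin 4 → Worldline, IsTetrahedral g (tube x R) c p N x M) ∧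
      ∀ M : Fin 4 → Worldline, IsTetrahedral g (tube x R) c p N x M →
        ∀ s : Finset (Fin 4), s.card = 3 →
          ∃ (M' : Fin 5 → Worldline) (G : SimpleGraph (Fin 5)),
            (∀ i : Fin 4, M' i.castSucc = M i) ∧
            (∀ i j : Fin 4, i ≠ j → G.Adj i.castSucc j.castSucc) ∧
            (∀ i : Fin 4, G.Adj (Fin.last 4) i.castSucc ↔ i ∈ s) ∧
            G.edgeSet.ncard = 9 ∧
            IsArrangement g (tube x R) M' G (2 * N) := by
  -- The three successive corrections in `exists_tetrahedron`, starting from tolerance `1 /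
  -- 1000000000`, require `100000000 * ε` below it; `1 / 10 ^ 18` leaves a factor of ten.
  refine ⟨1 / 10 ^ 18, by norm_num, fun c p R N x g hc hp hN hNR hg hgentle => ?_⟩
  have hN0 : (0 : ℝ) < N := by exact_mod_cast hN
  have hR : 0 < R := lt_of_lt_of_le (by positivity) hNR
  have hε : (1 / 10 ^ 18 : ℝ) ≤ 1 / 10 ^ 18 := le_rfl
  have hε' : (1 / 10 ^ 18 : ℝ) ≤ 1 / 1000000 := by norm_num
  refine ⟨exists_isTetrahedral hR hε hg hgentle hc hp hN hNR, fun M hM s hs => ?_⟩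
  have hm := staticCoefficients_isGentle hR hg hgentle
  have hP := tickTime_pos hR hε hg hgentle hc hp
  have hLR := mul_tickTime_le hR hε hg hgentle hNR
  obtain ⟨a, τ, k, ha0, hsp, hk, haT⟩ := hM.exists_synchronized hR hε hg hgentle hc hp
  set P := tickTime g c p x
  obtain ⟨d, hd⟩ : ∃ d, sᶜ = {d} := by
    rw [← Finset.card_eq_one, Finset.card_compl, hs, Fintype.card_fin]
  have hmem : ∀ i, i ∈ s ↔ i ≠ d := fun i => by
    rw [← not_iff_not, not_not, ← Finset.mem_compl, hd, Finset.mem_singleton]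
  obtain ⟨har, y, hyx, hya, hyT⟩ :=
    hm.exists_fifth_point hR (mul_pos hN0 hP) hLR hε ha0 haT d
  -- The fifth clock rests at `y` and has the tick length and phase of machine `0`.
  have hmach : IsOpenMachine g (tube x R) (restMachine P τ y) :=
    isOpenMachine_restMachine hR hε' hg hgentle hP τ (by rw [mem_ball_iff_norm]; linarith)
  have hysp : ∀ ζ, spatial (restMachine P τ y ζ) = y := fun ζ => spatial_atTime _ _
  have hyt : ∀ m : ℤ, restMachine P τ y m 0 = τ + m * P := fun m => rfl
  have hsurj : ∀ i t, ∃ ζ, M i ζ 0 = t := fun i =>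
    (hM.arrangement.machine i).exists_time_eq hP (τ := τ + k i * P) fun m => by
      rw [hk]; push_cast; ring
  have hdisj : ∀ i, Disjoint (Set.range (restMachine P τ y)) (Set.range (M i)) := fun i => by
    rw [Set.disjoint_left]
    rintro _ ⟨ζ, rfl⟩ ⟨ξ, hξ⟩
    refine hya i ?_
    rw [← hysp ζ, ← hξ, hsp]
  have hradar : ∀ i, RadarLinkable g (tube x R) (restMachine P τ y) (M i) := fun i =>
    radarLinkable_of_rest hR hε' hg hgentle (hya i) hyx (har i) (hsp i) (hsurj i) hysp
      (hmach.exists_time_eq hP hyt)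
  have hchan : ∀ i, i ≠ d → TwoWayChannel g (tube x R) (restMachine P τ y) (M i) (2 * N) :=
    fun i hi => twoWayChannel_of_rest hR hε' hg hgentle (hya i) hysp (hsp i) (τ := τ) (P := P)
      (k := 0) (l := k i) (fun m => by rw [hyt, add_zero]) (hk i)
      (hm.travelTime_symm hR hε' (hyT i hi))
  have hlast : (Fin.snoc M (restMachine P τ y) : Fin 5 → Worldline) (Fin.last 4)
      = restMachine P τ y := Fin.snoc_last (α := fun _ => Worldline) _ _
  have hcast : ∀ i : Fin 4, (Fin.snoc M (restMachine P τ y) : Fin 5 → Worldline) i.castSucc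
      = M i := fun i => Fin.snoc_castSucc (α := fun _ => Worldline) _ _ i
  refine ⟨Fin.snoc M (restMachine P τ y), completeGraphMinusEdge d, hcast,
    fun i j hij => completeGraphMinusEdge_castSucc_castSucc hij,
    fun i => completeGraphMinusEdge_last_castSucc.trans (hmem i).symm,
    completeGraphMinusEdge_ncard d, ?_⟩
  refine ⟨fun i => ?_, fun i => ?_, fun i j hij => ?_, fun i j hij => ?_, fun i j hij => ?_⟩
  · refine Fin.lastCases ?_ (fun i => ?_) i
    · rwa [hlast]
    · rw [hcast]; exact hM.arrangement.machine i
  · refine Fin.lastCases ?_ (fun i => ?_) i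
    · rw [hlast]; exact ⟨_, isAtRest_restMachine P τ y⟩
    · rw [hcast]; exact hM.arrangement.atRest i
  · induction i using Fin.lastCases with
    | last =>
      induction j using Fin.lastCases with
      | last => exact absurd rfl hij
      | cast j => rw [hlast, hcast]; exact hdisj j
    | cast i =>
      induction j using Fin.lastCases with
      | last => rw [hlast, hcast]; exact (hdisj i).symm
      | cast j =>
        rw [hcast, hcast]
        exact hM.arrangement.distinct i j fun h => hij (congrArg _ h)
  · induction i using Fin.lastCases with
    | last =>
      induction j using Fin.lastCases with
      | last => exact absurd rfl hij
      | cast j => rw [hlast, hcast]; exact hradar j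
    | cast i =>
      induction j using Fin.lastCases with
      | last => rw [hlast, hcast]; exact (hradar i).symm
      | cast j =>
        rw [hcast, hcast]
        exact hM.arrangement.radar i j fun h => hij (congrArg _ h)
  · induction i using Fin.lastCases with
    | last =>
      induction j using Fin.lastCases with
      | last => exact absurd rfl hij.ne
      | cast j =>
        rw [hlast, hcast]
        exact hchan j (completeGraphMinusEdge_last_castSucc.1 hij)
    | cast i =>
      induction j using Fin.lastCases with
      | last =>
        rw [hlast, hcast]
        exact (hchan i (completeGraphMinusEdge_last_castSucc.1 hij.symm)).symm
      | cast j =>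
        rw [hcast, hcast]
        exact hM.arrangement.channel i j fun h => hij.ne (congrArg _ h)
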